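/- Let $M$ be a smooth (Hausdorff) surface, $5\le r\le\infty$, and let $C^r(M,\mathbb R^4)$ carry the $C^r$ topology of uniform convergence of the derivatives of order $\le r$ on compact subsets of charts (a Banach space topology if $M$ is compact and $r<\infty$). Let $\mathcal I^r\subset C^r(M,\mathbb R^4)$ be the set of immersions. For $\mu\in\mathcal I^r$ with first fundamental form $I=E\,dx^2+2F\,dx\,dy+G\,dy^2$ and normal-plane-valued second fundamental form $II=\mathbf e\,dx^2+2\mathbf f\,dx\,dy+\mathbf g\,dy^2$, put $k_n(v)=II(v)/I(v)$ and $H=\frac{E\mathbf g-2F\mathbf f+G\mathbf e}{2(EG-F^2)}$. A point is *axiumbilic* if the ellipse of curvature $\{k_n(v): I(v)=1\}$, which is centred at $H$, has equal axes, i.e. $\|k_n-H\|$ is constant. The differential equation of axial lines is $\mathcal G(x,y,dx,dy)=0$, where $$\mathcal G=[a_0G(EG-4F^2)+a_1F(2F^2-EG)]dy^4+[-8a_0EFG+a_1E(4F^2-EG)]dy^3dx+[-6a_0GE^2+3a_1FE^2]dy^2dx^2+a_1E^3dy\,dx^3+a_0E^3dx^4,$$ $$a_1=4G(EG-4F^2)|\mathbf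 e|^2+32EFG\langle\mathbf e,\mathbf f\rangle+4E^3|\mathbf g|^2-8E^2G\langle\mathbf e,\mathbf g\rangle-16E^2G|\mathbf f|^2,$$ $$a_0=4F(EG-2F^2)|\mathbf e|^2-4E(EG-4F^2)\langle\mathbf e,\mathbf f\rangle+4E^3\langle\mathbf f,\mathbf g\rangle-4E^2F\langle\mathbf e,\mathbf g\rangle-8E^2F|\mathbf f|^2$$ (up to the factor $E^3(EG-F^2)I^2$, $\mathcal G$ is the Jacobian of $(\|k_n-H\|^2,I)$ with respect to $(dx,dy)$). We say that $(a,b)\in\mathbb R^2$ are *normal form coefficients* of $\mu$ at an axiumbilic point $q$ if, after an isometry and a homothety of $\mathbb R^4$, there is a Monge chart $(x,y)\mapsto(x,y,R(x,y),S(x,y))$ of the surface centred at $q$, with $R,S$ vanishing to first order at $0$, in which $$\mathcal G=y(dy^4-6dx^2dy^2+dx^4)+(ax+by)\,dx\,dy\,(dx^2-dy^2)+H(x,y,dx,dy),$$ where $H$ contains only terms of order at least $2$ in $(x,y)$. Let $$\Delta(a,b)=16a^5+4(b^2+68)a^4+16(b^2+144)a^3-8(b^2-80)(16+b^2)a^2+96(16+b^2)^2a+4(16+b^2)^3,$$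 the discriminant of $(p^4-6p^2+1)+(1-p^2)(a+bp)$. An axiumbilic point is of type - $E_3$ if it has normal form coefficients with $\Delta(a,b)<0$; - $E_4$ if it has normal form coefficients with $\Delta(a,b)>0$, $a<0$, $a\ne-1$; - $E_{34}^1$ if it has normal form coefficients with $a\neq0$ and either $\Delta(a,b)=0$, $(a,b)\ne(-1,0)$, $(a,b)\neq(-\frac{27}2,\pm\frac52\sqrt5)$, or $a=-1$, $b\ne0$. **Proposition 11.** Let $\alpha\in\mathcal I^r$ and let $\mathfrak p\in M$ be an axiumbilic point of $\alpha$ of type $E_{34}^1$. Then there are an open neighbourhood $V$ of $\mathfrak p$ in $M$, an open neighbourhood $W$ of $\alpha$ in $C^r(M,\mathbb R^4)$ and a function $\mathcal F:W\to\mathbb R$ of class $C^{r-3}$ such that, with $\mathcal V=W\cap\mathcal I^r$: i) $d\mathcal F_\alpha\neq0$; and every $\mu\in\mathcal V$ has exactly one axiumbilic point $\mathfrak p_\mu$ in $V$; there are normal form coefficients $(a(\mu),b(\mu))$ of $\mu$ at $\mathfrak p_\mu$ with $\mathcal F(\mu)=\Delta(a(\mu),b(\mu))$; and ii) $\mathcal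 F(\mu)<0$ if and only if $\mathfrak p_\mu$ is of type $E_3$; iii) $\mathcal F(\mu)>0$ if and only if $\mathfrak p_\mu$ is of type $E_4$; iv) $\mathcal F(\mu)=0$ if and only if $\mathfrak p_\mu$ is of type $E_{34}^1$. Here $C^k$ on an open set of $C^r(M,\mathbb R^4)$ means: having derivatives of all finite orders $j\le k$ which are continuous as maps into the continuous $j$-linear forms with the topology of uniform convergence on bounded sets (the usual Fréchet sense when $C^r(M,\mathbb R^4)$ is a Banach space). -/

import Mathlib

open Set Filter Topology
open scoped Manifold ContDiff

noncomputable section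

namespace Axial

/-- The parameter plane, with its Euclidean norm. -/
abbrev Plane := EuclideanSpace ℝ (Fin 2)

/-- The ambient space `ℝ⁴`, with its Euclidean norm. -/
abbrev Space := EuclideanSpace ℝ (Fin 4)

/-! ### Curvature of a parametrized surface `X : ℝ² → ℝ⁴` -/

/-- The first fundamental form of `X` at `q`, as a symmetric bilinear form. -/
def firstForm (X : Plane → Space) (q v w : Plane) : ℝ :=
  inner ℝ (fderiv ℝ X q v) (fderiv ℝ X q w)

/-- The tangent plane of `X` at `q`. -/
def tangentPlane (X : Plane → Space) (q : Plane) : Submodule ℝ Space :=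
  LinearMap.range (fderiv ℝ X q : Plane →ₗ[ℝ] Space)

/-- The second fundamental form of `X` at `q`, with values in the normal plane: the component
normal to the surface of the second derivative of `X`. In an orthonormal normal frame `N₁, N₂`
it is `II¹ N₁ + II² N₂`. -/
def secondForm (X : Plane → Space) (q v w : Plane) : Space :=
  (tangentPlane X q)ᗮ.starProjection (fderiv ℝ (fderiv ℝ X) q v w)

/-- The coordinate vector `∂/∂x`. -/
def dX : Plane := EuclideanSpace.single 0 1

/-- The coordinate vector `∂/∂y`. -/
def dY : Plane := EuclideanSpace.single 1 1

/-- The coefficient `E` of the first fundamental form. -/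
def coefE (X : Plane → Space) (q : Plane) : ℝ := firstForm X q dX dX

/-- The coefficient `F` of the first fundamental form. -/
def coefF (X : Plane → Space) (q : Plane) : ℝ := firstForm X q dX dY

/-- The coefficient `G` of the first fundamental form. -/
def coefG (X : Plane → Space) (q : Plane) : ℝ := firstForm X q dY dY

/-- The vector `e₁ N₁ + e₂ N₂`. -/
def vecE (X : Plane → Space) (q : Plane) : Space := secondForm X q dX dX

/-- The vector `f₁ N₁ + f₂ N₂`. -/
def vecF (X : Plane → Space) (q : Plane) : Space := secondForm X q dX dY

/-- The vector `g₁ N₁ + g₂ N₂`. -/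
def vecG (X : Plane → Space) (q : Plane) : Space := secondForm X q dY dY

/-- The mean curvature vector. -/
def meanCurvature (X : Plane → Space) (q : Plane) : Space :=
  (2 * (coefE X q * coefG X q - coefF X q ^ 2))⁻¹ •
    (coefE X q • vecG X q - (2 * coefF X q) • vecF X q + coefG X q • vecE X q)

/-- The normal curvature vector in the direction `v`. -/
def normalCurvature (X : Plane → Space) (q v : Plane) : Space :=
  (firstForm X q v v)⁻¹ • secondForm X q v v

/-- The ellipse of curvature: the image of the unit tangent circle under the normal curvature. -/
def curvatureEllipse (X : Plane → Space) (q : Plane) : Set Space :=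
  normalCurvature X q '' {v | firstForm X q v v = 1}

/-- The ellipse of curvature, which is centred at the mean curvature vector, has equal axes. -/
def EllipseIsCircle (X : Plane → Space) (q : Plane) : Prop :=
  ∃ ρ : ℝ, curvatureEllipse X q ⊆ Metric.sphere (meanCurvature X q) ρ

/-! ### The differential equation of axial lines -/

/-- The coefficient `a₀` of the differential equation of axial lines. The sums `e₁² + e₂²`,
`e₁ f₁ + e₂ f₂`, … over an orthonormal normal frame are inner products of normal vectors. -/
def a0 (X : Plane → Space) (q : Plane) : ℝ :=
  let E := coefE X q
  let F := coefF X q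
  let G := coefG X q
  let e := vecE X q
  let f := vecF X q
  let g := vecG X q
  4 * F * (E * G - 2 * F ^ 2) * inner ℝ e e - 4 * E * (E * G - 4 * F ^ 2) * inner ℝ e f
    + 4 * E ^ 3 * inner ℝ f g - 4 * E ^ 2 * F * inner ℝ e g - 8 * E ^ 2 * F * inner ℝ f f

/-- The coefficient `a₁` of the differential equation of axial lines. -/
def a1 (X : Plane → Space) (q : Plane) : ℝ :=
  let E := coefE X q
  let F := coefF X q
  let G := coefG X q
  let e := vecE X q
  let f := vecF X q
  let g := vecG X q
  4 * G * (E * G - 4 * F ^ 2) * inner ℝ e e + 32 * E * F * G * inner ℝ e f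
    + 4 * E ^ 3 * inner ℝ g g - 8 * E ^ 2 * G * inner ℝ e g - 16 * E ^ 2 * G * inner ℝ f f

/-- The quartic form `𝒢(q; dx, dy)` whose zeros are the axial directions. It is equal to
`E³ (EG - F²) I² Jac(‖kₙ - H‖², I)`, the Jacobian being taken in the variables `(dx, dy)`. -/
def axialForm (X : Plane → Space) (q : Plane) (dx dy : ℝ) : ℝ :=
  let E := coefE X q
  let F := coefF X q
  let G := coefG X q
  (a0 X q * G * (E * G - 4 * F ^ 2) + a1 X q * F * (2 * F ^ 2 - E * G)) * dy ^ 4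
    + (-8 * a0 X q * E * F * G + a1 X q * E * (4 * F ^ 2 - E * G)) * dy ^ 3 * dx
    + (-6 * a0 X q * G * E ^ 2 + 3 * a1 X q * F * E ^ 2) * dy ^ 2 * dx ^ 2
    + a1 X q * E ^ 3 * dy * dx ^ 3 + a0 X q * E ^ 3 * dx ^ 4

/-! ### Axiumbilic points of maps of a surface into `ℝ⁴` -/

section Surface

variable {M : Type*} [TopologicalSpace M] [ChartedSpace Plane M]

/-- `μ` is an immersion: its differential is injective at every point. -/
def IsImmersion (μ : M → Space) : Prop :=
  ∀ p : M, Function.Injective (mfderiv (𝓡 2) 𝓘(ℝ, Space) μ p)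

/-- `p` is an axiumbilic point of `μ`: the ellipse of curvature at `p` is a circle. The ellipse of
curvature does not depend on the chart used to compute it. -/
def IsAxiumbilic (μ : M → Space) (p : M) : Prop :=
  EllipseIsCircle (μ ∘ (extChartAt (𝓡 2) p).symm) (extChartAt (𝓡 2) p p)

/-- After an isometry `Γ` and a homothety of ratio `c` of `ℝ⁴`, the chart `e` of the `C^r` surface
`M` is a Monge chart of `μ` centred at `p`: it presents the image of `μ` near `p` as the graph
`(x, y, R(x, y), S(x, y))` of functions `R`, `S` that vanish to first order at the origin. -/
structure IsMongeChart (r : ℕ∞) (μ : M → Space) (p : M) (e : OpenPartialHomeomorph M Plane)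
    (Γ : Space ≃ᵃⁱ[ℝ] Space) (c : ℝ) (R S : Plane → ℝ) : Prop where
  mem_atlas : e ∈ IsManifold.maximalAtlas (𝓡 2) (r : WithTop ℕ∞) M
  mem_source : p ∈ e.source
  map_center : e p = 0
  ratio_pos : 0 < c
  graph : ∀ q ∈ e.target, c • Γ (μ (e.symm q)) = !₂[q 0, q 1, R q, S q]
  R_zero : R 0 = 0
  S_zero : S 0 = 0
  hasFDerivAt_R : HasFDerivAt R (0 : Plane →L[ℝ] ℝ) 0
  hasFDerivAt_S : HasFDerivAt S (0 : Plane →L[ℝ] ℝ) 0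

/-- `(a, b)` are normal form coefficients of `μ` at the axiumbilic point `p`: in some Monge chart
centred at `p`, after a homothety of `ℝ⁴`, the differential equation of axial lines is
`y (dy⁴ - 6 dx² dy² + dx⁴) + (a x + b y) dx dy (dx² - dy²) + H(x, y, dx, dy) = 0`
where `H` contains only terms of order at least `2` in `(x, y)`. -/
def HasNormalForm (r : ℕ∞) (μ : M → Space) (p : M) (a b : ℝ) : Prop :=
  IsAxiumbilic μ p ∧
  ∃ (e : OpenPartialHomeomorph M Plane) (Γ : Space ≃ᵃⁱ[ℝ] Space) (c : ℝ) (R S : Plane → ℝ),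
    IsMongeChart r μ p e Γ c R S ∧
    ∀ dx dy : ℝ,
      axialForm (fun q => !₂[q 0, q 1, R q, S q]) 0 dx dy = 0 ∧
      ∃ L : Plane →L[ℝ] ℝ,
        HasFDerivAt (fun q => axialForm (fun q => !₂[q 0, q 1, R q, S q]) q dx dy) L 0 ∧
        ∀ q : Plane, L q =
          q 1 * (dy ^ 4 - 6 * dx ^ 2 * dy ^ 2 + dx ^ 4)
            + (a * q 0 + b * q 1) * (dx * dy * (dx ^ 2 - dy ^ 2))

/-- The discriminant of `R(p) = (p⁴ - 6 p² + 1) + (1 - p²)(a + b p)`. -/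
def Δ (a b : ℝ) : ℝ :=
  16 * a ^ 5 + 4 * (b ^ 2 + 68) * a ^ 4 + 16 * (b ^ 2 + 144) * a ^ 3
    - 8 * (b ^ 2 - 80) * (16 + b ^ 2) * a ^ 2 + 96 * (16 + b ^ 2) ^ 2 * a + 4 * (16 + b ^ 2) ^ 3

/-- Axiumbilic points of type `E₃`. -/
def IsE3 (r : ℕ∞) (μ : M → Space) (p : M) : Prop :=
  ∃ a b : ℝ, HasNormalForm r μ p a b ∧ Δ a b < 0

/-- Axiumbilic points of type `E₄`. -/
def IsE4 (r : ℕ∞) (μ : M → Space) (p : M) : Prop :=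
  ∃ a b : ℝ, HasNormalForm r μ p a b ∧ 0 < Δ a b ∧ a < 0 ∧ a ≠ -1

/-- Axiumbilic points of type `E₃₄¹`. -/
def IsE34 (r : ℕ∞) (μ : M → Space) (p : M) : Prop :=
  ∃ a b : ℝ, HasNormalForm r μ p a b ∧ a ≠ 0 ∧
    ((Δ a b = 0 ∧ (a, b) ≠ (-1, 0) ∧ (a, b) ≠ (-27 / 2, 5 / 2 * √5) ∧
        (a, b) ≠ (-27 / 2, -(5 / 2 * √5))) ∨
      (a = -1 ∧ b ≠ 0))

end Surface

/-! ### The space of `C^r` maps and differentiable functions on it -/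

/-- The vector space of `C^r` maps of the surface `M` into `ℝ⁴`. -/
abbrev CrMap (r : ℕ∞) (M : Type*) [TopologicalSpace M] [ChartedSpace Plane M] :=
  ContMDiffMap (𝓡 2) 𝓘(ℝ, Space) M Space (r : WithTop ℕ∞)

/-- The `C^r` topology: uniform convergence, on compact sets of chart domains, of the derivatives
of order at most `r` (all finite orders if `r = ∞`) of the expressions in the charts. If `M` is
compact and `r` finite this is the topology of the Banach space `C^r(M, ℝ⁴)`. -/
instance CrMap.instTopologicalSpace (r : ℕ∞) (M : Type*) [TopologicalSpace M]
    [ChartedSpace Plane M] : TopologicalSpace (CrMap r M) :=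
  ⨅ (x : M) (j : {j : ℕ // (j : ℕ∞) ≤ r}),
    TopologicalSpace.induced
      (fun μ : CrMap r M =>
        UniformOnFun.ofFun {K : Set Plane | IsCompact K ∧ K ⊆ (extChartAt (𝓡 2) x).target}
          (iteratedFDeriv ℝ (j : ℕ) (μ ∘ (extChartAt (𝓡 2) x).symm)))
      inferInstance

/-- `f` is of class `C^k` on the open set `U` of the topological vector space `E`: it has
derivatives `D j` of all finite orders `j ≤ k`, which are continuous maps from `U` to the space of
continuous `j`-linear forms with the topology of uniform convergence on bounded sets. If `E` is a
normed space, this topology is that of the norm and the condition is the usual one, in the sense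
of Fréchet. -/
def IsOfClass {E : Type*} [AddCommGroup E] [Module ℝ E] [TopologicalSpace E]
    (k : ℕ∞) (f : E → ℝ) (U : Set E) : Prop :=
  ∀ n : ℕ, (n : ℕ∞) ≤ k →
    ∃ D : (j : ℕ) → E → ContinuousMultilinearMap ℝ (fun _ : Fin j => E) ℝ,
      (∀ x ∈ U, ∀ v : Fin 0 → E, D 0 x v = f x) ∧
      (∀ j ≤ n, ContinuousOn (D j) U) ∧
      ∀ j < n, ∀ x ∈ U, ∀ (h : E) (v : Fin j → E),
        HasDerivAt (fun t : ℝ => D j (x + t • h) v) (D (j + 1) x (Fin.cons h v)) 0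

/-- The differential of `f` at `x` exists in some direction and does not vanish there. -/
def HasNonzeroDifferential {E : Type*} [AddCommGroup E] [Module ℝ E] (f : E → ℝ) (x : E) : Prop :=
  ∃ (h : E) (c : ℝ), c ≠ 0 ∧ HasDerivAt (fun t : ℝ => f (x + t • h)) c 0

end Axial

end

open Axial

noncomputable section

namespace Axial

/-! At an axiumbilic point the quartic form vanishes, so its first derivative is a tensor T(w; v),
linear in w and quartic in v. In a conformal frame the quartics that occur are harmonic, that is,
combinations of Re z⁴ and Im z⁴ (`exists_quart_eq_harmonic`). A normal form amounts to the choice of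
an axis, a direction v with T(v; v) = 0. In terms of the slope p relative to the axis, the quintic
T(v; v) is p·R(p) up to a constant, where R is the quartic with discriminant `Δ` and R(0) = 1 + a.
Hence Δ·(1 + a)² is the discriminant of the quintic, and up to a positive factor it does not depend
on the axis (`HasAxis.exists_pos_Δ_mul_eq`). Although the types are defined by the existence of some
normal form, the sign of `Δ` at a single axis with a < 0, a ≠ -1, away from the triple values,
decides between them (`HasNormalForm.sign_iff`).

A point of type E₃₄¹ has an axis with a ≠ -1 (`IsE34.exists_frame`). There a ≠ 0 makes the
differentials of the two coefficients of the equation independent, and a ≠ -1 makes the axis a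
simple root of the quintic. Two applications of the implicit function theorem give an axiumbilic
point and an axis that follow μ (`exists_axis_family`), and 𝓕 is the value of `Δ` there. Since Δ = 0
with a ≠ 0 forces a < 0, the conditions a < 0, a ≠ -1 and not being a triple value hold near α.
Three derivatives are lost: two for the second fundamental form, one for the differential of the
coefficients.

The space of C^r maps need not be normed, but 𝓕 depends only on jets over a small closed disk. It
factors through the Banach space of k-jets on the disk, where evaluation is C^k jointly in map and
point (`IsJetFamily.contDiffOn_eval`). The implicit functions are built once, on 5-jets, which fixes
W. Their regularity of each finite order is then read off on jets of higher order by
`contDiffAt_of_implicit`, so that r = ∞ needs no shrinking of W.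

For d𝓕 ≠ 0: the gradient of `Δ` vanishes on Δ = 0, a ≠ 0 only at triple values
(`gradient_Δ_ne_zero`). Adding t·ℓ³/6 times a suitable vector keeps the 2-jet at the point, hence
the point itself, and for suitable linear forms ℓ it keeps the axis and moves a or b linearly in t
(`exists_cubicMap_Δ`). This requires that the curvature ellipse is not a single point
(`normalInner_frameDiff_ne_zero`). -/

/-! ### The discriminant `Δ` -/

/-- The harmonic quartic `Re (x + iy)⁴`. -/
def h1 (x y : ℝ) : ℝ := x ^ 4 - 6 * x ^ 2 * y ^ 2 + y ^ 4

/-- The harmonic quartic `Im (x + iy)⁴ / 4`. -/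
def h2 (x y : ℝ) : ℝ := x * y * (x ^ 2 - y ^ 2)

/-- The homogeneous form of the discriminant `Δ`. -/
def ΔHom (a b k : ℝ) : ℝ :=
  16 * a ^ 5 * k + 4 * (b ^ 2 + 68 * k ^ 2) * a ^ 4 + 16 * (b ^ 2 + 144 * k ^ 2) * a ^ 3 * k
    - 8 * (b ^ 2 - 80 * k ^ 2) * (16 * k ^ 2 + b ^ 2) * a ^ 2
    + 96 * (16 * k ^ 2 + b ^ 2) ^ 2 * a * k + 4 * (16 * k ^ 2 + b ^ 2) ^ 3

/-- The coefficients will be known as quotients with a common denominator; homogeneity allows `Δ` to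
be computed on the numerators. -/
lemma ΔHom_mul (a b k : ℝ) : ΔHom (k * a) (k * b) k = k ^ 6 * Δ a b := by
  unfold ΔHom Δ; ring

/-- The discriminant of the cubic which remains of the quintic of separatrices after two of its
roots have been split off. -/
def cubicDisc (x y N : ℝ) : ℝ :=
  48 * N * x * y ^ 11 + 1232 * N * x ^ 3 * y ^ 9 - 4000 * N * x ^ 5 * y ^ 7
    + 3360 * N * x ^ 7 * y ^ 5 - 144 * N * x ^ 9 * y ^ 3 - 496 * N * x ^ 11 * y
    + 496 * N ^ 2 * x ^ 2 * y ^ 6 - 816 * N ^ 2 * x ^ 4 * y ^ 4 + 304 * N ^ 2 * x ^ 6 * y ^ 2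
    + 88 * N ^ 2 * x ^ 8 - 8 * N ^ 2 * y ^ 8 + 80 * N ^ 3 * x * y ^ 3 - 48 * N ^ 3 * x ^ 3 * y
    + 4 * N ^ 4 + 96 * x ^ 2 * y ^ 14 + 608 * x ^ 4 * y ^ 12 - 5184 * x ^ 6 * y ^ 10
    + 9256 * x ^ 8 * y ^ 8 - 4512 * x ^ 10 * y ^ 6 - 2176 * x ^ 12 * y ^ 4 + 1408 * x ^ 14 * y ^ 2
    + 500 * x ^ 16 + 4 * y ^ 16

/-- The quintic has the roots (1, 0) and (x, y), and `N` parametrizes the remaining cubic. The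
discriminant of a linear factor times a cubic is that of the cubic times the square of the value of
the cubic at the root of the factor. Seen from the axis (1, 0) this root is (x, y). -/
lemma ΔHom_first_axis (x y N : ℝ) :
    ΔHom (-x * h1 x y - y * N) (-y * h1 x y + x * N) (x * (x ^ 2 - y ^ 2) * (x ^ 2 + y ^ 2)) =
      cubicDisc x y N * (-N * x * y ^ 2 + N * x ^ 3 - 5 * x ^ 2 * y ^ 5 + x ^ 4 * y ^ 3
        - 11 * x ^ 6 * y - y ^ 7) ^ 2 := by
  unfold ΔHom cubicDisc h1; ring

/-- The same factorization seen from the axis (x, y): the square is now that of the value of the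
cubic at (1, 0), up to powers of x² + y². -/
lemma ΔHom_second_axis (x y N : ℝ) :
    ΔHom (-(x ^ 2 + y ^ 2) ^ 4) (-16 * x * y * (x * (x ^ 2 - y ^ 2)) ^ 2 + N * h1 x y)
        (x * (x ^ 2 - y ^ 2) * (x * h1 x y + y * N)) =
      cubicDisc x y N * (x ^ 2 + y ^ 2) ^ 12 * (-N - 2 * x * y ^ 3 + 6 * x ^ 3 * y) ^ 2 := by
  unfold ΔHom cubicDisc h1; ring

/-- The discriminants of two normal forms whose axes differ by the direction `(x, y)` have the same
sign, once multiplied by `(1 + a) ^ 2`: both are the discriminant of the quintic of separatrices. -/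
lemma exists_pos_Δ_mul_eq {a b a' b' x y δ : ℝ} (hxy : x ≠ 0 ∨ y ≠ 0) (hδ : δ ≠ 0)
    (e1 : y * h1 x y + (a * x + b * y) * h2 x y = 0)
    (e2 : δ * a' = -16 * y * h2 x y + (a * x + b * y) * h1 x y)
    (e3 : δ = x * h1 x y + (-a * y + b * x) * h2 x y)
    (e4 : δ * b' = -16 * x * h2 x y + (-a * y + b * x) * h1 x y) :
    ∃ κ : ℝ, 0 < κ ∧ Δ a' b' * (1 + a') ^ 2 = κ * (Δ a b * (1 + a) ^ 2) := by
  rcases eq_or_ne y 0 with rfl | hy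
  · have hx : x ≠ 0 := by simpa using hxy
    have hδx : δ = x ^ 5 := by rw [e3]; unfold h1 h2; ring
    have ha : a' = a := by
      apply mul_left_cancel₀ hδ; rw [e2, hδx]; unfold h1 h2; ring
    have hb : b' = b := by
      apply mul_left_cancel₀ hδ; rw [e4, hδx]; unfold h1 h2; ring
    exact ⟨1, one_pos, by rw [ha, hb, one_mul]⟩
  set k : ℝ := x * (x ^ 2 - y ^ 2) with hk
  have hh2 : h2 x y = y * k := by unfold h2; ring
  have hr : 0 < x ^ 2 + y ^ 2 := by positivity
  have hlin : (a * x + b * y) * k = -h1 x y := by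
    apply mul_left_cancel₀ hy; rw [hh2] at e1; linear_combination e1
  -- If `k` vanished, the root condition would give `h1 x y = 0` as well, but the real and imaginary
  -- parts of z⁴ have no common zero besides 0.
  have hk0 : k ≠ 0 := by
    intro h0
    have hh : h1 x y = 0 := by rw [h0] at hlin; linarith
    rcases mul_eq_zero.mp h0 with h | h
    · rw [h] at hh; unfold h1 at hh; apply hy
      have : y ^ 4 = 0 := by linear_combination hh
      exact pow_eq_zero_iff (by norm_num) |>.mp this
    · unfold h1 at hh
      have : y ^ 4 = 0 := by linear_combination (-1/4 : ℝ) * hh + (1/4) * (x ^ 2 - 5 * y ^ 2) * h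
      exact hy (pow_eq_zero_iff (by norm_num) |>.mp this)
  set N : ℝ := (-a * y + b * x) * k with hN
  have hKa : k * (x ^ 2 + y ^ 2) * a = -x * h1 x y - y * N := by
    rw [hN]; linear_combination x * hlin
  have hKb : k * (x ^ 2 + y ^ 2) * b = -y * h1 x y + x * N := by
    rw [hN]; linear_combination y * hlin
  have hδN : δ = x * h1 x y + y * N := by rw [e3, hh2, hN]; ring
  have hKa' : k * δ * a' = -(x ^ 2 + y ^ 2) ^ 4 := by
    have : k * δ * a' = -16 * y * h2 x y * k - h1 x y ^ 2 := by
      linear_combination k * e2 + h1 x y * hlin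
    rw [this, hh2, hk]; unfold h1; ring
  have hKb' : k * δ * b' = -16 * x * y * k ^ 2 + N * h1 x y := by
    rw [hN]
    have := congrArg (k * ·) e4
    simp only [hh2] at this
    linear_combination this
  have hK1 : k * (x ^ 2 + y ^ 2) ≠ 0 := mul_ne_zero hk0 hr.ne'
  have hK2 : k * δ ≠ 0 := mul_ne_zero hk0 hδ
  have f1 := ΔHom_mul a b (k * (x ^ 2 + y ^ 2))
  have f2 := ΔHom_mul a' b' (k * δ)
  rw [hKa, hKb, hk, ΔHom_first_axis, ← hk] at f1
  rw [hKa', hKb', hδN, hk, ΔHom_second_axis, ← hk, ← hδN] at f2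
  -- The factor squared in the discriminant at one axis is, up to `y`, the numerator of 1 + a at the
  -- other axis. After multiplication by these squares both sides have the same factors.
  have g1 : k * (x ^ 2 + y ^ 2) * (1 + a) = y * (-N - 2 * x * y ^ 3 + 6 * x ^ 3 * y) := by
    rw [mul_add, hKa, hk]; unfold h1; ring
  have g2 : k * δ * (1 + a') = y * (-N * x * y ^ 2 + N * x ^ 3 - 5 * x ^ 2 * y ^ 5
      + x ^ 4 * y ^ 3 - 11 * x ^ 6 * y - y ^ 7) := by
    rw [mul_add, hKa', hδN, hk]; unfold h1; ring
  refine ⟨(x ^ 2 + y ^ 2) ^ 12 * (k * (x ^ 2 + y ^ 2)) ^ 8 / (k * δ) ^ 8, by positivity, ?_⟩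
  have h8 : (k * δ) ^ 8 ≠ 0 := pow_ne_zero _ hK2
  rw [div_mul_eq_mul_div, eq_div_iff h8]
  calc Δ a' b' * (1 + a') ^ 2 * (k * δ) ^ 8
      = ((k * δ) ^ 6 * Δ a' b') * (k * δ * (1 + a')) ^ 2 := by ring
    _ = (x ^ 2 + y ^ 2) ^ 12 * (((k * (x ^ 2 + y ^ 2)) ^ 6 * Δ a b)
          * (k * (x ^ 2 + y ^ 2) * (1 + a)) ^ 2) := by rw [← f1, ← f2, g1, g2]; ring
    _ = _ := by ring

/-- Hence Δ < 0 excludes a = -1, and Δ = 0 with a = -1 forces b = 0. -/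
lemma Δ_neg_one (b : ℝ) : Δ (-1) b = 4 * b ^ 2 * ((b ^ 2 + 11) ^ 2 + 4) := by
  unfold Δ; ring

lemma Δ_zero_right (a : ℝ) : Δ a 0 = 16 * (a + 1) * (a ^ 2 + 8 * a + 32) ^ 2 := by
  unfold Δ; ring

/-- `Δ` as a quadratic polynomial in `a`, for fixed `τ = (16 + b²) / a`. -/
lemma Δ_eq_of_mul_eq {a b τ : ℝ} (h : a * τ = 16 + b ^ 2) :
    Δ a b = 4 * a ^ 3 * (a ^ 2 * (τ + 4) - 2 * a * (τ ^ 2 - 2 * τ - 26) + (τ + 8) ^ 3) := by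
  have hb : b ^ 2 = a * τ - 16 := by linarith
  unfold Δ; rw [hb]; ring

/-- For a > 0 also τ > 0, and the quadratic in a of `Δ_eq_of_mul_eq` has discriminant -16(2τ + 7)³ <
0. -/
lemma neg_of_Δ_eq_zero {a b : ℝ} (ha : a ≠ 0) (h : Δ a b = 0) : a < 0 := by
  by_contra hneg
  have hpos : 0 < a := lt_of_le_of_ne (not_lt.mp hneg) (Ne.symm ha)
  obtain ⟨τ, hτ⟩ : ∃ τ, a * τ = 16 + b ^ 2 := ⟨(16 + b ^ 2) / a, mul_div_cancel₀ _ ha⟩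
  have hτ0 : 0 < τ := by
    by_contra hτ0
    nlinarith [mul_nonneg hpos.le (neg_nonneg.mpr (not_lt.mp hτ0)), sq_nonneg b]
  rw [Δ_eq_of_mul_eq hτ] at h
  have h0 : a ^ 2 * (τ + 4) - 2 * a * (τ ^ 2 - 2 * τ - 26) + (τ + 8) ^ 3 = 0 := by
    rcases mul_eq_zero.mp h with h | h
    · exact absurd h (by positivity)
    · exact h
  have h1 : ((τ + 4) * a - (τ ^ 2 - 2 * τ - 26)) ^ 2 + 4 * (2 * τ + 7) ^ 3 = 0 := by
    linear_combination (τ + 4) * h0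
  have : 0 < 4 * (2 * τ + 7) ^ 3 := by positivity
  nlinarith [sq_nonneg ((τ + 4) * a - (τ ^ 2 - 2 * τ - 26))]

/-- The zeros of `Δ` at which the normal form has a separatrix of multiplicity at least three. -/
def IsTripleValue (a b : ℝ) : Prop :=
  (a, b) = (-1, 0) ∨ (a, b) = (-27 / 2, 5 / 2 * √5) ∨ (a, b) = (-27 / 2, -(5 / 2 * √5))

/-- The partial derivative of `Δ` with respect to `a`. -/
def Δa (a b : ℝ) : ℝ :=
  80 * a ^ 4 + 16 * (b ^ 2 + 68) * a ^ 3 + 48 * (b ^ 2 + 144) * a ^ 2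
    - 16 * (b ^ 2 - 80) * (16 + b ^ 2) * a + 96 * (16 + b ^ 2) ^ 2

/-- Half the partial derivative of `Δ` with respect to `b ^ 2`. -/
def Δs (a b : ℝ) : ℝ :=
  4 * a ^ 4 + 16 * a ^ 3 - 8 * (16 + b ^ 2) * a ^ 2 - 8 * (b ^ 2 - 80) * a ^ 2
    + 192 * (16 + b ^ 2) * a + 12 * (16 + b ^ 2) ^ 2

lemma hasDerivAt_Δ_left (a b : ℝ) : HasDerivAt (fun t => Δ (a + t) b) (Δa a b) 0 := by
  have hpoly : (fun t => Δ (a + t) b) = fun t => Δ a b + t * Δa a b + t ^ 2 * (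
      16 * (10 * a ^ 3 + 10 * a ^ 2 * t + 5 * a * t ^ 2 + t ^ 3)
      + 4 * (b ^ 2 + 68) * (6 * a ^ 2 + 4 * a * t + t ^ 2)
      + 16 * (b ^ 2 + 144) * (3 * a + t) - 8 * (b ^ 2 - 80) * (16 + b ^ 2)) := by
    funext t; unfold Δ Δa; ring
  have hid := hasDerivAt_id (0 : ℝ)
  have hg : DifferentiableAt ℝ (fun t : ℝ => 16 * (10 * a ^ 3 + 10 * a ^ 2 * t + 5 * a * t ^ 2
      + t ^ 3) + 4 * (b ^ 2 + 68) * (6 * a ^ 2 + 4 * a * t + t ^ 2)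
      + 16 * (b ^ 2 + 144) * (3 * a + t) - 8 * (b ^ 2 - 80) * (16 + b ^ 2)) 0 := by fun_prop
  rw [hpoly]
  have := ((hid.mul_const (Δa a b)).const_add (Δ a b)).add ((hid.pow 2).mul hg.hasDerivAt)
  refine this.congr_deriv ?_
  simp

lemma hasDerivAt_Δ_right (a b : ℝ) :
    HasDerivAt (fun t => Δ a (b + t)) (2 * b * Δs a b) 0 := by
  have hpoly : (fun t => Δ a (b + t)) = fun t => Δ a b + (2 * b * t + t ^ 2) * Δs a b
      + (2 * b * t + t ^ 2) ^ 2 * (-8 * a ^ 2 + 96 * a + 4 * (3 * (16 + b ^ 2)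
        + (2 * b * t + t ^ 2))) := by
    funext t; unfold Δ Δs; ring
  have hid := hasDerivAt_id (0 : ℝ)
  have hs : HasDerivAt (fun t : ℝ => 2 * b * t + t ^ 2) (2 * b) 0 := by
    have := (hid.const_mul (2 * b)).add (hid.pow 2)
    refine this.congr_deriv ?_
    simp
  have hg : DifferentiableAt ℝ (fun t : ℝ => -8 * a ^ 2 + 96 * a + 4 * (3 * (16 + b ^ 2)
        + (2 * b * t + t ^ 2))) 0 := by fun_prop
  rw [hpoly]
  have := ((hs.mul_const (Δs a b)).const_add (Δ a b)).add ((hs.pow 2).mul hg.hasDerivAt)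
  refine this.congr_deriv ?_
  simp

/-- For fixed τ, a critical zero is a double root of the quadratic in a, whose discriminant is
-16(2τ + 7)³. So τ = -7/2, a = -27/2 and b² = 125/4. For b = 0 the derivative in b gives no
information, but the factorization of `Δ a 0` leaves only a = -1. -/
lemma gradient_Δ_ne_zero {a b : ℝ} (ha : a ≠ 0) (h : Δ a b = 0) (htriple : ¬ IsTripleValue a b) :
    Δa a b ≠ 0 ∨ 2 * b * Δs a b ≠ 0 := by
  by_contra! hgrad
  obtain ⟨hga, hgb⟩ := hgrad
  rcases eq_or_ne b 0 with rfl | hb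
  · rw [Δ_zero_right] at h
    have : a ^ 2 + 8 * a + 32 ≠ 0 := by nlinarith [sq_nonneg (a + 4)]
    have ha1 : a = -1 := by
      have : a + 1 = 0 := by simpa [this] using h
      linarith
    exact htriple (Or.inl (by rw [ha1]))
  have hgs : Δs a b = 0 := by simpa [hb] using hgb
  obtain ⟨τ, hτ⟩ : ∃ τ, a * τ = 16 + b ^ 2 := ⟨(16 + b ^ 2) / a, mul_div_cancel₀ _ ha⟩
  have h0 : a ^ 2 * (τ + 4) - 2 * a * (τ ^ 2 - 2 * τ - 26) + (τ + 8) ^ 3 = 0 := by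
    rw [Δ_eq_of_mul_eq hτ] at h
    rcases mul_eq_zero.mp h with h | h
    · exact absurd h (mul_ne_zero (by norm_num) (pow_ne_zero _ ha))
    · exact h
  have hbs : b ^ 2 = a * τ - 16 := by linarith
  have h1 : a * (τ + 4) - (τ ^ 2 - 2 * τ - 26) = 0 := by
    -- This sum is the derivative in a along the curve b² = aτ - 16 with τ fixed, so it can be
    -- compared with the derivative of the factored form.
    have hsum : Δa a b + τ * Δs a b = 0 := by rw [hga, hgs]; ring
    have : 8 * a ^ 3 * (a * (τ + 4) - (τ ^ 2 - 2 * τ - 26)) = 0 := by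
      unfold Δa Δs at hsum
      rw [hbs] at hsum
      linear_combination hsum - 12 * a ^ 2 * h0
    rcases mul_eq_zero.mp this with h | h
    · exact absurd h (mul_ne_zero (by norm_num) (pow_ne_zero _ ha))
    · exact h
  have h2 : (2 * τ + 7) ^ 3 = 0 := by
    linear_combination (1 / 4) * (τ + 4) * h0
      - (1 / 4) * (a * (τ + 4) - (τ ^ 2 - 2 * τ - 26)) * h1
  have hτv : τ = -7 / 2 := by
    have := pow_eq_zero_iff (by norm_num) |>.mp h2
    linarith
  have hav : a = -27 / 2 := by rw [hτv] at h1; linarith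
  have hbv : b ^ 2 = (5 / 2 * √5) ^ 2 := by
    rw [mul_pow, Real.sq_sqrt (by norm_num), hbs, hav, hτv]; norm_num
  rcases sq_eq_sq_iff_eq_or_eq_neg.mp hbv with hb' | hb'
  · exact htriple (Or.inr (Or.inl (by rw [hav, hb'])))
  · exact htriple (Or.inr (Or.inr (by rw [hav, hb'])))

/-- A normal form with `a = -1`, `b ≠ 0` has a separatrix in a direction `(1, t)` which is a simple
root of the quintic of separatrices. -/
lemma exists_simple_axis {b : ℝ} (hb : b ≠ 0) :
    ∃ t δ a' : ℝ, δ ≠ 0 ∧ t * h1 1 t + ((-1) * 1 + b * t) * h2 1 t = 0 ∧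
      δ = 1 * h1 1 t + (-(-1) * t + b * 1) * h2 1 t ∧
      δ * a' = -16 * t * h2 1 t + ((-1) * 1 + b * t) * h1 1 t ∧
      a' ≠ 0 ∧ a' ≠ -1 ∧ a' ≠ -27 / 2 := by
  -- For a = -1 the quintic is t²(t³ - bt² - 5t + b) in the slope t. The cubic equals -4 at t = 1
  -- whatever b is, and is nonnegative at |b| + 4.
  obtain ⟨t, ht1, ht⟩ : ∃ t : ℝ, 1 < t ∧ t ^ 3 - b * t ^ 2 - 5 * t + b = 0 := by
    have hcont : ContinuousOn (fun t : ℝ => t ^ 3 - b * t ^ 2 - 5 * t + b)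
        (Set.Icc 1 (|b| + 4)) := by fun_prop
    have hle : (1 : ℝ) ≤ |b| + 4 := by linarith [abs_nonneg b]
    have h0 : (0 : ℝ) ∈ Set.Icc ((fun t : ℝ => t ^ 3 - b * t ^ 2 - 5 * t + b) 1)
        ((fun t : ℝ => t ^ 3 - b * t ^ 2 - 5 * t + b) (|b| + 4)) := by
      constructor
      · norm_num
        linarith
      · simp only
        have h1 := le_abs_self b
        have h2 := neg_abs_le b
        have h3 := abs_nonneg b
        nlinarith [mul_nonneg (sub_nonneg.mpr h1) (sq_nonneg (|b| + 4))]
    obtain ⟨t, ht, hft⟩ := intermediate_value_Icc hle hcont h0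
    refine ⟨t, lt_of_le_of_ne ht.1 ?_, hft⟩
    rintro rfl
    norm_num at hft
    linarith
  have hw : 1 < t ^ 2 := by nlinarith
  have hk : 1 - t ^ 2 ≠ 0 := by linarith
  have hbt : b * (1 - t ^ 2) = 5 * t - t ^ 3 := by linear_combination ht
  have hδv : 1 * h1 1 t + (-(-1) * t + b * 1) * h2 1 t = 1 - t ^ 4 := by
    unfold h1 h2; linear_combination t * hbt
  have hδ0 : 1 - t ^ 4 ≠ 0 := by nlinarith
  have hval : (1 - t ^ 2) * (-16 * t * h2 1 t + ((-1) * 1 + b * t) * h1 1 t)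
      = -(1 + t ^ 2) ^ 4 := by
    unfold h1 h2; linear_combination t * (1 - 6 * t ^ 2 + t ^ 4) * hbt
  -- At the new axis a' = -(1 + t²)³/(1 - t²)², which no longer contains b.
  have key : (1 - t ^ 2) ^ 2 * ((-16 * t * h2 1 t + ((-1) * 1 + b * t) * h1 1 t) / (1 - t ^ 4))
      = -(1 + t ^ 2) ^ 3 := by
    rw [mul_div_assoc', div_eq_iff hδ0]; linear_combination (1 - t ^ 2) * hval
  refine ⟨t, 1 - t ^ 4, (-16 * t * h2 1 t + ((-1) * 1 + b * t) * h1 1 t) / (1 - t ^ 4), hδ0, ?_,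
    hδv.symm, mul_div_cancel₀ _ hδ0, ?_, ?_, ?_⟩
  · unfold h1 h2; linear_combination t ^ 2 * hbt
  · intro h
    rw [h, mul_zero] at key
    have : 0 < (1 + t ^ 2) ^ 3 := by positivity
    linarith
  · intro h
    rw [h] at key
    nlinarith [sq_nonneg t, sq_nonneg (t ^ 2)]
  · intro h
    rw [h] at key
    -- Since t > 1, only t² = 5 can occur, and then `hbt` gives b = 0.
    have h5 : (t ^ 2 - 5) ^ 2 * (2 * t ^ 2 - 1) = 0 := by linear_combination 2 * key
    rcases mul_eq_zero.mp h5 with h5 | h5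
    · have h5' : t ^ 2 = 5 := by
        have := pow_eq_zero_iff (by norm_num) |>.mp h5
        linarith
      apply hb
      have : b * (1 - t ^ 2) = 0 := by rw [hbt]; linear_combination -t * h5'
      exact (mul_eq_zero.mp this).resolve_right hk
    · linarith

/-! ### Linear algebra of the quartic form -/

/-- The quartic form of the differential equation of axial lines, as a function of its
coefficients. -/
def quart (E F G A0 A1 dx dy : ℝ) : ℝ :=
  (A0 * G * (E * G - 4 * F ^ 2) + A1 * F * (2 * F ^ 2 - E * G)) * dy ^ 4
    + (-8 * A0 * E * F * G + A1 * E * (4 * F ^ 2 - E * G)) * dy ^ 3 * dx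
    + (-6 * A0 * G * E ^ 2 + 3 * A1 * F * E ^ 2) * dy ^ 2 * dx ^ 2
    + A1 * E ^ 3 * dy * dx ^ 3 + A0 * E ^ 3 * dx ^ 4

lemma axialForm_eq_quart (X : Plane → Space) (q : Plane) (dx dy : ℝ) :
    axialForm X q dx dy =
      quart (coefE X q) (coefF X q) (coefG X q) (a0 X q) (a1 X q) dx dy := rfl

/-- The inner product with coefficients `E`, `F`, `G`. -/
def metric (E F G : ℝ) (v w : Plane) : ℝ :=
  E * (v 0 * w 0) + F * (v 0 * w 1 + v 1 * w 0) + G * (v 1 * w 1)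

/-- The quartic form in isothermal coordinates. -/
lemma mul_quart_eq {E F G W : ℝ} (hW : W ^ 2 = E * G - F ^ 2) (A0 A1 dx dy : ℝ) :
    W * E * quart E F G A0 A1 dx dy = W * A0 * h1 (E * dx + F * dy) (W * dy)
      + (E * A1 - 4 * A0 * F) * h2 (E * dx + F * dy) (W * dy) := by
  unfold quart h1 h2
  linear_combination W * (A0 * (6 * (E * dx + F * dy) ^ 2 * dy ^ 2
    - dy ^ 4 * (W ^ 2 + (E * G - F ^ 2)))
    + (E * A1 - 4 * A0 * F) * (E * dx + F * dy) * dy ^ 3) * hW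

/-- In a conformal frame the quartic form is harmonic. -/
lemma exists_quart_eq_harmonic {E F G : ℝ} (hE : 0 < E) (hW : 0 < E * G - F ^ 2) {v1 v2 : Plane}
    {l : ℝ} (hl : 0 < l) (h11 : metric E F G v1 v1 = l) (h22 : metric E F G v2 v2 = l)
    (h12 : metric E F G v1 v2 = 0) (A0 A1 : ℝ) :
    ∃ α β : ℝ, ∀ x y : ℝ, quart E F G A0 A1 (x * v1 0 + y * v2 0) (x * v1 1 + y * v2 1) =
      α * h1 x y + β * h2 x y := by
  set W : ℝ := √(E * G - F ^ 2) with hWdef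
  have hW0 : 0 < W := Real.sqrt_pos.mpr hW
  have hWsq : W ^ 2 = E * G - F ^ 2 := Real.sq_sqrt hW.le
  set ξ1 := E * v1 0 + F * v1 1 with hξ1
  set η1 := W * v1 1 with hη1
  set ξ2 := E * v2 0 + F * v2 1 with hξ2
  set η2 := W * v2 1 with hη2
  unfold metric at h11 h22 h12
  have k11 : ξ1 ^ 2 + η1 ^ 2 = E * l := by
    rw [hξ1, hη1, mul_pow, hWsq]; linear_combination E * h11
  have k22 : ξ2 ^ 2 + η2 ^ 2 = E * l := by
    rw [hξ2, hη2, mul_pow, hWsq]; linear_combination E * h22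
  have k12 : ξ1 * ξ2 + η1 * η2 = 0 := by
    have : η1 * η2 = W ^ 2 * (v1 1 * v2 1) := by rw [hη1, hη2]; ring
    rw [this, hWsq, hξ1, hξ2]; linear_combination E * h12
  have hEl : 0 < E * l := mul_pos hE hl
  -- In the coordinates (ξ, η) the metric is Euclidean up to the factor E, so the second frame
  -- vector is the first one turned by a right angle; ε = ±1 is the orientation.
  obtain ⟨ε, hε, hξ, hη⟩ : ∃ ε : ℝ, ε ^ 2 = 1 ∧ ξ2 = -ε * η1 ∧ η2 = ε * ξ1 := by
    have hsq : (ξ1 * η2 - η1 * ξ2) ^ 2 = (E * l) ^ 2 := by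
      linear_combination (ξ2 ^ 2 + η2 ^ 2) * k11 + (E * l) * k22
        - (ξ1 * ξ2 + η1 * η2) * k12
    refine ⟨(ξ1 * η2 - η1 * ξ2) / (E * l), by rw [div_pow, hsq, div_self (by positivity)], ?_, ?_⟩
    · rw [neg_mul, div_mul_eq_mul_div, ← neg_div, eq_div_iff hEl.ne']
      linear_combination -ξ2 * k11 + ξ1 * k12
    · rw [div_mul_eq_mul_div, eq_div_iff hEl.ne']
      linear_combination -η2 * k11 + η1 * k12
  have hWE : W * E ≠ 0 := by positivity
  refine ⟨(W * A0 * h1 ξ1 η1 + (E * A1 - 4 * A0 * F) * h2 ξ1 η1) / (W * E),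
    ε * (-16 * (W * A0) * h2 ξ1 η1 + (E * A1 - 4 * A0 * F) * h1 ξ1 η1) / (W * E), fun x y => ?_⟩
  have key := mul_quart_eq hWsq A0 A1 (x * v1 0 + y * v2 0) (x * v1 1 + y * v2 1)
  have e1 : E * (x * v1 0 + y * v2 0) + F * (x * v1 1 + y * v2 1) = x * ξ1 - y * ε * η1 := by
    rw [hξ1]; linear_combination y * hξ
  have e2 : W * (x * v1 1 + y * v2 1) = x * η1 + y * ε * ξ1 := by
    rw [hη1]; linear_combination y * hη
  rw [e1, e2] at key
  rw [div_mul_eq_mul_div, div_mul_eq_mul_div, ← add_div, eq_div_iff hWE, mul_comm, key]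
  have hε3 : ε ^ 3 = ε := by linear_combination ε * hε
  have hε4 : ε ^ 4 = 1 := by linear_combination (ε ^ 2 + 1) * hε
  have g1 : h1 (x * ξ1 - y * ε * η1) (x * η1 + y * ε * ξ1)
      = h1 ξ1 η1 * h1 x y - 16 * ε * h2 ξ1 η1 * h2 x y := by
    unfold h1 h2
    ring_nf
    simp only [hε, hε3, hε4]
    ring
  have g2 : h2 (x * ξ1 - y * ε * η1) (x * η1 + y * ε * ξ1)
      = h2 ξ1 η1 * h1 x y + ε * h1 ξ1 η1 * h2 x y := by
    unfold h1 h2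
    ring_nf
    simp only [hε, hε3, hε4]
    ring
  rw [g1, g2]
  ring

lemma quart_add (E F G A0 A1 B0 B1 dx dy : ℝ) : quart E F G (A0 + B0) (A1 + B1) dx dy =
    quart E F G A0 A1 dx dy + quart E F G B0 B1 dx dy := by
  unfold quart; ring

lemma quart_smul (E F G c A0 A1 dx dy : ℝ) : quart E F G (c * A0) (c * A1) dx dy =
    c * quart E F G A0 A1 dx dy := by
  unfold quart; ring

/-- The derivative of the quartic form in the direction `w`, evaluated at `v`: here `A0`, `A1` are
the differentials of the coefficients `a₀`, `a₁`. -/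
def axialTensor (E F G : ℝ) (A0 A1 : Plane →L[ℝ] ℝ) (w v : Plane) : ℝ :=
  quart E F G (A0 w) (A1 w) (v 0) (v 1)

/-- The tensor with metric `E`, `F`, `G` and differentials `A0`, `A1` takes the normal form with
coefficients `a`, `b` in some conformal frame. -/
def HasAxis (E F G : ℝ) (A0 A1 : Plane →L[ℝ] ℝ) (a b : ℝ) : Prop :=
  ∃ (v1 v2 : Plane) (l κ : ℝ), 0 < l ∧ κ ≠ 0 ∧ metric E F G v1 v1 = l ∧ metric E F G v2 v2 = l ∧
    metric E F G v1 v2 = 0 ∧ ∀ s t x y : ℝ,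
      axialTensor E F G A0 A1 (s • v1 + t • v2) (x • v1 + y • v2) =
        κ * (t * h1 x y + (a * s + b * t) * h2 x y)

/-- The real part of (zw)⁴ = z⁴w⁴, where z⁴ = `h1` + 4i `h2`; the next lemma is the imaginary part.
-/
lemma h1_rotate (x y s t : ℝ) :
    h1 (s * x - t * y) (s * y + t * x) = h1 x y * h1 s t - 16 * h2 x y * h2 s t := by
  unfold h1 h2; ring

lemma h2_rotate (x y s t : ℝ) :
    h2 (s * x - t * y) (s * y + t * x) = h2 x y * h1 s t + h1 x y * h2 s t := by
  unfold h1 h2; ring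

lemma metric_add_left (E F G : ℝ) (u v w : Plane) :
    metric E F G (u + v) w = metric E F G u w + metric E F G v w := by
  simp only [metric, PiLp.add_apply]; ring

lemma metric_smul_left (E F G c : ℝ) (v w : Plane) :
    metric E F G (c • v) w = c * metric E F G v w := by
  simp only [metric, PiLp.smul_apply, smul_eq_mul]; ring

lemma metric_comm (E F G : ℝ) (v w : Plane) : metric E F G v w = metric E F G w v := by
  simp only [metric]; ring

lemma metric_add_right (E F G : ℝ) (u v w : Plane) :
    metric E F G u (v + w) = metric E F G u v + metric E F G u w := by
  rw [metric_comm, metric_add_left, metric_comm _ _ _ v, metric_comm _ _ _ w]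

lemma metric_smul_right (E F G c : ℝ) (v w : Plane) :
    metric E F G v (c • w) = c * metric E F G v w := by
  rw [metric_comm, metric_smul_left, metric_comm _ _ _ w]

lemma metric_self_pos {E F G : ℝ} (hE : 0 < E) (hW : 0 < E * G - F ^ 2) {v : Plane}
    (hv : v ≠ 0) : 0 < metric E F G v v := by
  have key : E * metric E F G v v = (E * v 0 + F * v 1) ^ 2 + (E * G - F ^ 2) * v 1 ^ 2 := by
    unfold metric; ring
  have hpos : 0 < E * metric E F G v v := by
    rw [key]
    rcases eq_or_ne (v 1) 0 with h | h
    · have h0 : v 0 ≠ 0 := by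
        intro h0; apply hv; ext i; fin_cases i <;> simpa
      rw [h]; simp only [mul_zero, add_zero]; positivity
    · positivity
  exact (mul_pos_iff_of_pos_left hE).mp hpos

/-- Coordinates of a vector in an orthogonal frame. -/
lemma eq_frame_combination {E F G : ℝ} {v1 v2 : Plane}
    {l : ℝ} (hl : 0 < l) (h11 : metric E F G v1 v1 = l) (h22 : metric E F G v2 v2 = l)
    (h12 : metric E F G v1 v2 = 0) (v : Plane) :
    v = (metric E F G v v1 / l) • v1 + (metric E F G v v2 / l) • v2 := by
  have hdet : (E * G - F ^ 2) * (v1 0 * v2 1 - v1 1 * v2 0) ^ 2 = l ^ 2 := by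
    have : (E * G - F ^ 2) * (v1 0 * v2 1 - v1 1 * v2 0) ^ 2
        = metric E F G v1 v1 * metric E F G v2 v2 - metric E F G v1 v2 ^ 2 := by
      unfold metric; ring
    rw [this, h11, h22, h12]; ring
  have hd : v1 0 * v2 1 - v1 1 * v2 0 ≠ 0 := by
    intro h; rw [h] at hdet
    have : 0 < l ^ 2 := by positivity
    simp at hdet; linarith
  set d := v1 0 * v2 1 - v1 1 * v2 0 with hddef
  set s := (v 0 * v2 1 - v 1 * v2 0) / d with hs
  set t := (v1 0 * v 1 - v1 1 * v 0) / d with ht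
  have hv : v = s • v1 + t • v2 := by
    ext i; fin_cases i
    · simp only [PiLp.add_apply, PiLp.smul_apply, smul_eq_mul, hs, ht, Fin.zero_eta]
      field_simp
      rw [hddef]; ring
    · simp only [PiLp.add_apply, PiLp.smul_apply, smul_eq_mul, hs, ht, Fin.mk_one]
      field_simp
      rw [hddef]; ring
  have e1 : metric E F G v v1 / l = s := by
    rw [div_eq_iff hl.ne', hv, metric_add_left, metric_smul_left, metric_smul_left, h11,
      metric_comm _ _ _ v2, h12]
    ring
  have e2 : metric E F G v v2 / l = t := by
    rw [div_eq_iff hl.ne', hv, metric_add_left, metric_smul_left, metric_smul_left, h22, h12]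
    ring
  rw [e1, e2]; exact hv

lemma Δ_neg_right (a b : ℝ) : Δ a (-b) = Δ a b := by unfold Δ; ring

/-- Comparison of two normal forms of the same tensor. -/
lemma HasAxis.exists_pos_Δ_mul_eq {E F G : ℝ}
    {A0 A1 : Plane →L[ℝ] ℝ} {a b a' b' : ℝ} (h : HasAxis E F G A0 A1 a b)
    (h' : HasAxis E F G A0 A1 a' b') :
    ∃ κ : ℝ, 0 < κ ∧ Δ a' b' * (1 + a') ^ 2 = κ * (Δ a b * (1 + a) ^ 2) := by
  obtain ⟨v1, v2, l, κ, hl, hκ, h11, h22, h12, hT⟩ := h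
  obtain ⟨w1, w2, l', κ', hl', hκ', k11, k22, k12, hT'⟩ := h'
  set x := metric E F G w1 v1 / l
  set y := metric E F G w1 v2 / l
  have hw1 : w1 = x • v1 + y • v2 := eq_frame_combination hl h11 h22 h12 w1
  set s := metric E F G w2 v1 / l
  set t := metric E F G w2 v2 / l
  have hw2 : w2 = s • v1 + t • v2 := eq_frame_combination hl h11 h22 h12 w2
  have expand : ∀ p q r u : ℝ, metric E F G (p • v1 + q • v2) (r • v1 + u • v2)
      = (p * r + q * u) * l := by
    intro p q r u
    simp only [metric_add_left, metric_add_right, metric_smul_left, metric_smul_right, h11, h22,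
      h12, metric_comm E F G v2 v1]
    ring
  rw [hw1, expand] at k11
  rw [hw2, expand] at k22
  rw [hw1, hw2, expand] at k12
  have k12' : x * s + y * t = 0 := (mul_eq_zero.mp k12).resolve_right hl.ne'
  have hR : 0 < x * x + y * y := by
    by_contra hneg
    nlinarith [mul_nonneg (neg_nonneg.mpr (not_lt.mp hneg)) hl.le]
  have hRR : s * s + t * t = x * x + y * y := by
    apply mul_right_cancel₀ hl.ne'; rw [k11, k22]
  have hxy : x ≠ 0 ∨ y ≠ 0 := by
    by_contra! h0
    rw [h0.1, h0.2] at hR; norm_num at hR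
  -- the case of equal orientations
  have main : ∀ (b'' κ'' : ℝ), κ'' ≠ 0 → (∀ p q X Y : ℝ,
      axialTensor E F G A0 A1 (p • w1 + q • (-y • v1 + x • v2)) (X • w1 + Y • (-y • v1 + x • v2))
        = κ'' * (q * h1 X Y + (a' * p + b'' * q) * h2 X Y)) →
      ∃ c : ℝ, 0 < c ∧ Δ a' b'' * (1 + a') ^ 2 = c * (Δ a b * (1 + a) ^ 2) := by
    intro b'' κ'' hκ'' hT''
    have key : ∀ p q X Y : ℝ, κ'' * (q * h1 X Y + (a' * p + b'' * q) * h2 X Y) =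
        κ * ((p * y + q * x) * (h1 x y * h1 X Y - 16 * h2 x y * h2 X Y)
          + (a * (p * x - q * y) + b * (p * y + q * x))
            * (h2 x y * h1 X Y + h1 x y * h2 X Y)) := by
      intro p q X Y
      rw [← hT'', hw1]
      have e : ∀ p q : ℝ, p • (x • v1 + y • v2) + q • (-y • v1 + x • v2)
          = (p * x - q * y) • v1 + (p * y + q * x) • v2 := by
        intro p q; module
      rw [e, e, hT, h1_rotate, h2_rotate]
    -- A combination of `h1` and `h2` is determined by its values at (1, 0), where they are 1 and 0,
    -- and at (2, 1), where they are -7 and 6. The constants 6 and 7, here and in `axisA` and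
    -- `axisB`, come from this.
    have q1 := key 1 0 1 0
    have q2 := key 1 0 2 1
    have q3 := key 0 1 1 0
    have q4 := key 0 1 2 1
    have hv1 : h1 1 0 = 1 := by norm_num [h1]
    have hv2 : h2 1 0 = 0 := by norm_num [h2]
    have hv3 : h1 2 1 = -7 := by norm_num [h1]
    have hv4 : h2 2 1 = 6 := by norm_num [h2]
    simp only [hv1, hv2, hv3, hv4] at q1 q2 q3 q4
    have e1 : y * h1 x y + (a * x + b * y) * h2 x y = 0 := by
      have : κ * (y * h1 x y + (a * x + b * y) * h2 x y) = 0 := by linear_combination -q1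
      exact (mul_eq_zero.mp this).resolve_left hκ
    refine Axial.exists_pos_Δ_mul_eq (δ := κ'' / κ) (x := x) (y := y) hxy (div_ne_zero hκ'' hκ)
      e1 ?_ ?_ ?_
    · rw [div_mul_eq_mul_div, div_eq_iff hκ]
      linear_combination (1 / 6) * q2 - (7 / 6) * κ * e1
    · rw [div_eq_iff hκ]; linear_combination q3
    · rw [div_mul_eq_mul_div, div_eq_iff hκ]
      linear_combination (1 / 6) * q4 + (7 / 6) * q3
  -- Both frames are orthogonal with vectors of equal length, so the second vector of the new frame
  -- is determined up to sign.
  obtain hor | hor : (s = -y ∧ t = x) ∨ (s = y ∧ t = -x) := by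
    have hsq : (x * t - y * s - (x * x + y * y)) * (x * t - y * s + (x * x + y * y)) = 0 := by
      linear_combination (x * x + y * y) * hRR - (x * s + y * t) * k12'
    rcases mul_eq_zero.mp hsq with h | h
    · left
      constructor
      · apply mul_left_cancel₀ hR.ne'; linear_combination x * k12' - y * h
      · apply mul_left_cancel₀ hR.ne'; linear_combination y * k12' + x * h
    · right
      constructor
      · apply mul_left_cancel₀ hR.ne'; linear_combination x * k12' - y * h
      · apply mul_left_cancel₀ hR.ne'; linear_combination y * k12' + x * h
  · refine main b' κ' hκ' fun p q X Y => ?_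
    rw [← hT' p q X Y, hw2, hor.1, hor.2]
  -- Reversing the second frame vector preserves `h1` and changes the sign of `h2`, so b and κ
  -- change sign; `Δ` is even in b.
  · have := main (-b') (-κ') (neg_ne_zero.mpr hκ') fun p q X Y => ?_
    · rwa [Δ_neg_right] at this
    · have hw : -y • v1 + x • v2 = -w2 := by rw [hw2, hor.1, hor.2]; module
      rw [hw, smul_neg, smul_neg, ← neg_smul, ← neg_smul, hT']
      unfold h1 h2; ring

/-- Change of the axis of a normal form. -/
lemma HasAxis.rotate {E F G : ℝ} {A0 A1 : Plane →L[ℝ] ℝ} {a b a' b' x y δ : ℝ}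
    (h : HasAxis E F G A0 A1 a b) (hxy : x ≠ 0 ∨ y ≠ 0) (hδ : δ ≠ 0)
    (e1 : y * h1 x y + (a * x + b * y) * h2 x y = 0)
    (e2 : δ * a' = -16 * y * h2 x y + (a * x + b * y) * h1 x y)
    (e3 : δ = x * h1 x y + (-a * y + b * x) * h2 x y)
    (e4 : δ * b' = -16 * x * h2 x y + (-a * y + b * x) * h1 x y) :
    HasAxis E F G A0 A1 a' b' := by
  obtain ⟨v1, v2, l, κ, hl, hκ, h11, h22, h12, hT⟩ := h
  have hR : 0 < x * x + y * y := by
    rcases hxy with h | h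
    · nlinarith [mul_self_pos.mpr h, mul_self_nonneg y]
    · nlinarith [mul_self_pos.mpr h, mul_self_nonneg x]
  have expand : ∀ p q r u : ℝ, metric E F G (p • v1 + q • v2) (r • v1 + u • v2)
      = (p * r + q * u) * l := by
    intro p q r u
    simp only [metric_add_left, metric_add_right, metric_smul_left, metric_smul_right, h11, h22,
      h12, metric_comm E F G v2 v1]
    ring
  refine ⟨x • v1 + y • v2, -y • v1 + x • v2, (x * x + y * y) * l, κ * δ, by positivity,
    mul_ne_zero hκ hδ, expand _ _ _ _, ?_, ?_, fun p q X Y => ?_⟩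
  · rw [expand]; ring
  · rw [expand]; ring
  · have e : ∀ p q : ℝ, p • (x • v1 + y • v2) + q • (-y • v1 + x • v2)
        = (p * x - q * y) • v1 + (p * y + q * x) • v2 := by
      intro p q; module
    rw [e, e, hT, h1_rotate, h2_rotate]
    linear_combination κ * (p * h1 X Y * e1 - p * h2 X Y * e2 - q * h1 X Y * e3 - q * h2 X Y * e4)

/-- The rotation by a right angle with respect to the metric. -/
def perp (E F G : ℝ) (v : Plane) : Plane :=
  (√(E * G - F ^ 2))⁻¹ • !₂[-(F * v 0 + G * v 1), E * v 0 + F * v 1]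

/-- The coefficient `a` of the normal form whose axis has the direction `v`. -/
def axisA (E F G : ℝ) (A0 A1 : Plane →L[ℝ] ℝ) (v : Plane) : ℝ :=
  axialTensor E F G A0 A1 v ((2 : ℝ) • v + perp E F G v)
    / (6 * axialTensor E F G A0 A1 (perp E F G v) v)

/-- The coefficient `b` of the normal form whose axis has the direction `v`. -/
def axisB (E F G : ℝ) (A0 A1 : Plane →L[ℝ] ℝ) (v : Plane) : ℝ :=
  (axialTensor E F G A0 A1 (perp E F G v) ((2 : ℝ) • v + perp E F G v)
    + 7 * axialTensor E F G A0 A1 (perp E F G v) v)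
    / (6 * axialTensor E F G A0 A1 (perp E F G v) v)

lemma metric_perp_perp {E F G : ℝ} (hW : 0 < E * G - F ^ 2) (v : Plane) :
    metric E F G (perp E F G v) (perp E F G v) = metric E F G v v := by
  have hs : √(E * G - F ^ 2) ^ 2 = E * G - F ^ 2 := Real.sq_sqrt hW.le
  have hs0 : √(E * G - F ^ 2) ≠ 0 := (Real.sqrt_pos.mpr hW).ne'
  unfold perp
  rw [metric_smul_left, metric_smul_right, ← mul_assoc, ← sq, inv_pow, hs, inv_mul_eq_iff_eq_mul₀
    hW.ne']
  simp [metric]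
  ring

lemma metric_perp_right (E F G : ℝ) (v : Plane) : metric E F G v (perp E F G v) = 0 := by
  unfold perp
  rw [metric_smul_right]
  apply mul_eq_zero_of_right
  simp [metric]
  ring

lemma axialTensor_add_smul_left (E F G : ℝ) (A0 A1 : Plane →L[ℝ] ℝ) (s t : ℝ) (w w' v : Plane) :
    axialTensor E F G A0 A1 (s • w + t • w') v =
      s * axialTensor E F G A0 A1 w v + t * axialTensor E F G A0 A1 w' v := by
  unfold axialTensor
  simp only [map_add, map_smul, smul_eq_mul, quart_add, quart_smul]

/-- In a conformal frame whose first vector is a root of the quintic, the tensor has the normal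
form. -/
lemma hasAxis_of_frame {E F G : ℝ} (hE : 0 < E) (hW : 0 < E * G - F ^ 2)
    {A0 A1 : Plane →L[ℝ] ℝ} {v1 v2 : Plane} {l : ℝ} (hl : 0 < l)
    (h11 : metric E F G v1 v1 = l) (h22 : metric E F G v2 v2 = l) (h12 : metric E F G v1 v2 = 0)
    (hroot : axialTensor E F G A0 A1 v1 v1 = 0) (hne : axialTensor E F G A0 A1 v2 v1 ≠ 0) :
    ∀ s t x y : ℝ, axialTensor E F G A0 A1 (s • v1 + t • v2) (x • v1 + y • v2) =
      axialTensor E F G A0 A1 v2 v1 * (t * h1 x y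
        + (axialTensor E F G A0 A1 v1 ((2 : ℝ) • v1 + v2) / (6 * axialTensor E F G A0 A1 v2 v1) * s
          + (axialTensor E F G A0 A1 v2 ((2 : ℝ) • v1 + v2) + 7 * axialTensor E F G A0 A1 v2 v1)
            / (6 * axialTensor E F G A0 A1 v2 v1) * t) * h2 x y) := by
  have hv1 : h1 1 0 = 1 := by norm_num [h1]
  have hv2 : h2 1 0 = 0 := by norm_num [h2]
  have hv3 : h1 2 1 = -7 := by norm_num [h1]
  have hv4 : h2 2 1 = 6 := by norm_num [h2]
  have harm : ∀ w : Plane, ∃ α β : ℝ, ∀ x y : ℝ,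
      axialTensor E F G A0 A1 w (x • v1 + y • v2) = α * h1 x y + β * h2 x y := fun w => by
    obtain ⟨α, β, h⟩ := exists_quart_eq_harmonic hE hW hl h11 h22 h12 (A0 w) (A1 w)
    refine ⟨α, β, fun x y => ?_⟩
    rw [← h x y]
    simp [axialTensor]
  obtain ⟨α1, β1, H1⟩ := harm v1
  obtain ⟨α2, β2, H2⟩ := harm v2
  have g10 := H1 1 0
  have g11 := H1 2 1
  have g20 := H2 1 0
  have g21 := H2 2 1
  simp only [one_smul, zero_smul, add_zero, hv1, hv2, hv3, hv4, mul_one, mul_zero]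
    at g10 g11 g20 g21
  intro s t x y
  rw [axialTensor_add_smul_left, H1, H2, g11, g21]
  rw [hroot] at g10
  rw [g20] at hne ⊢
  rw [← g10]
  field_simp
  ring

/-- This reduces normal forms to roots of the quintic, a problem accessible to the implicit function
theorem, with coefficients given by explicit formulas. -/
lemma hasAxis_of_root {E F G : ℝ} (hE : 0 < E) (hW : 0 < E * G - F ^ 2)
    {A0 A1 : Plane →L[ℝ] ℝ} {v : Plane} (hv : v ≠ 0)
    (hroot : axialTensor E F G A0 A1 v v = 0)
    (hne : axialTensor E F G A0 A1 (perp E F G v) v ≠ 0) :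
    HasAxis E F G A0 A1 (axisA E F G A0 A1 v) (axisB E F G A0 A1 v) :=
  ⟨v, perp E F G v, _, _, metric_self_pos hE hW hv, hne, rfl, metric_perp_perp hW v,
    metric_perp_right E F G v, hasAxis_of_frame hE hW (metric_self_pos hE hW hv) rfl
      (metric_perp_perp hW v) (metric_perp_right E F G v) hroot hne⟩

/-- The second vector of the frame is `perp` of the first up to sign, and the sign passes to κ and
b. Normal forms are thus parametrized by the first vector alone. -/
lemma HasAxis.exists_frame {E F G : ℝ} (hW : 0 < E * G - F ^ 2)
    {A0 A1 : Plane →L[ℝ] ℝ} {a b : ℝ} (h : HasAxis E F G A0 A1 a b) :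
    ∃ (v : Plane) (κ b' : ℝ), v ≠ 0 ∧ κ ≠ 0 ∧ (b' = b ∨ b' = -b) ∧ ∀ s t x y : ℝ,
      axialTensor E F G A0 A1 (s • v + t • perp E F G v) (x • v + y • perp E F G v) =
        κ * (t * h1 x y + (a * s + b' * t) * h2 x y) := by
  obtain ⟨v1, v2, l, κ, hl, hκ, h11, h22, h12, hT⟩ := h
  have hv1 : v1 ≠ 0 := by
    rintro rfl
    simp [metric] at h11
    exact hl.ne h11
  have hp := eq_frame_combination hl h11 h22 h12 (perp E F G v1)
  rw [metric_comm _ _ _ (perp E F G v1) v1, metric_perp_right, zero_div, zero_smul, zero_add] at hp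
  set c := metric E F G (perp E F G v1) v2 / l
  have hc : c ^ 2 = 1 := by
    have := metric_perp_perp hW v1
    rw [hp, metric_smul_left, metric_smul_right, h22, h11, ← mul_assoc, ← sq] at this
    exact mul_right_cancel₀ hl.ne' (by rw [this, one_mul])
  rcases mul_self_eq_one_iff.mp ((sq c).symm.trans hc) with h | h
  · exact ⟨v1, κ, b, hv1, hκ, Or.inl rfl, by rw [hp, h, one_smul]; exact hT⟩
  · refine ⟨v1, -κ, -b, hv1, neg_ne_zero.mpr hκ, Or.inr rfl, fun s t x y => ?_⟩
    rw [hp, h, smul_smul, smul_smul, hT]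
    unfold h1 h2
    ring

lemma axis_eq_of_frame {E F G : ℝ} {A0 A1 : Plane →L[ℝ] ℝ} {v : Plane} {a b κ : ℝ} (hκ : κ ≠ 0)
    (h : ∀ s t x y : ℝ,
      axialTensor E F G A0 A1 (s • v + t • perp E F G v) (x • v + y • perp E F G v) =
        κ * (t * h1 x y + (a * s + b * t) * h2 x y)) :
    axisA E F G A0 A1 v = a ∧ axisB E F G A0 A1 v = b := by
  have hv1 : h1 1 0 = 1 := by norm_num [h1]
  have hv2 : h2 1 0 = 0 := by norm_num [h2]
  have hv3 : h1 2 1 = -7 := by norm_num [h1]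
  have hv4 : h2 2 1 = 6 := by norm_num [h2]
  have q2 := h 1 0 2 1
  have q3 := h 0 1 1 0
  have q4 := h 0 1 2 1
  simp only [one_smul, zero_smul, zero_add, add_zero, hv1, hv2, hv3, hv4] at q2 q3 q4
  unfold axisA axisB
  rw [q2, q3, q4]
  constructor
  · field_simp; ring
  · field_simp; ring

/-! ### Curvature under changes of coordinates -/

lemma plane_eq (v : Plane) : v = v 0 • dX + v 1 • dY := by
  ext i; fin_cases i <;> simp [dX, dY]

lemma firstForm_eq_metric (X : Plane → Space) (q v w : Plane) :
    firstForm X q v w = metric (coefE X q) (coefF X q) (coefG X q) v w := by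
  conv_lhs => rw [plane_eq v, plane_eq w]
  simp only [metric, coefE, coefF, coefG, firstForm, map_add, map_smul, inner_add_left,
    inner_add_right, real_inner_smul_left, real_inner_smul_right]
  rw [real_inner_comm (fderiv ℝ X q dX) (fderiv ℝ X q dY)]
  ring

lemma coefE_pos {X : Plane → Space} {q : Plane} (h : Function.Injective (fderiv ℝ X q)) :
    0 < coefE X q := by
  have : fderiv ℝ X q dX ≠ 0 := by
    rw [Ne, map_eq_zero_iff _ h]
    intro h0
    have := congrArg (fun v : Plane => v 0) h0
    simp [dX] at this
  exact real_inner_self_pos.mpr this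

lemma coef_det_pos {X : Plane → Space} {q : Plane} (h : Function.Injective (fderiv ℝ X q)) :
    0 < coefE X q * coefG X q - coefF X q ^ 2 := by
  have hE := coefE_pos h
  set v : Plane := !₂[-coefF X q, coefE X q] with hv
  have hv0 : v ≠ 0 := by
    intro h0
    have := congrArg (fun v : Plane => v 1) h0
    simp [hv] at this
    exact hE.ne' this
  have hpos : 0 < firstForm X q v v :=
    real_inner_self_pos.mpr (by rwa [Ne, map_eq_zero_iff _ h])
  rw [firstForm_eq_metric] at hpos
  have e : metric (coefE X q) (coefF X q) (coefG X q) v v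
      = coefE X q * (coefE X q * coefG X q - coefF X q ^ 2) := by
    simp [metric, hv]; ring
  rw [e] at hpos
  exact (mul_pos_iff_of_pos_left hE).mp hpos

lemma secondForm_eq {X : Plane → Space} {q : Plane} (hX : ContDiffAt ℝ 2 X q) (v w : Plane) :
    secondForm X q v w = (v 0 * w 0) • vecE X q + (v 0 * w 1 + v 1 * w 0) • vecF X q
      + (v 1 * w 1) • vecG X q := by
  have hsymm : fderiv ℝ (fderiv ℝ X) q dY dX = fderiv ℝ (fderiv ℝ X) q dX dY :=
    (hX.isSymmSndFDerivAt (by simp)) dY dX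
  conv_lhs => rw [plane_eq v, plane_eq w]
  simp only [vecE, vecF, vecG, secondForm, map_add, map_smul, add_apply,
    smul_apply, hsymm]
  module

/-- The rotation by a right angle, scaled by the area element. -/
def rot (E F G : ℝ) (v : Plane) : Plane := !₂[-(F * v 0 + G * v 1), E * v 0 + F * v 1]

/-- The quartic form whose zeros are the axial directions, in terms of the fundamental forms. -/
def axialQuartic (E F G : ℝ) (B : Plane → Plane → Space) (v : Plane) : ℝ :=
  inner ℝ ((E * G - F ^ 2) • B v v - B (rot E F G v) (rot E F G v)) (B v (rot E F G v))

/-- For a unit vector v with rotation Jv, II(v, v) - II(Jv, Jv) is twice the radius vector of the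
curvature ellipse and 2 II(v, Jv) its velocity; axial directions are those where the two are
orthogonal. This frame-free expression makes the transformation laws computable. -/
lemma axialForm_eq {X : Plane → Space} {q : Plane} (hX : ContDiffAt ℝ 2 X q) (v : Plane) :
    axialForm X q (v 0) (v 1) = -4 * coefE X q ^ 3 *
      axialQuartic (coefE X q) (coefF X q) (coefG X q) (secondForm X q) v := by
  unfold axialQuartic
  simp only [secondForm_eq hX, rot]
  unfold axialForm a0 a1
  generalize coefE X q = E
  generalize coefF X q = F
  generalize coefG X q = G
  generalize vecE X q = e
  generalize vecF X q = f
  generalize vecG X q = g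
  simp only [inner_add_left, inner_add_right, inner_sub_left, real_inner_smul_left,
    real_inner_smul_right, smul_add, smul_smul, Matrix.cons_val_zero,
    Matrix.cons_val_one]
  rw [real_inner_comm e f, real_inner_comm e g, real_inner_comm f g]
  simp
  ring

/-- The determinant of a linear map of the plane. -/
def det2 (T : Plane →L[ℝ] Plane) : ℝ := T dX 0 * T dY 1 - T dX 1 * T dY 0

lemma apply_plane (T : Plane →L[ℝ] Plane) (v : Plane) (i : Fin 2) :
    T v i = v 0 * T dX i + v 1 * T dY i := by
  conv_lhs => rw [plane_eq v]
  simp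

lemma det2_ne_zero {T : Plane →L[ℝ] Plane} (hT : Function.Injective T) : det2 T ≠ 0 := by
  intro h0
  unfold det2 at h0
  have key : ∀ i : Fin 2, T !₂[-(T dY i), T dX i] = 0 := by
    intro i
    ext j
    rw [apply_plane]
    fin_cases i <;> fin_cases j <;> simp <;> linarith
  have hz : ∀ i : Fin 2, T dX i = 0 := by
    intro i
    have := (map_eq_zero_iff T hT).mp (key i)
    have := congrArg (fun v : Plane => v 1) this
    simpa using this
  have : T dX = 0 := by ext i; simpa using hz i
  have := congrArg (fun v : Plane => v 0) ((map_eq_zero_iff T hT).mp this)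
  simp [dX] at this

/-- The scaled rotation intertwines with `T` up to the factor c²·det T. It occurs three times in the
product, and each of the two values of `B` contributes one more c, whence c⁸·(det T)³. -/
lemma axialQuartic_transform {E F G E' F' G' c : ℝ} {B B' : Plane → Plane → Space}
    (T : Plane →L[ℝ] Plane) (Λ : Space ≃ₗᵢ[ℝ] Space)
    (hE : E' = c ^ 2 * metric E F G (T dX) (T dX)) (hF : F' = c ^ 2 * metric E F G (T dX) (T dY))
    (hG : G' = c ^ 2 * metric E F G (T dY) (T dY))
    (hB : ∀ v w, B' v w = c • Λ (B (T v) (T w)))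
    (hl : ∀ (s : ℝ) u v, B (s • u) v = s • B u v)
    (hr : ∀ (s : ℝ) u v, B u (s • v) = s • B u v) (v : Plane) :
    axialQuartic E' F' G' B' v = c ^ 8 * det2 T ^ 3 * axialQuartic E F G B (T v) := by
  have hrot : T (rot E' F' G' v) = (c ^ 2 * det2 T) • rot E F G (T v) := by
    ext i
    rw [apply_plane]
    simp only [rot, PiLp.smul_apply, smul_eq_mul, hE, hF, hG, metric, apply_plane T v, det2]
    fin_cases i <;> simp <;> ring
  have hW : E' * G' - F' ^ 2 = (c ^ 2 * det2 T) ^ 2 * (E * G - F ^ 2) := by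
    rw [hE, hF, hG]; unfold metric det2; ring
  unfold axialQuartic
  simp only [hB, hrot, hl, hr, map_smul, hW]
  simp only [inner_sub_left, real_inner_smul_left, real_inner_smul_right,
    LinearIsometryEquiv.inner_map_map]
  ring

lemma affineIsometryEquiv_apply (Γ : Space ≃ᵃⁱ[ℝ] Space) (x : Space) :
    Γ x = Γ.linearIsometryEquiv x + Γ 0 := by
  simpa using Γ.map_vadd 0 x

section Transform

variable {X Y : Plane → Space} {τ : Plane → Plane} {y : Plane} {c : ℝ} {Γ : Space ≃ᵃⁱ[ℝ] Space}

lemma fderiv_similarity (hX : DifferentiableAt ℝ X (τ y)) (hτ : DifferentiableAt ℝ τ y)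
    (hY : Y =ᶠ[𝓝 y] fun z => c • Γ (X (τ z))) (v : Plane) :
    fderiv ℝ Y y v = c • Γ.linearIsometryEquiv (fderiv ℝ X (τ y) (fderiv ℝ τ y v)) := by
  have h1 : HasFDerivAt (fun z => X (τ z)) ((fderiv ℝ X (τ y)).comp (fderiv ℝ τ y)) y :=
    hX.hasFDerivAt.comp y hτ.hasFDerivAt
  have h2 := ((Γ.linearIsometryEquiv.toContinuousLinearEquiv.toContinuousLinearMap.hasFDerivAt.comp
    y h1).add_const (Γ 0)).const_smul c
  have h3 : HasFDerivAt Y _ y := h2.congr_of_eventuallyEq (hY.trans (Eventually.of_forall fun z => by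
    simp only [affineIsometryEquiv_apply Γ (X (τ z))]; rfl))
  rw [h3.fderiv]
  rfl

lemma fderiv_fderiv_similarity (hX : ContDiffAt ℝ 2 X (τ y)) (hτ : ContDiffAt ℝ 2 τ y)
    (hY : Y =ᶠ[𝓝 y] fun z => c • Γ (X (τ z))) (v w : Plane) :
    fderiv ℝ (fderiv ℝ Y) y v w = c • Γ.linearIsometryEquiv
      (fderiv ℝ (fderiv ℝ X) (τ y) (fderiv ℝ τ y v) (fderiv ℝ τ y w)
        + fderiv ℝ X (τ y) (fderiv ℝ (fderiv ℝ τ) y v w)) := by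
  have hXd : ∀ᶠ z in 𝓝 y, DifferentiableAt ℝ X (τ z) :=
    hτ.continuousAt.eventually ((hX.eventually (by simp)).mono fun z hz =>
      hz.differentiableAt (by norm_num))
  have hτd : ∀ᶠ z in 𝓝 y, DifferentiableAt ℝ τ z :=
    (hτ.eventually (by simp)).mono fun z hz => hz.differentiableAt (by norm_num)
  obtain ⟨Λ, hΛ⟩ : ∃ Λ : Space →L[ℝ] Space, ∀ x, Λ x = Γ.linearIsometryEquiv x :=
    ⟨Γ.linearIsometryEquiv.toContinuousLinearEquiv.toContinuousLinearMap, fun _ => rfl⟩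
  have heq : fderiv ℝ Y =ᶠ[𝓝 y] fun z =>
      c • Λ.comp ((fderiv ℝ X (τ z)).comp (fderiv ℝ τ z)) := by
    filter_upwards [hXd, hτd, hY.eventuallyEq_nhds] with z h1 h2 h3
    ext1 v
    rw [fderiv_similarity h1 h2 h3, ← hΛ]
    rfl
  have hX' : HasFDerivAt (fun z => fderiv ℝ X (τ z))
      ((fderiv ℝ (fderiv ℝ X) (τ y)).comp (fderiv ℝ τ y)) y :=
    ((hX.fderiv_right (m := 1) (by norm_num)).differentiableAt (by norm_num)).hasFDerivAt.comp y
      (hτ.differentiableAt (by norm_num)).hasFDerivAt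
  have hτ' : HasFDerivAt (fderiv ℝ τ) (fderiv ℝ (fderiv ℝ τ) y) y :=
    ((hτ.fderiv_right (m := 1) (by norm_num)).differentiableAt (by norm_num)).hasFDerivAt
  have h := ((ContinuousLinearMap.compL ℝ Plane Space Space Λ).hasFDerivAt.comp y
    (hX'.clm_comp hτ')).const_smul c
  rw [(h.congr_of_eventuallyEq heq).fderiv, ← hΛ, map_add, add_comm]
  simp only [smul_apply, ContinuousLinearMap.comp_apply, map_add, add_apply,
    ContinuousLinearMap.compL_apply, ContinuousLinearMap.flip_apply]

lemma firstForm_similarity (hX : DifferentiableAt ℝ X (τ y)) (hτ : DifferentiableAt ℝ τ y)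
    (hY : Y =ᶠ[𝓝 y] fun z => c • Γ (X (τ z))) (v w : Plane) :
    firstForm Y y v w = c ^ 2 * firstForm X (τ y) (fderiv ℝ τ y v) (fderiv ℝ τ y w) := by
  unfold firstForm
  rw [fderiv_similarity hX hτ hY, fderiv_similarity hX hτ hY, real_inner_smul_left,
    real_inner_smul_right, LinearIsometryEquiv.inner_map_map]
  ring

/-- The chain rule adds only the tangential term dX(d²τ), which the normal projection kills.
Surjectivity of dτ makes the tangent planes correspond. -/
lemma secondForm_similarity (hX : ContDiffAt ℝ 2 X (τ y)) (hτ : ContDiffAt ℝ 2 τ y)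
    (hsurj : Function.Surjective (fderiv ℝ τ y))
    (hY : Y =ᶠ[𝓝 y] fun z => c • Γ (X (τ z))) (v w : Plane) :
    secondForm Y y v w =
      c • Γ.linearIsometryEquiv (secondForm X (τ y) (fderiv ℝ τ y v) (fderiv ℝ τ y w)) := by
  have hXd := hX.differentiableAt (by norm_num : (2 : WithTop ℕ∞) ≠ 0)
  have hτd := hτ.differentiableAt (by norm_num : (2 : WithTop ℕ∞) ≠ 0)
  set x : Space := fderiv ℝ (fderiv ℝ X) (τ y) (fderiv ℝ τ y v) (fderiv ℝ τ y w) with hx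
  unfold secondForm
  rw [← hx]
  apply Submodule.eq_starProjection_of_mem_orthogonal
  · rw [Submodule.mem_orthogonal]
    rintro u ⟨z, rfl⟩
    have hz : fderiv ℝ Y y z = _ := fderiv_similarity hXd hτd hY z
    change inner ℝ (fderiv ℝ Y y z) _ = 0
    rw [hz, real_inner_smul_left, real_inner_smul_right, LinearIsometryEquiv.inner_map_map]
    have hmem := Submodule.starProjection_apply_mem (tangentPlane X (τ y))ᗮ x
    have := (Submodule.mem_orthogonal _ _).mp hmem (fderiv ℝ X (τ y) (fderiv ℝ τ y z)) ⟨_, rfl⟩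
    rw [this]; ring
  · rw [Submodule.orthogonal_orthogonal]
    rw [fderiv_fderiv_similarity hX hτ hY, ← hx, ← smul_sub, ← map_sub]
    have hmem : x - (tangentPlane X (τ y))ᗮ.starProjection x ∈ tangentPlane X (τ y) := by
      have := Submodule.sub_starProjection_mem_orthogonal (K := (tangentPlane X (τ y))ᗮ) x
      rwa [Submodule.orthogonal_orthogonal] at this
    obtain ⟨z, hz⟩ := hmem
    obtain ⟨z', hz'⟩ := hsurj (z + fderiv ℝ (fderiv ℝ τ) y v w)
    refine ⟨z', ?_⟩
    change fderiv ℝ Y y z' = _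
    rw [fderiv_similarity hXd hτd hY, hz', map_add]
    have hz2 : fderiv ℝ X (τ y) z = _ := hz
    rw [hz2]
    congr 2
    abel

/-- The quartic form is a relative tensor. -/
lemma axialForm_similarity (hX : ContDiffAt ℝ 2 X (τ y)) (hτ : ContDiffAt ℝ 2 τ y)
    (hsurj : Function.Surjective (fderiv ℝ τ y))
    (hY : Y =ᶠ[𝓝 y] fun z => c • Γ (X (τ z))) (v : Plane) :
    coefE X (τ y) ^ 3 * axialForm Y y (v 0) (v 1) = coefE Y y ^ 3 * c ^ 8 *
      det2 (fderiv ℝ τ y) ^ 3 *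
        axialForm X (τ y) (fderiv ℝ τ y v 0) (fderiv ℝ τ y v 1) := by
  have hXd := hX.differentiableAt (by norm_num : (2 : WithTop ℕ∞) ≠ 0)
  have hτd := hτ.differentiableAt (by norm_num : (2 : WithTop ℕ∞) ≠ 0)
  have hYc : ContDiffAt ℝ 2 Y y := by
    refine ContDiffAt.congr_of_eventuallyEq ?_ hY
    have h : ContDiffAt ℝ 2 (fun z => c • (Γ.linearIsometryEquiv (X (τ z)) + Γ 0)) y :=
      ((Γ.linearIsometryEquiv.contDiff.contDiffAt.comp y (hX.comp y hτ)).add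
        contDiffAt_const).const_smul c
    simpa only [← affineIsometryEquiv_apply] using h
  rw [axialForm_eq hYc, axialForm_eq hX,
    axialQuartic_transform (E := coefE X (τ y)) (F := coefF X (τ y)) (G := coefG X (τ y)) (c := c)
      (B := secondForm X (τ y)) (fderiv ℝ τ y) Γ.linearIsometryEquiv]
  · ring
  · rw [← firstForm_eq_metric]; exact firstForm_similarity hXd hτd hY _ _
  · rw [← firstForm_eq_metric]; exact firstForm_similarity hXd hτd hY _ _
  · rw [← firstForm_eq_metric]; exact firstForm_similarity hXd hτd hY _ _
  · exact secondForm_similarity hX hτ hsurj hY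
  · intro s u v; simp [secondForm]
  · intro s u v; simp [secondForm]

end Transform

/-! ### Axiumbilic points -/

/-- The ellipse of curvature is a circle exactly if the coefficients of the differential equation
of axial lines vanish. -/
lemma ellipseIsCircle_iff {X : Plane → Space} {q : Plane} (hX : ContDiffAt ℝ 2 X q)
    (hinj : Function.Injective (fderiv ℝ X q)) :
    EllipseIsCircle X q ↔ a0 X q = 0 ∧ a1 X q = 0 := by
  have hE := coefE_pos hinj
  have hW := coef_det_pos hinj
  set E := coefE X q with hEdef
  set F := coefF X q with hFdef
  set G := coefG X q with hGdef
  set e := vecE X q with hedef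
  set f := vecF X q with hfdef
  set g := vecG X q with hgdef
  set H := meanCurvature X q with hH
  set e' := e - E • H with he'
  set f' := f - F • H with hf'
  set g' := g - G • H with hg'
  -- The vectors e', f', g' are the coefficients of II - I·H, which is trace-free for the metric.
  -- Pairing this relation with each of them gives three relations among the six inner products p0,
  -- …, p5.
  have htr : E • g' - (2 * F) • f' + G • e' = 0 := by
    have hHW : (2 * (E * G - F ^ 2)) • H = E • g - (2 * F) • f + G • e := by
      rw [hH]; unfold meanCurvature
      rw [smul_inv_smul₀ (by positivity)]
    have : E • g' - (2 * F) • f' + G • e'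
        = (E • g - (2 * F) • f + G • e) - (2 * (E * G - F ^ 2)) • H := by
      rw [he', hf', hg']; module
    rw [this, hHW, sub_self]
  set p0 : ℝ := inner ℝ e' e' with hp0
  set p1 : ℝ := inner ℝ e' f' with hp1
  set p2 : ℝ := inner ℝ f' f' with hp2
  set p3 : ℝ := inner ℝ e' g' with hp3
  set p4 : ℝ := inner ℝ f' g' with hp4
  set p5 : ℝ := inner ℝ g' g' with hp5
  have t1 : E * p3 - 2 * F * p1 + G * p0 = 0 := by
    have := congrArg (fun z => inner ℝ e' z) htr
    simpa only [inner_add_right, inner_sub_right, real_inner_smul_right, inner_zero_right]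
      using this
  have t2 : E * p4 - 2 * F * p2 + G * p1 = 0 := by
    have := congrArg (fun z => inner ℝ f' z) htr
    simp only [inner_add_right, inner_sub_right, real_inner_smul_right, inner_zero_right] at this
    rw [real_inner_comm e' f'] at this
    exact this
  have t3 : E * p5 - 2 * F * p4 + G * p3 = 0 := by
    have := congrArg (fun z => inner ℝ g' z) htr
    simp only [inner_add_right, inner_sub_right, real_inner_smul_right, inner_zero_right] at this
    rw [real_inner_comm f' g', real_inner_comm e' g'] at this
    exact this
  have hee : (inner ℝ e e : ℝ) = p0 + 2 * E * inner ℝ e' H + E ^ 2 * inner ℝ H H := by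
    have : e = e' + E • H := by rw [he']; abel
    rw [this, hp0]
    simp only [inner_add_left, inner_add_right, real_inner_smul_left, real_inner_smul_right]
    rw [real_inner_comm e' H]; ring
  have hef : (inner ℝ e f : ℝ) = p1 + F * inner ℝ e' H + E * inner ℝ f' H
      + E * F * inner ℝ H H := by
    have h1 : e = e' + E • H := by rw [he']; abel
    have h2 : f = f' + F • H := by rw [hf']; abel
    rw [h1, h2, hp1]
    simp only [inner_add_left, inner_add_right, real_inner_smul_left, real_inner_smul_right]
    rw [real_inner_comm f' H]; ring
  have heg : (inner ℝ e g : ℝ) = p3 + G * inner ℝ e' H + E * inner ℝ g' H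
      + E * G * inner ℝ H H := by
    have h1 : e = e' + E • H := by rw [he']; abel
    have h2 : g = g' + G • H := by rw [hg']; abel
    rw [h1, h2, hp3]
    simp only [inner_add_left, inner_add_right, real_inner_smul_left, real_inner_smul_right]
    rw [real_inner_comm g' H]; ring
  have hff : (inner ℝ f f : ℝ) = p2 + 2 * F * inner ℝ f' H + F ^ 2 * inner ℝ H H := by
    have : f = f' + F • H := by rw [hf']; abel
    rw [this, hp2]
    simp only [inner_add_left, inner_add_right, real_inner_smul_left, real_inner_smul_right]
    rw [real_inner_comm f' H]; ring
  have hfg : (inner ℝ f g : ℝ) = p4 + G * inner ℝ f' H + F * inner ℝ g' H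
      + F * G * inner ℝ H H := by
    have h1 : f = f' + F • H := by rw [hf']; abel
    have h2 : g = g' + G • H := by rw [hg']; abel
    rw [h1, h2, hp4]
    simp only [inner_add_left, inner_add_right, real_inner_smul_left, real_inner_smul_right]
    rw [real_inner_comm g' H]; ring
  have hgg : (inner ℝ g g : ℝ) = p5 + 2 * G * inner ℝ g' H + G ^ 2 * inner ℝ H H := by
    have : g = g' + G • H := by rw [hg']; abel
    rw [this, hp5]
    simp only [inner_add_left, inner_add_right, real_inner_smul_left, real_inner_smul_right]
    rw [real_inner_comm g' H]; ring
  have hA0 : a0 X q = 8 * (E * G - F ^ 2) * (F * p0 - E * p1) := by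
    unfold a0
    simp only [← hEdef, ← hFdef, ← hGdef, ← hedef, ← hfdef, ← hgdef]
    rw [hee, hef, heg, hff, hfg]
    linear_combination 4 * E ^ 2 * t2 - 4 * E * F * t1
  have hA1 : a1 X q = 16 * (E * G - F ^ 2) * (G * p0 - E * p2) := by
    unfold a1
    simp only [← hEdef, ← hFdef, ← hGdef, ← hedef, ← hfdef, ← hgdef]
    rw [hee, hef, heg, hff, hgg]
    linear_combination 4 * E ^ 2 * t3 + 8 * E * F * t2 - 12 * E * G * t1
  have hcirc : ∀ v : Plane, ‖secondForm X q v v - firstForm X q v v • H‖ ^ 2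
      = p0 * v 0 ^ 4 + 4 * p1 * (v 0 ^ 3 * v 1) + (4 * p2 + 2 * p3) * (v 0 ^ 2 * v 1 ^ 2)
        + 4 * p4 * (v 0 * v 1 ^ 3) + p5 * v 1 ^ 4 := by
    intro v
    have : secondForm X q v v - firstForm X q v v • H
        = (v 0 * v 0) • e' + (2 * (v 0 * v 1)) • f' + (v 1 * v 1) • g' := by
      rw [secondForm_eq hX, firstForm_eq_metric, he', hf', hg']
      simp only [metric, ← hEdef, ← hFdef, ← hGdef]
      module
    rw [this, ← real_inner_self_eq_norm_sq]
    simp only [inner_add_left, inner_add_right, real_inner_smul_left, real_inner_smul_right]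
    rw [real_inner_comm e' f', real_inner_comm e' g', real_inner_comm f' g']
    simp only [← hp0, ← hp1, ← hp2, ← hp3, ← hp4, ← hp5]
    ring
  rw [hA0, hA1]
  constructor
  · rintro ⟨ρ, hρ⟩
    have key : ∀ v : Plane, v ≠ 0 → ‖secondForm X q v v - firstForm X q v v • H‖ ^ 2
        = ρ ^ 2 * firstForm X q v v ^ 2 := by
      intro v hv
      have hpos : 0 < firstForm X q v v := by
        rw [firstForm_eq_metric]; exact metric_self_pos hE hW hv
      set m := firstForm X q v v with hm
      have hsq : √m ^ 2 = m := Real.sq_sqrt hpos.le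
      have hs0 : √m ≠ 0 := (Real.sqrt_pos.mpr hpos).ne'
      have hunit : firstForm X q ((√m)⁻¹ • v) ((√m)⁻¹ • v) = 1 := by
        have : firstForm X q ((√m)⁻¹ • v) ((√m)⁻¹ • v) = (√m ^ 2)⁻¹ * m := by
          rw [hm]; simp only [firstForm, map_smul, real_inner_smul_left, real_inner_smul_right]
          ring
        rw [this, hsq, inv_mul_cancel₀ hpos.ne']
      have hmem := hρ ⟨_, hunit, rfl⟩
      rw [mem_sphere_iff_norm, normalCurvature, hunit, inv_one, one_smul, ← hH] at hmem
      have hII : secondForm X q ((√m)⁻¹ • v) ((√m)⁻¹ • v) = m⁻¹ • secondForm X q v v := by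
        simp only [secondForm, map_smul, smul_apply, smul_smul]
        rw [← mul_inv, ← sq, hsq]
      have : secondForm X q v v - m • H = m • (m⁻¹ • secondForm X q v v - H) := by
        rw [smul_sub, smul_inv_smul₀ hpos.ne']
      rw [this, norm_smul, ← hII, hmem, mul_pow, Real.norm_eq_abs, sq_abs, mul_comm]
    have ne : ∀ x y : ℝ, (x ≠ 0 ∨ y ≠ 0) → (!₂[x, y] : Plane) ≠ 0 := by
      rintro x y h h0
      have hx := congrArg (fun v : Plane => v 0) h0
      have hy := congrArg (fun v : Plane => v 1) h0
      simp at hx hy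
      tauto
    have val : ∀ x y : ℝ, (x ≠ 0 ∨ y ≠ 0) →
        p0 * x ^ 4 + 4 * p1 * (x ^ 3 * y) + (4 * p2 + 2 * p3) * (x ^ 2 * y ^ 2)
        + 4 * p4 * (x * y ^ 3) + p5 * y ^ 4 = ρ ^ 2 * (E * x ^ 2 + 2 * F * x * y + G * y ^ 2) ^ 2 := by
      intro x y h
      have := (hcirc !₂[x, y]).symm.trans (key _ (ne x y h))
      rw [firstForm_eq_metric] at this
      simp [metric, ← hEdef, ← hFdef, ← hGdef] at this
      rw [this]; ring
    -- A binary quartic is determined by its values at five pairwise independent vectors; the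
    -- combinations below extract the coefficients that are needed.
    have w1 := val 1 0 (by norm_num)
    have w2 := val 0 1 (by norm_num)
    have w3 := val 1 1 (by norm_num)
    have w4 := val 1 (-1) (by norm_num)
    have w5 := val 2 1 (by norm_num)
    have r0 : p0 = ρ ^ 2 * E ^ 2 := by linear_combination w1
    have r1 : p1 = ρ ^ 2 * (E * F) := by 
      linear_combination (1/24) * (w5 - 12 * w1 + 3 * w2 - 3 * w3 - w4)
    have r2 : 4 * p2 + 2 * p3 = ρ ^ 2 * (4 * F ^ 2 + 2 * E * G) := by
      linear_combination (1/2) * w3 + (1/2) * w4 - w1 - w2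
    have r3 : p3 = ρ ^ 2 * (2 * F ^ 2 - E * G) := by
      apply mul_left_cancel₀ hE.ne'
      linear_combination t1 + 2 * F * r1 - G * r0
    constructor
    · rw [r0, r1]; ring
    · have : p2 = ρ ^ 2 * (E * G) := by linear_combination (1/4) * r2 - (1/2) * r3
      rw [r0, this]; ring
  · rintro ⟨hz0, hz1⟩
    have hW2 : E * G - F ^ 2 ≠ 0 := hW.ne'
    have z0 : F * p0 - E * p1 = 0 := by
      rcases mul_eq_zero.mp hz0 with h | h
      · exact absurd h (mul_ne_zero (by norm_num) hW2)
      · exact h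
    have z1 : G * p0 - E * p2 = 0 := by
      rcases mul_eq_zero.mp hz1 with h | h
      · exact absurd h (mul_ne_zero (by norm_num) hW2)
      · exact h
    have hp0nn : 0 ≤ p0 := real_inner_self_nonneg
    have hEne := hE.ne'
    -- The hypotheses make (p0, p1, p2) a multiple of (E, F, G); the trace relations then give p3,
    -- p4, p5, so that ‖II - I·H‖² = ρ2·I².
    obtain ⟨ρ2, hρ2, r0⟩ : ∃ ρ2 : ℝ, 0 ≤ ρ2 ∧ p0 = ρ2 * E ^ 2 :=
      ⟨p0 / E ^ 2, by positivity, by field_simp⟩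
    have r1 : p1 = ρ2 * (E * F) := by
      apply mul_left_cancel₀ hEne; linear_combination -z0 + F * r0
    have r2 : p2 = ρ2 * (E * G) := by
      apply mul_left_cancel₀ hEne; linear_combination -z1 + G * r0
    have r3 : p3 = ρ2 * (2 * F ^ 2 - E * G) := by
      apply mul_left_cancel₀ hEne; linear_combination t1 + 2 * F * r1 - G * r0
    have r4 : p4 = ρ2 * (F * G) := by
      apply mul_left_cancel₀ hEne; linear_combination t2 + 2 * F * r2 - G * r1
    have r5 : p5 = ρ2 * G ^ 2 := by
      apply mul_left_cancel₀ hEne; linear_combination t3 + 2 * F * r4 - G * r3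
    refine ⟨√ρ2, ?_⟩
    rintro _ ⟨v, hv, rfl⟩
    have hv1 : firstForm X q v v = 1 := hv
    rw [mem_sphere_iff_norm, normalCurvature, hv1, inv_one, one_smul, ← hH]
    have h2 := hcirc v
    rw [hv1, one_smul] at h2
    rw [eq_comm, Real.sqrt_eq_iff_mul_self_eq hρ2 (norm_nonneg _), ← sq, h2,
      r0, r1, r2, r3, r4, r5]
    rw [firstForm_eq_metric] at hv1
    simp only [metric, ← hEdef, ← hFdef, ← hGdef] at hv1
    linear_combination -ρ2 * ((E * (v 0 * v 0) + F * (v 0 * v 1 + v 1 * v 0) + G * (v 1 * v 1)) + 1)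
      * hv1

/-! ### The coefficients as polynomials in the jets -/

/-- `EG - F²` as a function of the differential. -/
def jetArea (P : Plane →L[ℝ] Space) : ℝ :=
  inner ℝ (P dX) (P dX) * inner ℝ (P dY) (P dY) - inner ℝ (P dX) (P dY) ^ 2

/-- `EG - F²` times the inner product of the normal components of `x` and `y`. -/
def normalInner (P : Plane →L[ℝ] Space) (x y : Space) : ℝ :=
  jetArea P * inner ℝ x y
    - (inner ℝ (P dY) (P dY) * (inner ℝ x (P dX) * inner ℝ y (P dX))
      - inner ℝ (P dX) (P dY) * (inner ℝ x (P dX) * inner ℝ y (P dY)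
        + inner ℝ x (P dY) * inner ℝ y (P dX))
      + inner ℝ (P dX) (P dX) * (inner ℝ x (P dY) * inner ℝ y (P dY)))

/-- `EG - F²` times the coefficient `a₀`, as a polynomial in the second order jet. -/
def jetA0 (P : Plane →L[ℝ] Space) (B : Plane →L[ℝ] Plane →L[ℝ] Space) : ℝ :=
  let E : ℝ := inner ℝ (P dX) (P dX)
  let F : ℝ := inner ℝ (P dX) (P dY)
  let G : ℝ := inner ℝ (P dY) (P dY)
  let e := B dX dX
  let f := B dX dY
  let g := B dY dY
  4 * F * (E * G - 2 * F ^ 2) * normalInner P e e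
    - 4 * E * (E * G - 4 * F ^ 2) * normalInner P e f
    + 4 * E ^ 3 * normalInner P f g - 4 * E ^ 2 * F * normalInner P e g
    - 8 * E ^ 2 * F * normalInner P f f

/-- `EG - F²` times the coefficient `a₁`, as a polynomial in the second order jet. -/
def jetA1 (P : Plane →L[ℝ] Space) (B : Plane →L[ℝ] Plane →L[ℝ] Space) : ℝ :=
  let E : ℝ := inner ℝ (P dX) (P dX)
  let F : ℝ := inner ℝ (P dX) (P dY)
  let G : ℝ := inner ℝ (P dY) (P dY)
  let e := B dX dX
  let f := B dX dY
  let g := B dY dY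
  4 * G * (E * G - 4 * F ^ 2) * normalInner P e e + 32 * E * F * G * normalInner P e f
    + 4 * E ^ 3 * normalInner P g g - 8 * E ^ 2 * G * normalInner P e g
    - 16 * E ^ 2 * G * normalInner P f f

@[fun_prop]
lemma contDiff_inner_space {V : Type*} [NormedAddCommGroup V] [NormedSpace ℝ V]
    {n : WithTop ℕ∞} {f g : V → Space} (hf : ContDiff ℝ n f) (hg : ContDiff ℝ n g) :
    ContDiff ℝ n fun x => (inner ℝ (f x) (g x) : ℝ) := hf.inner ℝ hg

lemma contDiff_jetArea {n : WithTop ℕ∞} : ContDiff ℝ n jetArea := by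
  unfold jetArea; fun_prop

lemma contDiff_jetA0 {n : WithTop ℕ∞} : ContDiff ℝ n
    (fun J : (Plane →L[ℝ] Space) × (Plane →L[ℝ] Plane →L[ℝ] Space) => jetA0 J.1 J.2) := by
  simp only [jetA0, normalInner, jetArea]; fun_prop

lemma contDiff_jetA1 {n : WithTop ℕ∞} : ContDiff ℝ n
    (fun J : (Plane →L[ℝ] Space) × (Plane →L[ℝ] Plane →L[ℝ] Space) => jetA1 J.1 J.2) := by
  simp only [jetA1, normalInner, jetArea]; fun_prop

lemma jetArea_fderiv (X : Plane → Space) (q : Plane) :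
    jetArea (fderiv ℝ X q) = coefE X q * coefG X q - coefF X q ^ 2 := rfl

/-- Subtracting the tangential components from x·y involves the inverse of the Gram matrix;
multiplication by its determinant EG - F² leaves a polynomial in the differential. -/
lemma area_mul_inner_normal (X : Plane → Space) (q : Plane) (x y : Space) :
    (coefE X q * coefG X q - coefF X q ^ 2) *
      inner ℝ ((tangentPlane X q)ᗮ.starProjection x) ((tangentPlane X q)ᗮ.starProjection y) =
      normalInner (fderiv ℝ X q) x y := by
  set P := fderiv ℝ X q with hP
  set N := (tangentPlane X q)ᗮ with hN
  have hmem : x - N.starProjection x ∈ tangentPlane X q := by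
    have hNo : Nᗮ = tangentPlane X q := by rw [hN, Submodule.orthogonal_orthogonal]
    exact hNo.le (Submodule.sub_starProjection_mem_orthogonal (K := N) x)
  obtain ⟨z, hz⟩ := hmem
  have hz' : P z = x - N.starProjection x := hz
  rw [plane_eq z, map_add, map_smul, map_smul] at hz'
  have hperp : ∀ w : Plane, inner ℝ (N.starProjection x) (P w) = (0 : ℝ) := fun w => by
    have := (Submodule.mem_orthogonal _ _).mp (Submodule.starProjection_apply_mem N x) (P w)
      ⟨w, rfl⟩
    rwa [real_inner_comm]
  have hx : x = N.starProjection x + (z 0 • P dX + z 1 • P dY) := by rw [hz']; abel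
  have e1 : inner ℝ x (P dX) = z 0 * inner ℝ (P dX) (P dX) + z 1 * inner ℝ (P dX) (P dY) := by
    conv_lhs => rw [hx]
    simp only [inner_add_left, real_inner_smul_left, hperp]
    rw [real_inner_comm (P dX) (P dY)]; ring
  have e2 : inner ℝ x (P dY) = z 0 * inner ℝ (P dX) (P dY) + z 1 * inner ℝ (P dY) (P dY) := by
    conv_lhs => rw [hx]
    simp only [inner_add_left, real_inner_smul_left, hperp]
    ring
  have e3 : inner ℝ (N.starProjection x) (N.starProjection y) =
      inner ℝ x y - z 0 * inner ℝ y (P dX) - z 1 * inner ℝ y (P dY) := by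
    have h1 : inner ℝ (N.starProjection x) (N.starProjection y)
        = (inner ℝ (N.starProjection x) y : ℝ) := by
      have := (Submodule.mem_orthogonal' _ _).mp
        (Submodule.sub_starProjection_mem_orthogonal (K := N) y) (N.starProjection x)
        (Submodule.starProjection_apply_mem N x)
      rw [inner_sub_left, real_inner_comm, sub_eq_zero] at this
      rw [this, real_inner_comm]
    rw [h1]
    have h2 : inner ℝ x y = (inner ℝ (N.starProjection x) y : ℝ) + z 0 * inner ℝ (P dX) y
        + z 1 * inner ℝ (P dY) y := by
      conv_lhs => rw [hx]
      simp only [inner_add_left, real_inner_smul_left]; ring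
    rw [h2, real_inner_comm y (P dX), real_inner_comm y (P dY)]; ring
  have hE : coefE X q = inner ℝ (P dX) (P dX) := rfl
  have hF : coefF X q = inner ℝ (P dX) (P dY) := rfl
  have hG : coefG X q = inner ℝ (P dY) (P dY) := rfl
  rw [e3, hE, hF, hG]
  unfold normalInner jetArea
  rw [e1, e2]
  ring

/-- The coefficient itself contains a projection onto a moving plane, while its multiple by EG - F²
is a polynomial in the 2-jet. The zeros are the same, and at a zero the differential only changes by
this factor. -/
lemma area_mul_a0 (X : Plane → Space) (q : Plane) :
    (coefE X q * coefG X q - coefF X q ^ 2) * a0 X q =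
      jetA0 (fderiv ℝ X q) (fderiv ℝ (fderiv ℝ X) q) := by
  unfold a0 jetA0 vecE vecF vecG secondForm
  simp only [← area_mul_inner_normal]
  simp only [coefE, coefF, coefG, firstForm]
  ring

lemma area_mul_a1 (X : Plane → Space) (q : Plane) :
    (coefE X q * coefG X q - coefF X q ^ 2) * a1 X q =
      jetA1 (fderiv ℝ X q) (fderiv ℝ (fderiv ℝ X) q) := by
  unfold a1 jetA1 vecE vecF vecG secondForm
  simp only [← area_mul_inner_normal]
  simp only [coefE, coefF, coefG, firstForm]
  ring

/-- `EG - F²` times the coefficient `a₀` of a surface. -/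
def coefZ0 (X : Plane → Space) (q : Plane) : ℝ := jetA0 (fderiv ℝ X q) (fderiv ℝ (fderiv ℝ X) q)

/-- `EG - F²` times the coefficient `a₁` of a surface. -/
def coefZ1 (X : Plane → Space) (q : Plane) : ℝ := jetA1 (fderiv ℝ X q) (fderiv ℝ (fderiv ℝ X) q)

lemma coefZ_eq_zero_iff {X : Plane → Space} {q : Plane}
    (hinj : Function.Injective (fderiv ℝ X q)) :
    (coefZ0 X q = 0 ∧ coefZ1 X q = 0) ↔ (a0 X q = 0 ∧ a1 X q = 0) := by
  have hW := (coef_det_pos hinj).ne'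
  unfold coefZ0 coefZ1
  rw [← area_mul_a0, ← area_mul_a1, mul_eq_zero_iff_left hW, mul_eq_zero_iff_left hW]

lemma contDiffAt_coefZ0 {X : Plane → Space} {q : Plane} (hX : ContDiffAt ℝ 3 X q) :
    ContDiffAt ℝ 1 (coefZ0 X) q := by
  have h1 : ContDiffAt ℝ 2 (fderiv ℝ X) q := hX.fderiv_right (by norm_num)
  have h2 : ContDiffAt ℝ 1 (fderiv ℝ (fderiv ℝ X)) q := h1.fderiv_right (by norm_num)
  have h12 : ContDiffAt ℝ 1 (fun z => (fderiv ℝ X z, fderiv ℝ (fderiv ℝ X) z)) q :=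
    (h1.of_le (by norm_num)).prodMk h2
  have := ContDiff.comp_contDiffAt (g := fun J : (Plane →L[ℝ] Space) ×
    (Plane →L[ℝ] Plane →L[ℝ] Space) => jetA0 J.1 J.2) q contDiff_jetA0 h12
  have he : coefZ0 X = fun z => jetA0 (fderiv ℝ X z) (fderiv ℝ (fderiv ℝ X) z) := rfl
  rw [he]
  exact this

lemma contDiffAt_coefZ1 {X : Plane → Space} {q : Plane} (hX : ContDiffAt ℝ 3 X q) :
    ContDiffAt ℝ 1 (coefZ1 X) q := by
  have h1 : ContDiffAt ℝ 2 (fderiv ℝ X) q := hX.fderiv_right (by norm_num)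
  have h2 : ContDiffAt ℝ 1 (fderiv ℝ (fderiv ℝ X)) q := h1.fderiv_right (by norm_num)
  have h12 : ContDiffAt ℝ 1 (fun z => (fderiv ℝ X z, fderiv ℝ (fderiv ℝ X) z)) q :=
    (h1.of_le (by norm_num)).prodMk h2
  have := ContDiff.comp_contDiffAt (g := fun J : (Plane →L[ℝ] Space) ×
    (Plane →L[ℝ] Plane →L[ℝ] Space) => jetA1 J.1 J.2) q contDiff_jetA1 h12
  have he : coefZ1 X = fun z => jetA1 (fderiv ℝ X z) (fderiv ℝ (fderiv ℝ X) z) := rfl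
  rw [he]
  exact this

/-- The term with the derivative of `g` would carry the factor f x = 0, so continuity of `g`
suffices. Factors in front of quantities vanishing at the point therefore enter only through their
values. -/
lemma hasFDerivAt_mul_of_eq_zero {V : Type*} [NormedAddCommGroup V] [NormedSpace ℝ V]
    {f g : V → ℝ} {f' : V →L[ℝ] ℝ} {x : V} (hf : HasFDerivAt f f' x) (h0 : f x = 0)
    (hg : ContinuousAt g x) : HasFDerivAt (fun z => g z * f z) (g x • f') x := by
  apply HasFDerivAt.of_isLittleO
  have h1 : (fun z => f z - f x - f' (z - x)) =o[𝓝 x] fun z => z - x := hf.isLittleO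
  have h2 : (fun z => g z * (f z - f x - f' (z - x))) =o[𝓝 x] fun z => z - x := by
    have := (hg.isBigO_one ℝ).mul_isLittleO h1.norm_right
    simp only [one_mul] at this
    exact this.of_norm_right
  have h3 : (fun z => (g z - g x) * f' (z - x)) =o[𝓝 x] fun z => z - x := by
    have hgo : (fun z => g z - g x) =o[𝓝 x] fun _ => (1 : ℝ) := by
      rw [Asymptotics.isLittleO_one_iff]
      simpa using hg.tendsto.sub_const (g x)
    have := hgo.mul_isBigO (f'.isBigO_sub (𝓝 x) x).norm_right
    simp only [one_mul] at this
    exact this.of_norm_right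
  refine (h2.add h3).congr_left fun z => ?_
  simp only [h0, smul_apply, smul_eq_mul]
  ring

lemma surjective_of_det2_ne_zero {T : Plane →L[ℝ] Plane} (h : det2 T ≠ 0) :
    Function.Surjective T := by
  intro v
  refine ⟨(det2 T)⁻¹ • !₂[v 0 * T dY 1 - v 1 * T dY 0, T dX 0 * v 1 - T dX 1 * v 0], ?_⟩
  rw [map_smul, inv_smul_eq_iff₀ h]
  ext i
  rw [apply_plane]
  unfold det2
  fin_cases i <;> simp <;> ring

lemma injective_of_surjective_plane {T : Plane →L[ℝ] Plane} (h : Function.Surjective T) :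
    Function.Injective T :=
  (LinearMap.injective_iff_surjective (f := (T : Plane →ₗ[ℝ] Plane))).mpr h

lemma quart_eq_linear (E F G A0 A1 dx dy : ℝ) : quart E F G A0 A1 dx dy =
    quart E F G 1 0 dx dy * A0 + quart E F G 0 1 dx dy * A1 := by
  unfold quart; ring

/-- The derivative of the quartic form at an axiumbilic point, in another chart and after a
similarity of the ambient space. -/
lemma exists_hasFDerivAt_axialForm {X Y : Plane → Space} {τ : Plane → Plane} {y : Plane} {c : ℝ}
    {Γ : Space ≃ᵃⁱ[ℝ] Space} (hX : ContDiffAt ℝ 3 X (τ y)) (hτ : ContDiffAt ℝ 2 τ y)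
    (hinj : Function.Injective (fderiv ℝ X (τ y)))
    (hsurj : Function.Surjective (fderiv ℝ τ y))
    (hY : Y =ᶠ[𝓝 y] fun z => c • Γ (X (τ z)))
    (h0 : coefZ0 X (τ y) = 0) (h1 : coefZ1 X (τ y) = 0) (v : Plane) :
    ∃ L : Plane →L[ℝ] ℝ, HasFDerivAt (fun z => axialForm Y z (v 0) (v 1)) L y ∧ ∀ u, L u =
      coefE Y y ^ 3 * c ^ 8 * det2 (fderiv ℝ τ y) ^ 3 /
        (coefE X (τ y) ^ 3 * jetArea (fderiv ℝ X (τ y))) *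
      axialTensor (coefE X (τ y)) (coefF X (τ y)) (coefG X (τ y))
        (fderiv ℝ (coefZ0 X) (τ y)) (fderiv ℝ (coefZ1 X) (τ y)) (fderiv ℝ τ y u)
        (fderiv ℝ τ y v) := by
  have hτc : ContinuousAt τ y := hτ.continuousAt
  have hX2 : ContDiffAt ℝ 2 X (τ y) := hX.of_le (by norm_num)
  have hYc : ContDiffAt ℝ 2 Y y := by
    refine ContDiffAt.congr_of_eventuallyEq ?_ hY
    have h : ContDiffAt ℝ 2 (fun z => c • (Γ.linearIsometryEquiv (X (τ z)) + Γ 0)) y :=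
      ((Γ.linearIsometryEquiv.contDiff.contDiffAt.comp y (hX2.comp y hτ)).add
        contDiffAt_const).const_smul c
    simpa only [← affineIsometryEquiv_apply] using h
  have hfX : ContinuousAt (fun z => fderiv ℝ X (τ z)) y :=
    ContinuousAt.comp (f := τ) (hX.fderiv_right (m := 2) (by norm_num)).continuousAt hτc
  have hfτ : ContinuousAt (fderiv ℝ τ) y := (hτ.fderiv_right (m := 1) (by norm_num)).continuousAt
  have hfY : ContinuousAt (fderiv ℝ Y) y := (hYc.fderiv_right (m := 1) (by norm_num)).continuousAt
  have appX : ∀ w, ContinuousAt (fun z => fderiv ℝ X (τ z) w) y := fun w =>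
    hfX.clm_apply continuousAt_const
  have appY : ∀ w, ContinuousAt (fun z => fderiv ℝ Y z w) y := fun w =>
    hfY.clm_apply continuousAt_const
  have appτ : ∀ w (i : Fin 2), ContinuousAt (fun z => fderiv ℝ τ z w i) y := fun w i =>
    (EuclideanSpace.proj i : Plane →L[ℝ] ℝ).continuous.continuousAt.comp
      (hfτ.clm_apply continuousAt_const)
  have cE : ContinuousAt (fun z => coefE X (τ z)) y := (appX dX).inner (appX dX)
  have cF : ContinuousAt (fun z => coefF X (τ z)) y := (appX dX).inner (appX dY)
  have cG : ContinuousAt (fun z => coefG X (τ z)) y := (appX dY).inner (appX dY)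
  have cEY : ContinuousAt (fun z => coefE Y z) y := (appY dX).inner (appY dX)
  have cA : ContinuousAt (fun z => jetArea (fderiv ℝ X (τ z))) y :=
    contDiff_jetArea (n := 0).continuous.continuousAt.comp hfX
  have cD : ContinuousAt (fun z => det2 (fderiv ℝ τ z)) y :=
    ((appτ dX 0).mul (appτ dY 1)).sub ((appτ dX 1).mul (appτ dY 0))
  have hA : jetArea (fderiv ℝ X (τ y)) ≠ 0 := (coef_det_pos hinj).ne'
  have hE : coefE X (τ y) ≠ 0 := (coefE_pos hinj).ne'
  have hD : det2 (fderiv ℝ τ y) ≠ 0 := det2_ne_zero (injective_of_surjective_plane hsurj)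
  set K : Plane → ℝ := fun z => coefE Y z ^ 3 * c ^ 8 * det2 (fderiv ℝ τ z) ^ 3 /
        (coefE X (τ z) ^ 3 * jetArea (fderiv ℝ X (τ z))) with hK
  have cK : ContinuousAt K y :=
    (((cEY.pow 3).mul continuousAt_const).mul (cD.pow 3)).div ((cE.pow 3).mul cA)
      (mul_ne_zero (pow_ne_zero _ hE) hA)
  set Q : ℝ → ℝ → Plane → ℝ := fun s t z => quart (coefE X (τ z)) (coefF X (τ z)) (coefG X (τ z))
    s t (fderiv ℝ τ z v 0) (fderiv ℝ τ z v 1) with hQ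
  have cQ : ∀ s t, ContinuousAt (Q s t) y := fun s t => by
    have hx := appτ v 0
    have hy := appτ v 1
    simp only [hQ, quart]
    fun_prop
  -- Near `y` the form is a continuous factor times `coefZ0` plus one times `coefZ1`, both taken
  -- along τ and both zero at `y`, so that only these two need to be differentiated.
  have heq : (fun z => axialForm Y z (v 0) (v 1)) =ᶠ[𝓝 y] fun z =>
      (K z * Q 1 0 z) * coefZ0 X (τ z) + (K z * Q 0 1 z) * coefZ1 X (τ z) := by
    filter_upwards [hτc.eventually (hX2.eventually (by simp)), hτ.eventually (by simp),
      hY.eventuallyEq_nhds, cA.eventually_ne hA, cE.eventually_ne hE, cD.eventually_ne hD]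
      with z z1 z2 z3 z4 z5 z6
    have := axialForm_similarity z1 z2 (surjective_of_det2_ne_zero z6) z3 v
    rw [axialForm_eq_quart X, quart_eq_linear] at this
    have e0 : coefZ0 X (τ z) = jetArea (fderiv ℝ X (τ z)) * a0 X (τ z) := (area_mul_a0 _ _).symm
    have e1 : coefZ1 X (τ z) = jetArea (fderiv ℝ X (τ z)) * a1 X (τ z) := (area_mul_a1 _ _).symm
    rw [e0, e1]
    simp only [hK, hQ]
    field_simp
    linear_combination this
  have d0 : HasFDerivAt (fun z => coefZ0 X (τ z))
      ((fderiv ℝ (coefZ0 X) (τ y)).comp (fderiv ℝ τ y)) y :=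
    ((contDiffAt_coefZ0 hX).differentiableAt (by norm_num)).hasFDerivAt.comp y
      (hτ.differentiableAt (by norm_num)).hasFDerivAt
  have d1 : HasFDerivAt (fun z => coefZ1 X (τ z))
      ((fderiv ℝ (coefZ1 X) (τ y)).comp (fderiv ℝ τ y)) y :=
    ((contDiffAt_coefZ1 hX).differentiableAt (by norm_num)).hasFDerivAt.comp y
      (hτ.differentiableAt (by norm_num)).hasFDerivAt
  refine ⟨_, ((hasFDerivAt_mul_of_eq_zero d0 h0 (cK.mul (cQ 1 0))).add
    (hasFDerivAt_mul_of_eq_zero d1 h1 (cK.mul (cQ 0 1)))).congr_of_eventuallyEq heq, fun u => ?_⟩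
  simp only [add_apply, smul_apply, ContinuousLinearMap.comp_apply, smul_eq_mul]
  unfold axialTensor
  rw [quart_eq_linear _ _ _ (fderiv ℝ (coefZ0 X) (τ y) _)]
  simp only [hK, hQ, Pi.mul_apply]
  ring

/-! ### Axiumbilic points in a fixed chart -/

lemma a_eq_zero_iff_axialForm {X : Plane → Space} {q : Plane} (hE : coefE X q ≠ 0) :
    (a0 X q = 0 ∧ a1 X q = 0) ↔ ∀ v : Plane, axialForm X q (v 0) (v 1) = 0 := by
  constructor
  · rintro ⟨h0, h1⟩ v
    rw [axialForm_eq_quart, h0, h1]; unfold quart; ring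
  · intro h
    have h' : ∀ x y, quart (coefE X q) (coefF X q) (coefG X q) (a0 X q) (a1 X q) x y = 0 :=
      fun x y => by simpa [axialForm_eq_quart] using h !₂[x, y]
    have hE3 : coefE X q ^ 3 ≠ 0 := pow_ne_zero _ hE
    have z0 : a0 X q = 0 := by
      have := h' 1 0
      unfold quart at this
      apply (mul_eq_zero.mp (_ : _ * _ = (0 : ℝ))).resolve_right hE3
      linear_combination this
    refine ⟨z0, ?_⟩
    -- With a₀ = 0 the form at (x, 1) is a cubic in x with leading coefficient a₁E³, and the third
    -- difference over 0, 1, 2, 3 is six times that coefficient.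
    have w0 := h' 0 1
    have w1 := h' 1 1
    have w2 := h' 2 1
    have w3 := h' 3 1
    rw [z0] at w0 w1 w2 w3
    unfold quart at w0 w1 w2 w3
    apply (mul_eq_zero.mp (_ : _ * _ = (0 : ℝ))).resolve_right hE3
    linear_combination (1 / 6) * (w3 - 3 * w2 + 3 * w1 - w0)

section Chart

variable {M : Type*} [TopologicalSpace M] [ChartedSpace Plane M]

/-- The expression of a map in the preferred chart at `p`. -/
def chartMap (p : M) (μ : M → Space) : Plane → Space := μ ∘ (extChartAt (𝓡 2) p).symm

lemma isOpen_target (p : M) : IsOpen (extChartAt (𝓡 2) p).target := isOpen_extChartAt_target p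

lemma contDiffOn_chartMap [IsManifold (𝓡 2) ∞ M] {r : ℕ∞} (p : M) (μ : CrMap r M) :
    ContDiffOn ℝ (r : WithTop ℕ∞) (chartMap p μ) (extChartAt (𝓡 2) p).target := by
  have : IsManifold (𝓡 2) (r : WithTop ℕ∞) M := IsManifold.of_le (n := ∞) (by exact_mod_cast le_top)
  rw [← contMDiffOn_iff_contDiffOn]
  exact μ.contMDiff.comp_contMDiffOn (contMDiffOn_extChartAt_symm p)

lemma contDiffAt_chartMap [IsManifold (𝓡 2) ∞ M] {r : ℕ∞} (p : M) (μ : CrMap r M) {x : Plane}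
    (hx : x ∈ (extChartAt (𝓡 2) p).target) :
    ContDiffAt ℝ (r : WithTop ℕ∞) (chartMap p μ) x :=
  (contDiffOn_chartMap p μ).contDiffAt ((isOpen_target p).mem_nhds hx)

lemma injective_fderiv_chartMap [IsManifold (𝓡 2) ∞ M] {r : ℕ∞} (hr : 1 ≤ r) (p : M)
    (μ : CrMap r M) (hμ : IsImmersion μ) {x : Plane} (hx : x ∈ (extChartAt (𝓡 2) p).target) :
    Function.Injective (fderiv ℝ (chartMap p μ) x) := by
  have : IsManifold (𝓡 2) 1 M := IsManifold.of_le (n := ∞) (by exact_mod_cast le_top)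
  have hinv := isInvertible_mfderivWithin_extChartAt_symm hx
  rw [ModelWithCorners.range_eq_univ, mfderivWithin_univ] at hinv
  have hsymm : MDifferentiableAt 𝓘(ℝ, Plane) (𝓡 2) (extChartAt (𝓡 2) p).symm x :=
    ((contMDiffOn_extChartAt_symm (n := 1) p).contMDiffAt
      ((isOpen_target p).mem_nhds hx)).mdifferentiableAt (by norm_num)
  have hμd : MDifferentiableAt (𝓡 2) 𝓘(ℝ, Space) μ ((extChartAt (𝓡 2) p).symm x) :=
    μ.contMDiff.contMDiffAt.mdifferentiableAt (by
      have : (1 : WithTop ℕ∞) ≤ r := by exact_mod_cast hr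
      rintro h0
      rw [h0] at this
      norm_num at this)
  rw [← mfderiv_eq_fderiv]
  unfold chartMap
  rw [mfderiv_comp x hμd hsymm]
  exact (hμ _).comp hinv.injective

/-- Coordinate changes between charts of the maximal atlas. -/
lemma contDiffAt_coordChange {n : WithTop ℕ∞} {e e' : OpenPartialHomeomorph M Plane}
    (he : e ∈ IsManifold.maximalAtlas (𝓡 2) n M) (he' : e' ∈ IsManifold.maximalAtlas (𝓡 2) n M)
    {m : M} (hm : m ∈ e.source) (hm' : m ∈ e'.source) :
    ContDiffAt ℝ n (e' ∘ e.symm) (e m) := by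
  have := ModelWithCorners.contDiffWithinAt_extendCoordChange' (I := 𝓡 2) he he' hm hm'
  rw [ModelWithCorners.range_eq_univ, contDiffWithinAt_univ] at this
  exact this

lemma surjective_fderiv_coordChange {n : WithTop ℕ∞} (hn : n ≠ 0)
    {e e' : OpenPartialHomeomorph M Plane}
    (he : e ∈ IsManifold.maximalAtlas (𝓡 2) n M) (he' : e' ∈ IsManifold.maximalAtlas (𝓡 2) n M)
    {m : M} (hm : m ∈ e.source) (hm' : m ∈ e'.source) :
    Function.Surjective (fderiv ℝ (e' ∘ e.symm) (e m)) := by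
  have h1 : HasFDerivAt (e' ∘ e.symm) (fderiv ℝ (e' ∘ e.symm) (e m)) ((e ∘ e'.symm) (e' m)) := by
    have := ((contDiffAt_coordChange he he' hm hm').differentiableAt hn).hasFDerivAt
    simpa [hm'] using this
  have h2 := ((contDiffAt_coordChange he' he hm' hm).differentiableAt hn).hasFDerivAt
  have h3 := h1.comp (e' m) h2
  have hev : (e' ∘ e.symm) ∘ (e ∘ e'.symm) =ᶠ[𝓝 (e' m)] id := by
    have hs : ∀ᶠ z in 𝓝 (e' m), z ∈ e'.target ∧ e'.symm z ∈ e.source := by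
      refine Eventually.and (e'.open_target.mem_nhds (e'.map_source hm')) ?_
      have hc := e'.continuousAt_symm (e'.map_source hm')
      apply hc.eventually
      rw [e'.left_inv hm']
      exact e.open_source.mem_nhds hm
    filter_upwards [hs] with z hz
    simp [hz.1, hz.2]
  have h4 := h3.unique ((hasFDerivAt_id (e' m)).congr_of_eventuallyEq hev)
  intro v
  exact ⟨_, DFunLike.congr_fun h4 v⟩

/-- The definition uses the chart at `m`, which varies with the point. Since the quartic form is a
relative tensor, its vanishing can be tested in the fixed chart at `p`, where one equation describes
all nearby axiumbilic points. -/
lemma isAxiumbilic_iff [IsManifold (𝓡 2) ∞ M] {r : ℕ∞} (hr : 3 ≤ r) (p : M) (μ : CrMap r M)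
    (hμ : IsImmersion μ) {m : M} (hm : m ∈ (extChartAt (𝓡 2) p).source) :
    IsAxiumbilic μ m ↔ coefZ0 (chartMap p μ) (extChartAt (𝓡 2) p m) = 0 ∧
      coefZ1 (chartMap p μ) (extChartAt (𝓡 2) p m) = 0 := by
  have hr1 : 1 ≤ r := le_trans (by norm_num) hr
  have h2r : (2 : WithTop ℕ∞) ≤ r := by
    have : (2 : ℕ∞) ≤ r := le_trans (by norm_num) hr
    exact WithTop.coe_le_coe.mpr this
  have hman : IsManifold (𝓡 2) 2 M := IsManifold.of_le (n := ∞) (WithTop.coe_le_coe.mpr le_top)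
  have hmm := mem_extChartAt_source (I := 𝓡 2) m
  have hxm := (extChartAt (𝓡 2) m).map_source hmm
  have hxp := (extChartAt (𝓡 2) p).map_source hm
  have hc : ContDiffAt ℝ 2 (chartMap m μ) (extChartAt (𝓡 2) m m) :=
    (contDiffAt_chartMap m μ hxm).of_le h2r
  have hinjm := injective_fderiv_chartMap hr1 m μ hμ hxm
  have hinjp := injective_fderiv_chartMap hr1 p μ hμ hxp
  rw [coefZ_eq_zero_iff hinjp]
  unfold IsAxiumbilic
  change EllipseIsCircle (chartMap m μ) _ ↔ _
  rw [ellipseIsCircle_iff hc hinjm, a_eq_zero_iff_axialForm (coefE_pos hinjm).ne',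
    a_eq_zero_iff_axialForm (coefE_pos hinjp).ne']
  have hmem := IsManifold.chart_mem_maximalAtlas (I := 𝓡 2) (n := 2) m
  have hmep := IsManifold.chart_mem_maximalAtlas (I := 𝓡 2) (n := 2) p
  have hms : m ∈ (chartAt Plane m).source := mem_chart_source Plane m
  have hps : m ∈ (chartAt Plane p).source := by simpa using hm
  set τ := chartAt Plane p ∘ (chartAt Plane m).symm with hτ
  have hτm : τ (extChartAt (𝓡 2) m m) = extChartAt (𝓡 2) p m := by
    simp [hτ]
  have hτc : ContDiffAt ℝ 2 τ (extChartAt (𝓡 2) m m) :=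
    contDiffAt_coordChange hmem hmep hms hps
  have hsurj : Function.Surjective (fderiv ℝ τ (extChartAt (𝓡 2) m m)) :=
    surjective_fderiv_coordChange (by norm_num) hmem hmep hms hps
  have hY : chartMap m μ =ᶠ[𝓝 (extChartAt (𝓡 2) m m)] fun z =>
      (1 : ℝ) • (AffineIsometryEquiv.refl ℝ Space) (chartMap p μ (τ z)) := by
    have hs : ∀ᶠ z in 𝓝 (chartAt Plane m m), (chartAt Plane m).symm z ∈ (chartAt Plane p).source := by
      have hc := (chartAt Plane m).continuousAt_symm ((chartAt Plane m).map_source hms)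
      apply hc.eventually
      rw [(chartAt Plane m).left_inv hms]
      exact (chartAt Plane p).open_source.mem_nhds hps
    filter_upwards [hs] with z hz
    simp [chartMap, hτ, hz]
  have key := axialForm_similarity (c := 1) (Γ := AffineIsometryEquiv.refl ℝ Space)
    (X := chartMap p μ) (Y := chartMap m μ) (τ := τ) (y := extChartAt (𝓡 2) m m)
    (by rw [hτm]; exact (contDiffAt_chartMap p μ hxp).of_le h2r) hτc hsurj hY
  rw [hτm] at key
  have hEp := pow_ne_zero 3 (coefE_pos hinjp).ne'
  have hEm := pow_ne_zero 3 (coefE_pos hinjm).ne'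
  have hdet := pow_ne_zero 3 (det2_ne_zero (injective_of_surjective_plane hsurj))
  constructor
  · intro h v
    obtain ⟨w, rfl⟩ := hsurj v
    have := key w
    rw [h w, mul_zero] at this
    have hne : coefE (chartMap m μ) (extChartAt (𝓡 2) m m) ^ 3 * 1 ^ 8 *
        det2 (fderiv ℝ τ (extChartAt (𝓡 2) m m)) ^ 3 ≠ 0 := by
      rw [one_pow, mul_one]; exact mul_ne_zero hEm hdet
    exact (mul_eq_zero.mp this.symm).resolve_left hne
  · intro h v
    have := key v
    rw [h, mul_zero] at this
    exact (mul_eq_zero.mp this).resolve_left hEp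

end Chart

/-! ### Monge charts -/

lemma hasFDerivAt_graph {R S : Plane → ℝ} (hR : HasFDerivAt R (0 : Plane →L[ℝ] ℝ) 0)
    (hS : HasFDerivAt S (0 : Plane →L[ℝ] ℝ) 0) (u : Plane) :
    DifferentiableAt ℝ (fun q : Plane => (!₂[q 0, q 1, R q, S q] : Space)) 0 ∧
    fderiv ℝ (fun q : Plane => (!₂[q 0, q 1, R q, S q] : Space)) 0 u = !₂[u 0, u 1, 0, 0] := by
  have key : HasFDerivAt (fun q : Plane => (!₂[q 0, q 1, R q, S q] : Space))
      ((PiLp.continuousLinearEquiv 2 ℝ (fun _ : Fin 4 => ℝ)).symm.toContinuousLinearMap.comp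
        (ContinuousLinearMap.pi ![EuclideanSpace.proj 0, EuclideanSpace.proj 1, 0, 0])) 0 := by
    rw [← hasFDerivWithinAt_univ, hasFDerivWithinAt_euclidean]
    intro i
    rw [hasFDerivWithinAt_univ]
    fin_cases i
    · exact (EuclideanSpace.proj (𝕜 := ℝ) (0 : Fin 2) : Plane →L[ℝ] ℝ).hasFDerivAt
    · exact (EuclideanSpace.proj (𝕜 := ℝ) (1 : Fin 2) : Plane →L[ℝ] ℝ).hasFDerivAt
    · exact hR
    · exact hS
  refine ⟨key.differentiableAt, ?_⟩
  rw [key.fderiv]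
  ext i
  fin_cases i <;> simp

section MongeChart

variable {M : Type*} [TopologicalSpace M] [ChartedSpace Plane M]

/-- The expression of a map in a Monge chart, in terms of its expression in the chart at `p`. -/
lemma IsMongeChart.graph_eventuallyEq {r : ℕ∞} {μ : CrMap r M} {m : M}
    {e : OpenPartialHomeomorph M Plane} {Γ : Space ≃ᵃⁱ[ℝ] Space} {c : ℝ} {R S : Plane → ℝ}
    (h : IsMongeChart r μ m e Γ c R S) {p : M} (hm : m ∈ (chartAt Plane p).source) :
    (fun q : Plane => (!₂[q 0, q 1, R q, S q] : Space)) =ᶠ[𝓝 0] fun z =>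
      c • Γ (chartMap p μ ((chartAt Plane p ∘ e.symm) z)) := by
  have h0 : (0 : Plane) ∈ e.target := by rw [← h.map_center]; exact e.map_source h.mem_source
  have hs : ∀ᶠ z in 𝓝 (0 : Plane), e.symm z ∈ (chartAt Plane p).source := by
    have hc := e.continuousAt_symm h0
    apply hc.eventually
    rw [← h.map_center, e.left_inv h.mem_source]
    exact (chartAt Plane p).open_source.mem_nhds hm
  filter_upwards [hs, e.open_target.mem_nhds h0] with z hz hz'
  rw [← h.graph z hz']
  simp [chartMap, hz]

variable [IsManifold (𝓡 2) ∞ M]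

/-- The first fundamental form and the derivative of the quartic form in a Monge chart. -/
lemma IsMongeChart.axialForm_derivative {r : ℕ∞} (hr : 3 ≤ r) {μ : CrMap r M}
    (hμ : IsImmersion μ) {m : M}
    {e : OpenPartialHomeomorph M Plane} {Γ : Space ≃ᵃⁱ[ℝ] Space} {c : ℝ} {R S : Plane → ℝ}
    (h : IsMongeChart r μ m e Γ c R S) {p : M} (hm : m ∈ (chartAt Plane p).source)
    (h0 : coefZ0 (chartMap p μ) (chartAt Plane p m) = 0)
    (h1 : coefZ1 (chartMap p μ) (chartAt Plane p m) = 0) :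
    let X := chartMap p μ
    let x := chartAt Plane p m
    let T := fderiv ℝ (chartAt Plane p ∘ e.symm) 0
    Function.Surjective T ∧
    (∀ u w : Plane, c ^ 2 * metric (coefE X x) (coefF X x) (coefG X x) (T u) (T w) =
      u 0 * w 0 + u 1 * w 1) ∧
    ∀ v : Plane, ∃ L : Plane →L[ℝ] ℝ,
      HasFDerivAt (fun z => axialForm (fun q => !₂[q 0, q 1, R q, S q]) z (v 0) (v 1)) L 0 ∧
      ∀ u, L u = c ^ 8 * det2 T ^ 3 / (coefE X x ^ 3 * jetArea (fderiv ℝ X x)) *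
        axialTensor (coefE X x) (coefF X x) (coefG X x) (fderiv ℝ (coefZ0 X) x)
          (fderiv ℝ (coefZ1 X) x) (T u) (T v) := by
  intro X x T
  have hr1 : 1 ≤ r := le_trans (by norm_num) hr
  have hman : IsManifold (𝓡 2) (r : WithTop ℕ∞) M :=
    IsManifold.of_le (n := ∞) (WithTop.coe_le_coe.mpr le_top)
  have h3r : (3 : WithTop ℕ∞) ≤ r := WithTop.coe_le_coe.mpr hr
  have hr0 : (r : WithTop ℕ∞) ≠ 0 := by
    intro h0; rw [h0] at h3r; norm_num at h3r
  set τ := chartAt Plane p ∘ e.symm with hτ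
  have hτ0 : τ 0 = x := by
    simp only [hτ, Function.comp_apply, ← h.map_center, e.left_inv h.mem_source]; rfl
  have hxt : x ∈ (extChartAt (𝓡 2) p).target := by
    simpa [x] using (chartAt Plane p).map_source hm
  have hmep := IsManifold.chart_mem_maximalAtlas (I := 𝓡 2) (n := (r : WithTop ℕ∞)) p
  have hτc : ContDiffAt ℝ 2 τ 0 := by
    have := contDiffAt_coordChange h.mem_atlas hmep h.mem_source hm
    rw [h.map_center] at this
    exact this.of_le (le_trans (by norm_num) h3r)
  have hsurj : Function.Surjective T := by
    have := surjective_fderiv_coordChange hr0 h.mem_atlas hmep h.mem_source hm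
    rwa [h.map_center] at this
  have hX : ContDiffAt ℝ 3 X (τ 0) := by
    rw [hτ0]; exact (contDiffAt_chartMap p μ hxt).of_le h3r
  have hinj : Function.Injective (fderiv ℝ X (τ 0)) := by
    rw [hτ0]; exact injective_fderiv_chartMap hr1 p μ hμ hxt
  have hY := h.graph_eventuallyEq hm
  have hI : ∀ u w : Plane, c ^ 2 * metric (coefE X x) (coefF X x) (coefG X x) (T u) (T w) =
      u 0 * w 0 + u 1 * w 1 := by
    intro u w
    rw [← firstForm_eq_metric, ← hτ0,
      ← firstForm_similarity (hX.differentiableAt (by norm_num))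
        (hτc.differentiableAt (by norm_num)) hY]
    unfold firstForm
    rw [(hasFDerivAt_graph h.hasFDerivAt_R h.hasFDerivAt_S u).2,
      (hasFDerivAt_graph h.hasFDerivAt_R h.hasFDerivAt_S w).2]
    simp [EuclideanSpace.inner_eq_star_dotProduct, Fin.sum_univ_four, dotProduct]
    ring
  refine ⟨hsurj, hI, fun v => ?_⟩
  obtain ⟨L, hL, hLu⟩ := exists_hasFDerivAt_axialForm hX hτc hinj hsurj hY
    (by rw [hτ0]; exact h0) (by rw [hτ0]; exact h1) v
  refine ⟨L, hL, fun u => ?_⟩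
  rw [hLu u, hτ0]
  -- The graph functions vanish to first order, so E = 1 at the centre and the factor E³ of the
  -- Monge chart disappears.
  have hE1 : coefE (fun q : Plane => (!₂[q 0, q 1, R q, S q] : Space)) 0 = 1 := by
    have := hI dX dX
    rw [← firstForm_eq_metric, ← hτ0, ← firstForm_similarity (hX.differentiableAt (by norm_num))
        (hτc.differentiableAt (by norm_num)) hY] at this
    unfold coefE
    rw [this]; simp [dX]
  rw [hE1]
  ring

/-- Normal forms are normal forms of the tensor in the chart at `p`. -/
lemma HasNormalForm.hasAxis {r : ℕ∞} (hr : 3 ≤ r) {μ : CrMap r M} (hμ : IsImmersion μ) {m : M}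
    {a b : ℝ} (h : HasNormalForm r μ m a b) {p : M} (hm : m ∈ (chartAt Plane p).source) :
    HasAxis (coefE (chartMap p μ) (chartAt Plane p m)) (coefF (chartMap p μ) (chartAt Plane p m))
      (coefG (chartMap p μ) (chartAt Plane p m))
      (fderiv ℝ (coefZ0 (chartMap p μ)) (chartAt Plane p m))
      (fderiv ℝ (coefZ1 (chartMap p μ)) (chartAt Plane p m)) a b := by
  obtain ⟨hax, e, Γ, c, R, S, hM, hform⟩ := h
  have hZ := (isAxiumbilic_iff hr p μ hμ (by simpa using hm)).mp hax
  obtain ⟨hsurj, hI, hder⟩ := hM.axialForm_derivative hr hμ hm hZ.1 hZ.2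
  set X := chartMap p μ
  set x := chartAt Plane p m
  set T := fderiv ℝ (chartAt Plane p ∘ e.symm) 0
  set κ := c ^ 8 * det2 T ^ 3 / (coefE X x ^ 3 * jetArea (fderiv ℝ X x)) with hκ
  have hc := hM.ratio_pos
  have hxt : x ∈ (extChartAt (𝓡 2) p).target := by
    simpa [x] using (chartAt Plane p).map_source hm
  have hinj := injective_fderiv_chartMap (le_trans (by norm_num) hr) p μ hμ hxt
  have hκ0 : κ ≠ 0 := div_ne_zero (mul_ne_zero (pow_ne_zero _ hc.ne')
    (pow_ne_zero _ (det2_ne_zero (injective_of_surjective_plane hsurj))))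
    (mul_ne_zero (pow_ne_zero _ (coefE_pos hinj).ne') (coef_det_pos hinj).ne')
  have hc2 : c ^ 2 ≠ 0 := pow_ne_zero _ hc.ne'
  refine ⟨T dX, T dY, (c ^ 2)⁻¹, κ⁻¹, by positivity, inv_ne_zero hκ0, ?_, ?_, ?_, ?_⟩
  · have := hI dX dX
    apply mul_left_cancel₀ hc2; rw [this, mul_inv_cancel₀ hc2]; simp [dX]
  · have := hI dY dY
    apply mul_left_cancel₀ hc2; rw [this, mul_inv_cancel₀ hc2]; simp [dY]
  · have := hI dX dY
    apply mul_left_cancel₀ hc2; rw [this]; simp [dX, dY]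
  · intro s t X' Y'
    set u : Plane := s • dX + t • dY with hu
    set v : Plane := X' • dX + Y' • dY with hv
    obtain ⟨-, L, hL, hLu⟩ := hform (v 0) (v 1)
    obtain ⟨L', hL', hLu'⟩ := hder v
    have hLL : L = L' := hL.unique hL'
    have hu2 := hLu u
    rw [hLL, hLu'] at hu2
    have hTu : T u = s • T dX + t • T dY := by rw [hu, map_add, map_smul, map_smul]
    have hTv : T v = X' • T dX + Y' • T dY := by rw [hv, map_add, map_smul, map_smul]
    rw [hTu, hTv] at hu2
    have u0 : u 0 = s := by simp [hu, dX, dY]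
    have u1 : u 1 = t := by simp [hu, dX, dY]
    have v0 : v 0 = X' := by simp [hv, dX, dY]
    have v1 : v 1 = Y' := by simp [hv, dX, dY]
    rw [u0, u1, v0, v1] at hu2
    rw [eq_inv_mul_iff_mul_eq₀ hκ0, hu2]
    unfold h1 h2
    ring

end MongeChart

/-- A linear map of the plane with nonzero determinant, as an equivalence. -/
lemma exists_equiv_of_det2_ne_zero {T : Plane →L[ℝ] Plane} (h : det2 T ≠ 0) :
    ∃ T' : Plane ≃L[ℝ] Plane, (T' : Plane →L[ℝ] Plane) = T := by
  have hs := surjective_of_det2_ne_zero h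
  exact ⟨ContinuousLinearEquiv.ofBijective T (LinearMap.ker_eq_bot.mpr
    (injective_of_surjective_plane hs)) (LinearMap.range_eq_top.mpr hs), by ext; rfl⟩

lemma orthonormal_pair_extend {t1 t2 : Space} (h1 : inner ℝ t1 t1 = (1 : ℝ))
    (h2 : inner ℝ t2 t2 = (1 : ℝ)) (h12 : inner ℝ t1 t2 = (0 : ℝ)) :
    ∃ b : OrthonormalBasis (Fin 4) ℝ Space, b 0 = t1 ∧ b 1 = t2 := by
  have hn1 : ‖t1‖ = 1 := by
    rw [real_inner_self_eq_norm_sq] at h1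
    nlinarith [norm_nonneg t1]
  have hn2 : ‖t2‖ = 1 := by
    rw [real_inner_self_eq_norm_sq] at h2
    nlinarith [norm_nonneg t2]
  have h21 : inner ℝ t2 t1 = (0 : ℝ) := by rw [real_inner_comm]; exact h12
  have ho : Orthonormal ℝ (({0, 1} : Set (Fin 4)).domRestrict (![t1, t2, 0, 0] : Fin 4 → Space)) := by
    constructor
    · rintro ⟨i, rfl | rfl⟩
      · simpa using hn1
      · simpa using hn2
    · rintro ⟨i, rfl | rfl⟩ ⟨j, rfl | rfl⟩ hij
      · exact absurd rfl hij
      · simpa using h12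
      · simpa using h21
      · exact absurd rfl hij
  obtain ⟨b, hb⟩ := ho.exists_orthonormalBasis_extension_of_card_eq (by simp)
  exact ⟨b, by simpa using hb 0 (by simp), by simpa using hb 1 (by simp)⟩

section MongeChart

variable {M : Type*} [TopologicalSpace M] [ChartedSpace Plane M]

/-- A local diffeomorphism of the plane composed with a chart is a chart of the maximal atlas. -/
lemma trans_mem_maximalAtlas {n : WithTop ℕ∞} [IsManifold (𝓡 2) n M] (p : M)
    (H : OpenPartialHomeomorph Plane Plane) (hH : ContDiffOn ℝ n H H.source)
    (hH' : ContDiffOn ℝ n H.symm H.target) :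
    (chartAt Plane p).trans H ∈ IsManifold.maximalAtlas (𝓡 2) n M := by
  have hch := IsManifold.chart_mem_maximalAtlas (I := 𝓡 2) (n := n) p
  apply OpenPartialHomeomorph.mem_maximalAtlas_of_contMDiffOn
  · rw [OpenPartialHomeomorph.coe_trans]
    refine (contMDiffOn_iff_contDiffOn.mpr hH).comp
      ((contMDiffOn_of_mem_maximalAtlas hch).mono ?_) ?_
    · intro z hz; rw [OpenPartialHomeomorph.trans_source] at hz; exact hz.1
    · intro z hz; rw [OpenPartialHomeomorph.trans_source] at hz; exact hz.2
  · rw [OpenPartialHomeomorph.coe_trans_symm]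
    refine (contMDiffOn_symm_of_mem_maximalAtlas hch).comp
      ((contMDiffOn_iff_contDiffOn.mpr hH').mono ?_) ?_
    · intro z hz; rw [OpenPartialHomeomorph.trans_target] at hz; exact hz.1
    · intro z hz; rw [OpenPartialHomeomorph.trans_target] at hz; exact hz.2

variable [IsManifold (𝓡 2) ∞ M]

/-- Every orthogonal frame is the coordinate frame of a Monge chart. -/
lemma exists_isMongeChart {r : ℕ∞} (hr : 1 ≤ r) (μ : CrMap r M) {m p : M}
    (hm : m ∈ (chartAt Plane p).source) {v1 v2 : Plane} {c : ℝ} (hc : 0 < c)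
    (h11 : firstForm (chartMap p μ) (chartAt Plane p m) v1 v1 = (c ^ 2)⁻¹)
    (h22 : firstForm (chartMap p μ) (chartAt Plane p m) v2 v2 = (c ^ 2)⁻¹)
    (h12 : firstForm (chartMap p μ) (chartAt Plane p m) v1 v2 = 0) :
    ∃ (e : OpenPartialHomeomorph M Plane) (Γ : Space ≃ᵃⁱ[ℝ] Space) (R S : Plane → ℝ),
      IsMongeChart r μ m e Γ c R S ∧ fderiv ℝ (chartAt Plane p ∘ e.symm) 0 dX = v1 ∧
      fderiv ℝ (chartAt Plane p ∘ e.symm) 0 dY = v2 := by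
  have hman : IsManifold (𝓡 2) (r : WithTop ℕ∞) M :=
    IsManifold.of_le (n := ∞) (WithTop.coe_le_coe.mpr le_top)
  have h1r : (1 : WithTop ℕ∞) ≤ r := WithTop.coe_le_coe.mpr hr
  have hr0 : (r : WithTop ℕ∞) ≠ 0 := by
    intro h0; rw [h0] at h1r; norm_num at h1r
  set X := chartMap p μ with hX
  set x := chartAt Plane p m with hx
  have hxt : x ∈ (chartAt Plane p).target := (chartAt Plane p).map_source hm
  have htarget : (extChartAt (𝓡 2) p).target = (chartAt Plane p).target := by simp
  have hXon : ContDiffOn ℝ (r : WithTop ℕ∞) X (chartAt Plane p).target := by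
    rw [← htarget]; exact contDiffOn_chartMap p μ
  have hopen := (chartAt Plane p).open_target
  have hXd : HasFDerivAt X (fderiv ℝ X x) x :=
    ((hXon.contDiffAt (hopen.mem_nhds hxt)).differentiableAt hr0).hasFDerivAt
  set P := fderiv ℝ X x with hP
  have hc2 : c ^ 2 ≠ 0 := pow_ne_zero _ hc.ne'
  -- Coordinates in an orthonormal basis of ℝ⁴ that starts with the scaled images of the frame
  -- define Γ. The first two coordinates ψ of the surface then have the differential that sends v1,
  -- v2 to the standard basis, and the Monge chart is the local inverse of ψ.
  obtain ⟨b, hb0, hb1⟩ : ∃ b : OrthonormalBasis (Fin 4) ℝ Space, b 0 = c • P v1 ∧ b 1 = c • P v2 := by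
    apply orthonormal_pair_extend
    · rw [real_inner_smul_left, real_inner_smul_right, ← mul_assoc, ← sq]
      rw [show inner ℝ (P v1) (P v1) = (c ^ 2)⁻¹ from h11, mul_inv_cancel₀ hc2]
    · rw [real_inner_smul_left, real_inner_smul_right, ← mul_assoc, ← sq]
      rw [show inner ℝ (P v2) (P v2) = (c ^ 2)⁻¹ from h22, mul_inv_cancel₀ hc2]
    · rw [real_inner_smul_left, real_inner_smul_right]
      rw [show inner ℝ (P v1) (P v2) = (0 : ℝ) from h12, mul_zero, mul_zero]
  set Λ : Space →L[ℝ] Space := b.repr.toContinuousLinearEquiv.toContinuousLinearMap with hΛ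
  have hΛ1 : c • Λ (P v1) = EuclideanSpace.single 0 1 := by
    rw [← map_smul, ← hb0]; exact b.repr_self 0
  have hΛ2 : c • Λ (P v2) = EuclideanSpace.single 1 1 := by
    rw [← map_smul, ← hb1]; exact b.repr_self 1
  set Γ : Space ≃ᵃⁱ[ℝ] Space :=
    (AffineIsometryEquiv.constVAdd ℝ Space (-μ m)).trans b.repr.toAffineIsometryEquiv with hΓ
  have hΓa : ∀ z, Γ z = Λ (-μ m + z) := fun z => rfl
  set g : Plane → Space := fun z => c • Λ (-μ m + X z) with hg
  have hgon : ContDiffOn ℝ (r : WithTop ℕ∞) g (chartAt Plane p).target :=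
    (Λ.contDiff.comp_contDiffOn (contDiffOn_const.add hXon)).const_smul c
  have hgd : HasFDerivAt g (c • Λ.comp P) x :=
    (Λ.hasFDerivAt.comp x (hXd.const_add (-μ m))).const_smul c
  set π : Space →L[ℝ] Plane := LinearMap.toContinuousLinearMap
    { toFun := fun y => !₂[y 0, y 1]
      map_add' := fun y z => by ext i; fin_cases i <;> simp
      map_smul' := fun s y => by ext i; fin_cases i <;> simp } with hπ
  have hπa : ∀ y : Space, π y = !₂[y 0, y 1] := fun y => rfl
  set ψ : Plane → Plane := fun z => π (g z) with hψ
  have hψon : ContDiffOn ℝ (r : WithTop ℕ∞) ψ (chartAt Plane p).target :=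
    π.contDiff.comp_contDiffOn hgon
  set A : Plane →L[ℝ] Plane := π.comp (c • Λ.comp P) with hA
  have hψd : HasFDerivAt ψ A x := π.hasFDerivAt.comp x hgd
  have hA1 : A v1 = dX := by
    have : A v1 = π (c • Λ (P v1)) := rfl
    rw [this, hΛ1, hπa]; ext i; fin_cases i <;> simp [dX]
  have hA2 : A v2 = dY := by
    have : A v2 = π (c • Λ (P v2)) := rfl
    rw [this, hΛ2, hπa]; ext i; fin_cases i <;> simp [dY]
  have hAcomb : ∀ u : Plane, A (u 0 • v1 + u 1 • v2) = u := by
    intro u; rw [map_add, map_smul, map_smul, hA1, hA2, ← plane_eq]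
  have hAsurj : Function.Surjective A := fun u => ⟨_, hAcomb u⟩
  have hAdet : det2 A ≠ 0 := det2_ne_zero (injective_of_surjective_plane hAsurj)
  obtain ⟨A', hA'⟩ := exists_equiv_of_det2_ne_zero hAdet
  have hA'app : ∀ u, A' u = A u := fun u => DFunLike.congr_fun hA' u
  have hAsymm1 : A'.symm dX = v1 := by rw [← hA1, ← hA'app, A'.symm_apply_apply]
  have hAsymm2 : A'.symm dY = v2 := by rw [← hA2, ← hA'app, A'.symm_apply_apply]
  have hψd' : HasFDerivAt ψ (A' : Plane →L[ℝ] Plane) x := by rw [hA']; exact hψd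
  have hψat := hψon.contDiffAt (hopen.mem_nhds hxt)
  set H := hψat.toOpenPartialHomeomorph ψ hψd' hr0 with hH
  have hHcoe : (H : Plane → Plane) = ψ := rfl
  have hxH : x ∈ H.source := hψat.mem_toOpenPartialHomeomorph_source hψd' hr0
  -- The inverse must be C^r on its whole domain to give a chart of the maximal atlas, so the local
  -- inverse is restricted to the open set where dψ remains invertible.
  set O : Set Plane := (chartAt Plane p).target ∩ (fun z => det2 (fderiv ℝ ψ z)) ⁻¹' {0}ᶜ with hO
  have hOopen : IsOpen O := by
    refine ContinuousOn.isOpen_inter_preimage ?_ hopen isOpen_compl_singleton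
    have hf : ContinuousOn (fderiv ℝ ψ) (chartAt Plane p).target :=
      hψon.continuousOn_fderiv_of_isOpen hopen h1r
    have app : ∀ w (i : Fin 2), ContinuousOn (fun z => fderiv ℝ ψ z w i) (chartAt Plane p).target :=
      fun w i => (EuclideanSpace.proj i : Plane →L[ℝ] ℝ).continuous.comp_continuousOn
        (hf.clm_apply continuousOn_const)
    exact ((app dX 0).mul (app dY 1)).sub ((app dX 1).mul (app dY 0))
  have hxO : x ∈ O := ⟨hxt, by simpa [hψd.fderiv] using hAdet⟩
  set H' := H.restrOpen O hOopen with hH'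
  have hH'coe : (H' : Plane → Plane) = ψ := rfl
  have hH's : H'.source = H.source ∩ O := rfl
  have hxH' : x ∈ H'.source := by rw [hH's]; exact ⟨hxH, hxO⟩
  have hH'on : ContDiffOn ℝ (r : WithTop ℕ∞) H' H'.source := by
    rw [hH'coe]; exact hψon.mono fun z hz => (by rw [hH's] at hz; exact hz.2.1)
  have hH'symm : ContDiffOn ℝ (r : WithTop ℕ∞) H'.symm H'.target := by
    intro y hy
    have hz : H'.symm y ∈ H'.source := H'.map_target hy
    rw [hH's] at hz
    obtain ⟨D, hD⟩ := exists_equiv_of_det2_ne_zero (show det2 (fderiv ℝ ψ (H'.symm y)) ≠ 0 from hz.2.2)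
    have hcd := hψon.contDiffAt (hopen.mem_nhds hz.2.1)
    exact (H'.contDiffAt_symm hy (f₀' := D)
      (by rw [hD, hH'coe]; exact (hcd.differentiableAt hr0).hasFDerivAt) hcd).contDiffWithinAt
  set e := (chartAt Plane p).trans H' with he
  have hψx : ψ x = 0 := by
    have : X x = μ m := by
      change μ ((chartAt Plane p).symm (chartAt Plane p m)) = μ m
      rw [(chartAt Plane p).left_inv hm]
    simp only [hψ, hg, this, neg_add_cancel, map_zero, smul_zero]
  have hem : e m = 0 := by
    change H' (chartAt Plane p m) = 0
    rw [hH'coe, ← hx, hψx]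
  have hms : m ∈ e.source := by
    rw [he, OpenPartialHomeomorph.trans_source]; exact ⟨hm, hxH'⟩
  have h0t : (0 : Plane) ∈ H'.target := by
    rw [← hψx, ← hH'coe]; exact H'.map_source hxH'
  have hs0 : H'.symm 0 = x := by rw [← hψx, ← hH'coe]; exact H'.left_inv hxH'
  have hval : ∀ q, c • Γ (μ (e.symm q)) = g (H'.symm q) := fun q => rfl
  have hsd : HasFDerivAt H'.symm (A'.symm : Plane →L[ℝ] Plane) 0 :=
    H'.hasFDerivAt_symm h0t (by rw [hs0, hH'coe]; exact hψd')
  have hgs : HasFDerivAt (fun q => g (H'.symm q)) ((c • Λ.comp P).comp (A'.symm : Plane →L[ℝ] Plane))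
      0 := by
    have hgd' : HasFDerivAt g (c • Λ.comp P) (H'.symm 0) := by rw [hs0]; exact hgd
    exact hgd'.comp 0 hsd
  have hcoord : ∀ i : Fin 4, i ≠ 0 → i ≠ 1 →
      HasFDerivAt (fun q => (c • Γ (μ (e.symm q))) i) (0 : Plane →L[ℝ] ℝ) 0 := by
    intro i hi0 hi1
    have h := (EuclideanSpace.proj i : Space →L[ℝ] ℝ).hasFDerivAt.comp 0 hgs
    refine h.congr_fderiv ?_
    ext u
    have : A'.symm u = u 0 • v1 + u 1 • v2 := by
      conv_lhs => rw [plane_eq u]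
      rw [map_add, map_smul, map_smul, hAsymm1, hAsymm2]
    have h2 : (c • Λ.comp P) (A'.symm u)
        = u 0 • EuclideanSpace.single 0 1 + u 1 • EuclideanSpace.single 1 1 := by
      rw [this, map_add, map_smul, map_smul, ← hΛ1, ← hΛ2]; rfl
    change ((c • Λ.comp P) (A'.symm u)) i = 0
    rw [h2]
    simp [hi0, hi1]
  refine ⟨e, Γ, fun q => (c • Γ (μ (e.symm q))) 2, fun q => (c • Γ (μ (e.symm q))) 3, ?_, ?_⟩
  · have hem0 : e.symm 0 = m := by rw [← hem]; exact e.left_inv hms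
    have hz0 : c • Γ (μ (e.symm 0)) = 0 := by
      rw [hem0, hΓa, neg_add_cancel, map_zero, smul_zero]
    refine ⟨trans_mem_maximalAtlas p H' hH'on hH'symm, hms, hem, hc, ?_, ?_, ?_,
      hcoord 2 (by decide) (by decide), hcoord 3 (by decide) (by decide)⟩
    · intro q hq
      have hqt : q ∈ H'.target := by
        rw [he, OpenPartialHomeomorph.trans_target] at hq; exact hq.1
      have hq' : ψ (H'.symm q) = q := by rw [← hH'coe]; exact H'.right_inv hqt
      have hq0 : (g (H'.symm q)) 0 = q 0 := by
        have := congrArg (fun v : Plane => v 0) hq'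
        simpa [hψ, hπa] using this
      have hq1 : (g (H'.symm q)) 1 = q 1 := by
        have := congrArg (fun v : Plane => v 1) hq'
        simpa [hψ, hπa] using this
      ext i
      fin_cases i
      · simpa [hval] using hq0
      · simpa [hval] using hq1
      · simp
      · simp
    · simp only [hz0]; rfl
    · simp only [hz0]; rfl
  · have hev : chartAt Plane p ∘ e.symm =ᶠ[𝓝 0] H'.symm := by
      have hcont := H'.continuousAt_symm h0t
      have : ∀ᶠ z in 𝓝 (0 : Plane), H'.symm z ∈ (chartAt Plane p).target := by
        apply hcont.eventually
        rw [hs0]; exact hopen.mem_nhds hxt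
      filter_upwards [this] with z hz
      exact (chartAt Plane p).right_inv hz
    rw [hev.fderiv_eq, hsd.fderiv]
    exact ⟨hAsymm1, hAsymm2⟩

/-- A normal form of the tensor in the chart at `p` is a normal form in a Monge chart. -/
lemma hasNormalForm_of_hasAxis {r : ℕ∞} (hr : 3 ≤ r) {μ : CrMap r M} (hμ : IsImmersion μ) {m : M}
    {a b : ℝ} {p : M} (hm : m ∈ (chartAt Plane p).source) (hax : IsAxiumbilic μ m)
    (h : HasAxis (coefE (chartMap p μ) (chartAt Plane p m))
      (coefF (chartMap p μ) (chartAt Plane p m)) (coefG (chartMap p μ) (chartAt Plane p m))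
      (fderiv ℝ (coefZ0 (chartMap p μ)) (chartAt Plane p m))
      (fderiv ℝ (coefZ1 (chartMap p μ)) (chartAt Plane p m)) a b) :
    HasNormalForm r μ m a b := by
  have hZ := (isAxiumbilic_iff hr p μ hμ (by simpa using hm)).mp hax
  have hr1 : 1 ≤ r := le_trans (by norm_num) hr
  obtain ⟨w1, w2, l, κ, hl, hκ, h11, h22, h12, hT⟩ := h
  set X := chartMap p μ
  set x := chartAt Plane p m
  have hxt : x ∈ (extChartAt (𝓡 2) p).target := by
    simpa [x] using (chartAt Plane p).map_source hm
  have hinj := injective_fderiv_chartMap hr1 p μ hμ hxt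
  have hE := coefE_pos hinj
  have hW : 0 < jetArea (fderiv ℝ X x) := coef_det_pos hinj
  set d := w1 0 * w2 1 - w1 1 * w2 0 with hd
  have hdet : (coefE X x * coefG X x - coefF X x ^ 2) * d ^ 2 = l ^ 2 := by
    have : (coefE X x * coefG X x - coefF X x ^ 2) * d ^ 2
        = metric (coefE X x) (coefF X x) (coefG X x) w1 w1
          * metric (coefE X x) (coefF X x) (coefG X x) w2 w2
          - metric (coefE X x) (coefF X x) (coefG X x) w1 w2 ^ 2 := by
      rw [hd]; unfold metric; ring
    rw [this, h11, h22, h12]; ring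
  have hd0 : d ≠ 0 := by
    intro h0; rw [h0] at hdet
    have : 0 < l ^ 2 := by positivity
    simp at hdet; linarith
  set C := d ^ 3 * κ / (coefE X x ^ 3 * jetArea (fderiv ℝ X x)) with hC
  have hC0 : C ≠ 0 := div_ne_zero (mul_ne_zero (pow_ne_zero _ hd0) hκ)
    (mul_ne_zero (pow_ne_zero _ hE.ne') hW.ne')
  -- Scaling the frame by s multiplies the derivative of the form by s¹¹, six factors from (det T)³
  -- and five from the tensor. The exponent is odd, so s of either sign is allowed and the sign of
  -- `C` can be absorbed.
  obtain ⟨ε, hε, hεC⟩ : ∃ ε : ℝ, ε ^ 2 = 1 ∧ 0 < ε * C := by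
    rcases lt_or_gt_of_ne hC0 with h | h
    · exact ⟨-1, by norm_num, by linarith⟩
    · exact ⟨1, by norm_num, by linarith⟩
  set q := √l with hq
  have hq0 : 0 < q := Real.sqrt_pos.mpr hl
  have hql : q ^ 2 = l := Real.sq_sqrt hl.le
  -- The condition c²s²l = 1 for a Monge chart gives s = ε/(cq). The total factor c⁸s¹¹C then equals
  -- εC/(c³q¹¹), and this choice of the homothety ratio makes it exactly 1.
  obtain ⟨c, hc, hc3⟩ : ∃ c : ℝ, 0 < c ∧ c ^ 3 = ε * C / q ^ 11 := by
    have hpos : 0 < ε * C / q ^ 11 := by positivity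
    refine ⟨(ε * C / q ^ 11) ^ ((3 : ℕ) : ℝ)⁻¹, Real.rpow_pos_of_pos hpos _,
      Real.rpow_inv_natCast_pow hpos.le (by norm_num)⟩
  set s := ε / (c * q) with hs
  have hs2 : s ^ 2 * l = (c ^ 2)⁻¹ := by
    rw [hs, div_pow, hε, ← hql]; field_simp
  have fst : ∀ u v : Plane, firstForm X x u v
      = metric (coefE X x) (coefF X x) (coefG X x) u v := firstForm_eq_metric X x
  obtain ⟨e, Γ, R, S, hM, hT1, hT2⟩ := exists_isMongeChart hr1 μ hm (v1 := s • w1) (v2 := s • w2) hc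
    (by rw [fst, metric_smul_left, metric_smul_right, h11, ← hs2]; ring)
    (by rw [fst, metric_smul_left, metric_smul_right, h22, ← hs2]; ring)
    (by rw [fst, metric_smul_left, metric_smul_right, h12]; ring)
  obtain ⟨-, -, hder⟩ := hM.axialForm_derivative hr hμ hm hZ.1 hZ.2
  refine ⟨hax, e, Γ, c, R, S, hM, fun dx dy => ?_⟩
  set T := fderiv ℝ (chartAt Plane p ∘ e.symm) 0 with hTdef
  have hTu : ∀ u : Plane, T u = (s * u 0) • w1 + (s * u 1) • w2 := fun u => by
    conv_lhs => rw [plane_eq u]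
    rw [map_add, map_smul, map_smul, hT1, hT2]; module
  have hdetT : det2 T = s ^ 2 * d := by
    unfold det2; rw [hT1, hT2, hd]; simp; ring
  set v : Plane := !₂[dx, dy] with hv
  have hv0 : v 0 = dx := by simp [hv]
  have hv1 : v 1 = dy := by simp [hv]
  obtain ⟨L, hL, hLu⟩ := hder v
  rw [hv0, hv1] at hL
  have hnorm : c ^ 8 * s ^ 11 * C = 1 := by
    have hs11 : s ^ 11 = ε / (c ^ 11 * q ^ 11) := by
      have : ε ^ 11 = ε := by linear_combination ε * (ε ^ 8 + ε ^ 6 + ε ^ 4 + ε ^ 2 + 1) * hε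
      rw [hs, div_pow, this, mul_pow]
    have hc3' : c ^ 3 * q ^ 11 = ε * C := by rw [hc3]; field_simp
    rw [hs11]
    field_simp
    linear_combination -hc3'
  refine ⟨?_, L, hL, fun u => ?_⟩
  · have h2r : (2 : WithTop ℕ∞) ≤ r := by
      have : (2 : ℕ∞) ≤ r := le_trans (by norm_num) hr
      exact WithTop.coe_le_coe.mpr this
    have hman : IsManifold (𝓡 2) (r : WithTop ℕ∞) M :=
      IsManifold.of_le (n := ∞) (WithTop.coe_le_coe.mpr le_top)
    have hmep := IsManifold.chart_mem_maximalAtlas (I := 𝓡 2) (n := (r : WithTop ℕ∞)) p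
    have hr0 : (r : WithTop ℕ∞) ≠ 0 := by
      intro h0; rw [h0] at h2r; norm_num at h2r
    have hτ0 : (chartAt Plane p ∘ e.symm) 0 = x := by
      simp only [Function.comp_apply, ← hM.map_center, e.left_inv hM.mem_source]; rfl
    have hτc := contDiffAt_coordChange hM.mem_atlas hmep hM.mem_source hm
    have hsurj := surjective_fderiv_coordChange hr0 hM.mem_atlas hmep hM.mem_source hm
    rw [hM.map_center] at hτc hsurj
    have key := axialForm_similarity (X := X)
      (by rw [hτ0]; exact (contDiffAt_chartMap p μ hxt).of_le h2r) (hτc.of_le h2r) hsurj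
      (hM.graph_eventuallyEq hm) v
    rw [hτ0, ((a_eq_zero_iff_axialForm hE.ne').mp ((coefZ_eq_zero_iff hinj).mp hZ)), mul_zero,
      hv0, hv1] at key
    exact (mul_eq_zero.mp key).resolve_left (pow_ne_zero _ hE.ne')
  · rw [hLu u, hTu u, hTu v, hv0, hv1, hT, hdetT]
    have hh1 : h1 (s * dx) (s * dy) = s ^ 4 * h1 dx dy := by unfold h1; ring
    have hh2 : h2 (s * dx) (s * dy) = s ^ 4 * h2 dx dy := by unfold h2; ring
    rw [hh1, hh2]
    calc _ = (c ^ 8 * s ^ 11 * C) * (u 1 * h1 dx dy + (a * u 0 + b * u 1) * h2 dx dy) := by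
          rw [hC]; ring
      _ = _ := by rw [hnorm]; unfold h1 h2; ring

end MongeChart

/-! ### Joint smoothness of evaluation -/

section Evaluation

universe w u

variable {B : Type w} {E F : Type u} [NormedAddCommGroup B] [NormedSpace ℝ B]
  [NormedAddCommGroup E] [NormedSpace ℝ E] [NormedAddCommGroup F] [NormedSpace ℝ F]

/-- The family of continuous linear maps `δ q`, indexed by the points of `Ω`, is bounded, and for
each `u` the function `q ↦ δ q u` has `k` derivatives on `Ω`, which are again given by such
families. -/
def IsJetFamily (Ω : Set E) :
    ℕ → ∀ {F : Type u} [NormedAddCommGroup F] [NormedSpace ℝ F], (E → B →L[ℝ] F) → Prop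
  | 0, _, _, _, δ => (∃ C, ∀ q ∈ Ω, ‖δ q‖ ≤ C) ∧ ∀ u, ContinuousOn (fun q => δ q u) Ω
  | k + 1, _, _, _, δ => (∃ C, ∀ q ∈ Ω, ‖δ q‖ ≤ C) ∧
      ∃ δ' : E → B →L[ℝ] (E →L[ℝ] _),
        (∀ q ∈ Ω, ∀ u, HasFDerivAt (fun p => δ p u) (δ' q u) q) ∧ IsJetFamily Ω k δ'

lemma IsJetFamily.exists_bound {Ω : Set E} {k : ℕ} {δ : E → B →L[ℝ] F}
    (h : IsJetFamily Ω k δ) : ∃ C, ∀ q ∈ Ω, ‖δ q‖ ≤ C := by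
  cases k with
  | zero => exact h.1
  | succ k => exact h.1

lemma IsJetFamily.clm_comp {Ω : Set E} {k : ℕ} {F G : Type u} [NormedAddCommGroup F]
    [NormedSpace ℝ F] [NormedAddCommGroup G] [NormedSpace ℝ G] (L : F →L[ℝ] G)
    {δ : E → B →L[ℝ] F} (h : IsJetFamily Ω k δ) : IsJetFamily Ω k (fun q => L ∘L δ q) := by
  have hb : ∃ C, ∀ q ∈ Ω, ‖L ∘L δ q‖ ≤ C := by
    obtain ⟨C, hC⟩ := h.exists_bound
    exact ⟨‖L‖ * C, fun q hq => (L.opNorm_comp_le _).trans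
      (mul_le_mul_of_nonneg_left (hC q hq) (norm_nonneg _))⟩
  induction k generalizing F G with
  | zero => exact ⟨hb, fun u => L.continuous.comp_continuousOn (h.2 u)⟩
  | succ k ih =>
    obtain ⟨_, δ', h', hk⟩ := h
    refine ⟨hb, fun q => (ContinuousLinearMap.compL ℝ E F G L) ∘L δ' q, fun q hq u => ?_, ?_⟩
    · exact L.hasFDerivAt.comp q (h' q hq u)
    · refine ih _ hk ?_
      obtain ⟨C, hC⟩ := hk.exists_bound
      exact ⟨‖ContinuousLinearMap.compL ℝ E F G L‖ * C, fun q hq =>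
        (ContinuousLinearMap.opNorm_comp_le _ _).trans
          (mul_le_mul_of_nonneg_left (hC q hq) (norm_nonneg _))⟩

/-- The mean value inequality with the uniform bound on δ' makes q ↦ δ q u Lipschitz with a constant
proportional to ‖u‖. Continuity thus holds in operator norm, at the price of one derivative. -/
lemma IsJetFamily.continuousOn {Ω : Set E} (hΩ : Convex ℝ Ω) {k : ℕ}
    {δ : E → B →L[ℝ] F} (h : IsJetFamily Ω (k + 1) δ) : ContinuousOn δ Ω := by
  obtain ⟨_, δ', h', hk⟩ := h
  obtain ⟨C, hC⟩ := hk.exists_bound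
  have hlip : LipschitzOnWith C.toNNReal δ Ω := by
    refine LipschitzOnWith.of_dist_le_mul fun x hx y hy => ?_
    rw [dist_eq_norm, dist_eq_norm]
    refine ContinuousLinearMap.opNorm_le_bound _ (by positivity) fun u => ?_
    have := hΩ.norm_image_sub_le_of_norm_hasFDerivWithin_le (f := fun p => δ p u)
      (f' := fun q => δ' q u) (C := C.toNNReal * ‖u‖)
      (fun q hq => (h' q hq u).hasFDerivWithinAt)
      (fun q hq => ((δ' q).le_opNorm u).trans
        (mul_le_mul_of_nonneg_right ((hC q hq).trans (Real.le_coe_toNNReal C)) (norm_nonneg _)))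
      hy hx
    calc ‖(δ x - δ y) u‖ = ‖δ x u - δ y u‖ := by simp
      _ ≤ _ := this
      _ = _ := by ring
  exact hlip.continuousOn

/-- Derivatives known for each vector u separately combine into a derivative in operator norm: by
continuity of δ' the mean value estimate is uniform in u up to the factor ‖u‖. -/
lemma hasFDerivAt_flip_of_continuousOn {Ω : Set E} (hΩo : IsOpen Ω)
    {δ : E → B →L[ℝ] F} {δ' : E → B →L[ℝ] (E →L[ℝ] F)}
    (h' : ∀ q ∈ Ω, ∀ u, HasFDerivAt (fun p => δ p u) (δ' q u) q) (hc : ContinuousOn δ' Ω)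
    {q : E} (hq : q ∈ Ω) : HasFDerivAt δ (δ' q).flip q := by
  rw [hasFDerivAt_iff_isLittleO, Asymptotics.isLittleO_iff]
  intro c hc0
  have hcq := (hc.continuousAt (hΩo.mem_nhds hq))
  obtain ⟨ε, hε, hball⟩ := Metric.eventually_nhds_iff_ball.1
    ((hcq.eventually (Metric.ball_mem_nhds (δ' q) hc0)).and (hΩo.mem_nhds hq))
  filter_upwards [Metric.ball_mem_nhds q hε] with x hx
  refine ContinuousLinearMap.opNorm_le_bound _ (by positivity) fun u => ?_
  have := (convex_ball q ε).norm_image_sub_le_of_norm_hasFDerivWithin_le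
    (f := fun p => δ p u - δ' q u p)
    (f' := fun p => δ' p u - δ' q u) (C := c * ‖u‖) (x := q) (y := x)
    (fun p hp => ((h' p (hball p hp).2 u).sub (δ' q u).hasFDerivAt).hasFDerivWithinAt)
    (fun p hp => by
      have h1 : ‖δ' p - δ' q‖ < c := (dist_eq_norm (δ' p) (δ' q)).symm.trans_lt (hball p hp).1
      calc ‖δ' p u - δ' q u‖ = ‖(δ' p - δ' q) u‖ := by simp
        _ ≤ _ := (δ' p - δ' q).le_opNorm u
        _ ≤ _ := mul_le_mul_of_nonneg_right h1.le (norm_nonneg _))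
    (Metric.mem_ball_self hε) hx
  calc ‖(δ x - δ q - (δ' q).flip (x - q)) u‖
      = ‖δ x u - δ' q u x - (δ q u - δ' q u q)‖ := by
        simp only [_root_.sub_apply, ContinuousLinearMap.flip_apply, map_sub]
        congr 1; abel
    _ ≤ _ := this
    _ = _ := by ring

/-- As operator-valued functions the families have one derivative less than along each vector. -/
lemma IsJetFamily.contDiffOn {Ω : Set E} (hΩ : Convex ℝ Ω) (hΩo : IsOpen Ω) {k : ℕ}
    {F : Type u} [NormedAddCommGroup F] [NormedSpace ℝ F]
    {δ : E → B →L[ℝ] F} (h : IsJetFamily Ω (k + 1) δ) : ContDiffOn ℝ k δ Ω := by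
  induction k generalizing F with
  | zero => exact contDiffOn_zero.2 (h.continuousOn hΩ)
  | succ k ih =>
    obtain ⟨_, δ', h', hk⟩ := h
    have hd : ∀ q ∈ Ω, HasFDerivAt δ (δ' q).flip q := fun q hq =>
      hasFDerivAt_flip_of_continuousOn hΩo h' (hk.continuousOn hΩ) hq
    rw [Nat.cast_succ, contDiffOn_succ_iff_fderiv_of_isOpen hΩo]
    refine ⟨fun q hq => (hd q hq).differentiableAt.differentiableWithinAt, by simp, ?_⟩
    have hflip : ContDiff ℝ k (fun L : B →L[ℝ] E →L[ℝ] F => L.flip) :=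
      IsBoundedLinearMap.contDiff (IsLinearMap.with_bound
        ⟨fun _ _ => rfl, fun _ _ => rfl⟩ 1 fun L => by simp [ContinuousLinearMap.opNorm_flip])
    exact (hflip.comp_contDiffOn (ih hk)).congr fun q hq => (hd q hq).fderiv

/-- Evaluation is as smooth, jointly in the function and in the point, as the functions. -/
lemma IsJetFamily.contDiffOn_eval {Ω : Set E} (hΩ : Convex ℝ Ω) (hΩo : IsOpen Ω) {k : ℕ}
    {F : Type u} [NormedAddCommGroup F] [NormedSpace ℝ F]
    {δ : E → B →L[ℝ] F} (h : IsJetFamily Ω k δ) :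
    ContDiffOn ℝ k (fun x : B × E => δ x.2 x.1) (univ ×ˢ Ω) := by
  induction k generalizing F with
  | zero =>
    refine contDiffOn_zero.2 fun x hx => ContinuousAt.continuousWithinAt ?_
    obtain ⟨C, hC⟩ := h.1
    have h2 : ContinuousAt (fun y : B × E => δ y.2 x.1) x :=
      ContinuousAt.comp (f := Prod.snd) (x := x) (g := fun q => δ q x.1)
        ((h.2 x.1).continuousAt (hΩo.mem_nhds hx.2)) continuousAt_snd
    have h1 : Tendsto (fun y : B × E => δ y.2 (y.1 - x.1)) (𝓝 x) (𝓝 0) := by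
      have h3 : Tendsto (fun y : B × E => C * ‖y.1 - x.1‖) (𝓝 x) (𝓝 0) := by
        have : Continuous (fun y : B × E => C * ‖y.1 - x.1‖) := by fun_prop
        simpa using this.tendsto x
      refine squeeze_zero_norm' ?_ h3
      filter_upwards [(hΩo.preimage continuous_snd).mem_nhds hx.2] with y hy
      exact ((δ y.2).le_opNorm _).trans (mul_le_mul_of_nonneg_right (hC _ hy) (norm_nonneg _))
    have := h1.add h2.tendsto
    simpa [ContinuousAt] using this
  | succ k ih =>
    have hδ := h.contDiffOn hΩ hΩo
    have hδc := h.continuousOn hΩ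
    obtain ⟨_, δ', h', hk⟩ := h
    -- The derivative is (h, η) ↦ δ q h + δ' q u η. The first term needs δ only in class C^k in
    -- operator norm, which is what remains after the loss of one order; the second is again an
    -- evaluation map, covered by the induction hypothesis.
    have hd : ∀ x ∈ (univ ×ˢ Ω : Set (B × E)), HasFDerivAt (fun x : B × E => δ x.2 x.1)
        ((δ x.2).coprod (δ' x.2 x.1)) x := by
      intro x hx
      have h1 : HasFDerivAt (fun y : B × E => δ y.2 x.1)
          ((δ' x.2 x.1) ∘L ContinuousLinearMap.snd ℝ B E) x :=
        HasFDerivAt.comp x (g := fun q => δ q x.1) (h' x.2 hx.2 x.1) hasFDerivAt_snd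
      have h2 : HasFDerivAt (fun y : B × E => δ y.2 (y.1 - x.1))
          ((δ x.2) ∘L ContinuousLinearMap.fst ℝ B E) x := by
        rw [hasFDerivAt_iff_isLittleO]
        have h3 : Tendsto (fun y : B × E => δ y.2 - δ x.2) (𝓝 x) (𝓝 0) := by
          have : ContinuousAt (fun y : B × E => δ y.2) x :=
            ContinuousAt.comp (f := Prod.snd) (x := x) (g := δ)
              (hδc.continuousAt (hΩo.mem_nhds hx.2)) continuousAt_snd
          simpa using this.tendsto.sub_const (δ x.2)
        have h4 : (fun y : B × E => (δ y.2 - δ x.2) (y.1 - x.1)) =o[𝓝 x] fun y => y - x := by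
          rw [Asymptotics.isLittleO_iff]
          intro c hc
          filter_upwards [Metric.tendsto_nhds.1 h3 c hc] with y hy
          rw [dist_zero_right] at hy
          exact ((δ y.2 - δ x.2).le_opNorm _).trans
            (mul_le_mul hy.le (norm_fst_le (y - x)) (norm_nonneg _) hc.le)
        refine h4.congr_left fun y => ?_
        simp
      refine (h1.add h2).congr_fderiv ?_ |>.congr_of_eventuallyEq ?_
      · ext <;> simp
      · exact Eventually.of_forall fun y => by simp
    have hopen : IsOpen (univ ×ˢ Ω : Set (B × E)) := isOpen_univ.prod hΩo
    rw [Nat.cast_succ, contDiffOn_succ_iff_fderiv_of_isOpen hopen]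
    refine ⟨fun q hq => (hd q hq).differentiableAt.differentiableWithinAt, by simp, ?_⟩
    have e1 : ContDiffOn ℝ k (fun x : B × E => δ x.2) (univ ×ˢ Ω) :=
      hδ.comp contDiff_snd.contDiffOn fun x hx => hx.2
    have e2 := ih hk
    have e3 : ContDiffOn ℝ k (fun x : B × E => (δ x.2) ∘L ContinuousLinearMap.fst ℝ B E
        + (δ' x.2 x.1) ∘L ContinuousLinearMap.snd ℝ B E) (univ ×ˢ Ω) :=
      (e1.clm_comp contDiffOn_const).add (e2.clm_comp contDiffOn_const)
    refine e3.congr fun x hx => ?_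
    rw [(hd x hx).fderiv]
    ext <;> simp

end Evaluation

/-! ### Implicit functions, and derivatives of functions factoring through a Banach space -/

/-- A continuous solution of an implicit equation is as smooth as the equation. -/
lemma contDiffAt_of_implicit {B E F : Type*} [NormedAddCommGroup B] [NormedSpace ℝ B]
    [CompleteSpace B] [NormedAddCommGroup E] [NormedSpace ℝ E] [CompleteSpace E]
    [NormedAddCommGroup F] [NormedSpace ℝ F] [CompleteSpace F] {f : B × E → F} {q : B → E} {u : B}
    {n : WithTop ℕ∞} (hn : n ≠ 0) (hf : ContDiffAt ℝ n f (u, q u)) (hq : ContinuousAt q u)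
    (hinv : (fderiv ℝ f (u, q u) ∘L .inr ℝ B E).IsInvertible)
    (h0 : ∀ᶠ w in 𝓝 u, f (w, q w) = 0) : ContDiffAt ℝ n q u := by
  have h1 := hf.eventually_apply_eq_iff_implicitFunction hn hinv
  -- By continuity the given solution stays where the implicit function is the only solution, so the
  -- two agree near `u`.
  have ht : Tendsto (fun w => (w, q w)) (𝓝 u) (𝓝 (u, q u)) := (continuousAt_id.prodMk hq).tendsto
  refine (hf.contDiffAt_implicitFunction hn hinv).congr_of_eventuallyEq ?_
  filter_upwards [ht.eventually h1, h0] with w hw hw0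
  rw [hw0, h0.self_of_nhds] at hw
  exact (hw.1 rfl).symm

/-- Existence, uniqueness and continuity of the solution of an implicit equation. -/
lemma exists_implicit {B E F : Type*} [NormedAddCommGroup B] [NormedSpace ℝ B]
    [CompleteSpace B] [NormedAddCommGroup E] [NormedSpace ℝ E] [CompleteSpace E]
    [NormedAddCommGroup F] [NormedSpace ℝ F] [CompleteSpace F] {f : B × E → F} {u₀ : B} {q₀ : E}
    (hf : ContDiffAt ℝ 1 f (u₀, q₀))
    (hinv : (fderiv ℝ f (u₀, q₀) ∘L .inr ℝ B E).IsInvertible) (h0 : f (u₀, q₀) = 0)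
    {N : Set E} (hN : N ∈ 𝓝 q₀) :
    ∃ q : B → E, q u₀ = q₀ ∧ ∃ V ⊆ N, IsOpen V ∧ q₀ ∈ V ∧ ∃ U, IsOpen U ∧ u₀ ∈ U ∧
      ContinuousOn q U ∧ ∀ u ∈ U, q u ∈ V ∧ ∀ p ∈ V, f (u, p) = 0 ↔ p = q u := by
  have h1 := hf.eventually_apply_eq_iff_implicitFunction one_ne_zero hinv
  set q := hf.implicitFunction one_ne_zero hinv with hqdef
  have hq0 : q u₀ = q₀ := hf.implicitFunction_apply_self one_ne_zero hinv
  have hqc : ∀ᶠ u in 𝓝 u₀, ContinuousAt q u := by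
    have := (hf.contDiffAt_implicitFunction one_ne_zero hinv).eventually (by simp)
    exact this.mono fun u hu => hu.continuousAt
  rw [h0, nhds_prod_eq] at h1
  obtain ⟨P, hP, Q, hQ, hPQ⟩ := Filter.eventually_prod_iff.1 h1
  obtain ⟨V, hVs, hVo, hqV⟩ := mem_nhds_iff.1 (inter_mem hQ hN)
  have hqV' : ∀ᶠ u in 𝓝 u₀, q u ∈ V := by
    refine hqc.self_of_nhds.eventually_mem ?_
    rw [hq0]; exact hVo.mem_nhds hqV
  obtain ⟨U, hUs, hUo, hU⟩ := eventually_nhds_iff.1 (hqc.and (hqV'.and hP))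
  refine ⟨q, hq0, V, fun x hx => (hVs hx).2, hVo, hqV, U, hUo, hU,
    fun u hu => (hUs u hu).1.continuousWithinAt, fun u hu => ⟨(hUs u hu).2.1, fun p hp => ?_⟩⟩
  have := hPQ (hUs u hu).2.2 (hVs hp).1
  rw [this]
  exact eq_comm

/-- The derivatives of a function of class `C^n` of a continuous linear image. -/
lemma exists_derivatives_of_comp {V B : Type*} [AddCommGroup V] [Module ℝ V] [TopologicalSpace V]
    [NormedAddCommGroup B] [NormedSpace ℝ B] {n : ℕ} {f : V → ℝ} {W : Set V}
    (ρ : V →L[ℝ] B) {g : B → ℝ} {U : Set B} (hU : IsOpen U) (hWU : MapsTo ρ W U)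
    (hg : ContDiffOn ℝ n g U) (hfg : ∀ x ∈ W, f x = g (ρ x)) :
    ∃ D : (j : ℕ) → V → ContinuousMultilinearMap ℝ (fun _ : Fin j => V) ℝ,
      (∀ x ∈ W, ∀ v : Fin 0 → V, D 0 x v = f x) ∧
      (∀ j ≤ n, ContinuousOn (D j) W) ∧
      ∀ j < n, ∀ x ∈ W, ∀ (h : V) (v : Fin j → V),
        HasDerivAt (fun t : ℝ => D j (x + t • h) v) (D (j + 1) x (Fin.cons h v)) 0 := by
  -- The derivatives are pulled back along ρ. Precomposition with a continuous linear map is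
  -- continuous for uniform convergence on bounded sets, so no norm on V is needed.
  refine ⟨fun j x => (iteratedFDeriv ℝ j g (ρ x)).compContinuousLinearMap fun _ => ρ,
    fun x hx v => ?_, fun j hj => ?_, fun j hj x hx h v => ?_⟩
  · simp [hfg x hx]
  · have h1 : ContinuousOn (iteratedFDeriv ℝ j g) U := fun y hy =>
      ((hg.contDiffAt (hU.mem_nhds hy)).continuousAt_iteratedFDeriv
        (by exact_mod_cast hj)).continuousWithinAt
    exact (ContinuousMultilinearMap.continuous_precomp (fun _ : Fin j => ρ)).comp_continuousOn
      (h1.comp ρ.continuous.continuousOn hWU)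
  · have h1 : DifferentiableAt ℝ (iteratedFDeriv ℝ j g) (ρ x + (0 : ℝ) • ρ h) := by
      rw [zero_smul, add_zero]
      exact (hg.contDiffAt (hU.mem_nhds (hWU hx))).differentiableAt_iteratedFDeriv
        (by exact_mod_cast hj)
    have h2 : HasDerivAt (fun t : ℝ => ρ x + t • ρ h) (ρ h) 0 := by
      simpa using ((hasDerivAt_id (0 : ℝ)).smul_const (ρ h)).const_add (ρ x)
    have h3 := h1.hasFDerivAt.comp_hasDerivAt (0 : ℝ) h2
    have h4 := (ContinuousMultilinearMap.apply ℝ (fun _ : Fin j => B) ℝ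
      (fun i => ρ (v i))).hasFDerivAt.comp_hasDerivAt (0 : ℝ) h3
    have e1 : (fun t : ℝ => ((iteratedFDeriv ℝ j g (ρ (x + t • h))).compContinuousLinearMap
        fun _ => ρ) v) = (ContinuousMultilinearMap.apply ℝ (fun _ : Fin j => B) ℝ
      (fun i => ρ (v i))) ∘ ((iteratedFDeriv ℝ j g) ∘ fun t : ℝ => ρ x + t • ρ h) := by
      funext t
      simp
    rw [e1]
    refine h4.congr_deriv ?_
    rw [zero_smul, add_zero]
    simp only [ContinuousMultilinearMap.compContinuousLinearMap_apply,
      iteratedFDeriv_succ_apply_left, Fin.cons_zero, ContinuousMultilinearMap.apply_apply]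
    congr 1

/-! ### Banach spaces of jets on a closed disk -/

section JetSpace

/-- Tuples of continuous maps on a closed disk. -/
abbrev JetProd (G : ℕ → Type) [∀ j, NormedAddCommGroup (G j)] (x₀ : Plane) (ε : ℝ) (k : ℕ) :
    Type :=
  (j : Fin (k + 1)) → C(Metric.closedBall x₀ ε, G j)

variable {G : ℕ → Type} [∀ j, NormedAddCommGroup (G j)] [∀ j, NormedSpace ℝ (G j)]
  {c : ∀ j, G (j + 1) →L[ℝ] Plane →L[ℝ] G j} {x₀ : Plane} {ε : ℝ} {k : ℕ}

open Classical in
/-- The value of the component of order `j` at a point. -/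
def evalJet (G : ℕ → Type) [∀ j, NormedAddCommGroup (G j)] [∀ j, NormedSpace ℝ (G j)]
    (x₀ : Plane) (ε : ℝ) (k : ℕ) (j : Fin (k + 1)) (q : Plane) : JetProd G x₀ ε k →L[ℝ] G j :=
  if h : q ∈ Metric.closedBall x₀ ε then
    (ContinuousMap.evalCLM ℝ ⟨q, h⟩) ∘L ContinuousLinearMap.proj j
  -- The value 0 off the disk is a default that keeps the norm bound and the uniform estimates valid
  -- on the whole plane.
  else 0

lemma evalJet_apply (j : Fin (k + 1)) {q : Plane} (h : q ∈ Metric.closedBall x₀ ε)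
    (u : JetProd G x₀ ε k) : evalJet G x₀ ε k j q u = u j ⟨q, h⟩ := by
  simp [evalJet, h]

lemma norm_evalJet_le (j : Fin (k + 1)) (q : Plane) : ‖evalJet G x₀ ε k j q‖ ≤ 1 := by
  refine ContinuousLinearMap.opNorm_le_bound _ zero_le_one fun u => ?_
  by_cases h : q ∈ Metric.closedBall x₀ ε
  · rw [evalJet_apply j h, one_mul]
    exact ((u j).norm_coe_le_norm _).trans (norm_le_pi_norm u j)
  · simp [evalJet, h]

/-- The space of `k`-jets of maps of the closed disk: the component of order `j + 1` is, through
`c j`, the derivative of the component of order `j` in the interior of the disk. -/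
def JetSpace (c : ∀ j, G (j + 1) →L[ℝ] Plane →L[ℝ] G j) (x₀ : Plane) (ε : ℝ) (k : ℕ) :
    Submodule ℝ (JetProd G x₀ ε k) where
  carrier := {u | ∀ j : Fin k, ∀ q ∈ Metric.ball x₀ ε,
    HasFDerivAt (fun p => evalJet G x₀ ε k j.castSucc p u) (c j (evalJet G x₀ ε k j.succ q u)) q}
  add_mem' := fun {u v} hu hv j q hq => by
    simp only [map_add]
    exact (hu j q hq).add (hv j q hq)
  zero_mem' := fun j q hq => by
    simp only [map_zero]
    exact hasFDerivAt_const _ _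
  smul_mem' := fun a u hu j q hq => by
    simp only [map_smul]
    exact (hu j q hq).const_smul a

/-- If functions converge and their derivatives converge uniformly, the limit is differentiable with
the limit as derivative. Hence the jet space is complete and the implicit function theorem applies
there. -/
lemma isClosed_jetSpace : IsClosed (JetSpace c x₀ ε k : Set (JetProd G x₀ ε k)) := by
  refine isClosed_of_closure_subset fun u hu => ?_
  obtain ⟨s, hs, hsu⟩ := mem_closure_iff_seq_limit.1 hu
  intro j q hq
  have hcv : ∀ i : Fin (k + 1), TendstoUniformly
      (fun n p => evalJet G x₀ ε k i p (s n)) (fun p => evalJet G x₀ ε k i p u) atTop := by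
    intro i
    rw [Metric.tendstoUniformly_iff]
    intro δ hδ
    filter_upwards [Metric.tendsto_nhds.1 hsu δ hδ] with n hn p
    rw [dist_comm, dist_eq_norm, ← map_sub]
    rw [dist_eq_norm] at hn
    refine lt_of_le_of_lt ((evalJet G x₀ ε k i p).le_opNorm _) (lt_of_le_of_lt ?_ hn)
    exact mul_le_of_le_one_left (norm_nonneg _) (norm_evalJet_le i p)
  have hcurry : TendstoUniformly (fun n p => c j (evalJet G x₀ ε k j.succ p (s n)))
      (fun p => c j (evalJet G x₀ ε k j.succ p u)) atTop :=
    (c j).uniformContinuous.comp_tendstoUniformly (hcv j.succ)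
  exact hasFDerivAt_of_tendstoUniformlyOn Metric.isOpen_ball hcurry.tendstoUniformlyOn
    (fun n p hp => hs n j p hp) (fun p _ => (hcv j.castSucc).tendsto_at p) hq

/-- The space of `k`-jets, as a Banach space. -/
def JetBanach (c : ∀ j, G (j + 1) →L[ℝ] Plane →L[ℝ] G j) (x₀ : Plane) (ε : ℝ) (k : ℕ) : Type :=
  JetSpace c x₀ ε k

instance : NormedAddCommGroup (JetBanach c x₀ ε k) :=
  inferInstanceAs (NormedAddCommGroup (JetSpace c x₀ ε k))

instance : NormedSpace ℝ (JetBanach c x₀ ε k) :=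
  inferInstanceAs (NormedSpace ℝ (JetSpace c x₀ ε k))

instance [∀ j, CompleteSpace (G j)] : CompleteSpace (JetBanach c x₀ ε k) :=
  isClosed_jetSpace.completeSpace_coe

/-- The component of order `j` of a jet at a point. -/
def jetEval (c : ∀ j, G (j + 1) →L[ℝ] Plane →L[ℝ] G j) (x₀ : Plane) (ε : ℝ) (k : ℕ)
    (j : Fin (k + 1)) (q : Plane) : JetBanach c x₀ ε k →L[ℝ] G j :=
  LinearMap.mkContinuous
    { toFun := fun u => evalJet G x₀ ε k j q u.1
      map_add' := fun u v => map_add (evalJet G x₀ ε k j q) u.1 v.1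
      map_smul' := fun a u => map_smul (evalJet G x₀ ε k j q) a u.1 } 1
    fun u => (evalJet G x₀ ε k j q).le_of_opNorm_le (norm_evalJet_le j q) u.1

/-- The component of order j has k - j further derivatives, each obtained from the next component
through `c`. -/
lemma isJetFamily_jetEval {m : ℕ} (j : Fin (k + 1)) (hj : (j : ℕ) + m ≤ k) :
    IsJetFamily (Metric.ball x₀ ε) m (jetEval c x₀ ε k j) := by
  have hb : ∀ j : Fin (k + 1), ∃ C, ∀ q ∈ Metric.ball x₀ ε, ‖jetEval c x₀ ε k j q‖ ≤ C := fun j =>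
    ⟨1, fun q _ => LinearMap.mkContinuous_norm_le _ zero_le_one _⟩
  induction m generalizing j with
  | zero =>
    refine ⟨hb j, fun u => ?_⟩
    have : ContinuousOn (fun q => evalJet G x₀ ε k j q u.1) (Metric.closedBall x₀ ε) := by
      rw [continuousOn_iff_continuous_domRestrict]
      convert (u.1 j).continuous using 1
      funext q
      exact evalJet_apply j q.2 _
    exact this.mono Metric.ball_subset_closedBall
  | succ m ih =>
    obtain ⟨i, rfl⟩ : ∃ i : Fin k, i.castSucc = j := ⟨⟨j, by omega⟩, rfl⟩
    refine ⟨hb _, fun q => c i ∘L jetEval c x₀ ε k i.succ q, fun q hq u => u.2 i q hq, ?_⟩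
    refine IsJetFamily.clm_comp _ (ih i.succ ?_)
    simp only [Fin.val_castSucc, Fin.val_succ] at hj ⊢
    omega

lemma contDiffAt_jetEval {u : JetBanach c x₀ ε k} {q : Plane} (hq : q ∈ Metric.ball x₀ ε) :
    ContDiffAt ℝ k (fun x : JetBanach c x₀ ε k × Plane => jetEval c x₀ ε k 0 x.2 x.1) (u, q) := by
  have h1 := (isJetFamily_jetEval (c := c) (x₀ := x₀) (ε := ε) (0 : Fin (k + 1)) (m := k)
    (by simp)).contDiffOn_eval (convex_ball _ _) Metric.isOpen_ball
  exact h1.contDiffAt ((isOpen_univ.prod Metric.isOpen_ball).mem_nhds ⟨mem_univ _, hq⟩)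

lemma evalJet_castLE {l : ℕ} (h : l + 1 ≤ k + 1) (u : JetProd G x₀ ε k) (i : Fin (l + 1))
    (p : Plane) : evalJet G x₀ ε l i p (fun j : Fin (l + 1) => u (Fin.castLE h j)) =
      evalJet G x₀ ε k (Fin.castLE h i) p u := by
  by_cases hp : p ∈ Metric.closedBall x₀ ε
  · rw [evalJet_apply _ hp, evalJet_apply _ hp]
  · simp [evalJet, hp]

/-- Truncation of jets. -/
def truncateJet (c : ∀ j, G (j + 1) →L[ℝ] Plane →L[ℝ] G j) (x₀ : Plane) (ε : ℝ) {k l : ℕ}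
    (h : l ≤ k) : JetBanach c x₀ ε k →L[ℝ] JetBanach c x₀ ε l :=
  LinearMap.mkContinuous
    { toFun := fun u => ⟨fun j => u.1 (Fin.castLE (by omega) j), fun j q hq => by
        simp only [evalJet_castLE]
        exact u.2 (Fin.castLE h j) q hq⟩
      map_add' := fun _ _ => rfl
      map_smul' := fun _ _ => rfl } 1
    fun u => by
      rw [one_mul]
      exact (pi_norm_le_iff_of_nonneg (norm_nonneg u)).2 fun j =>
        norm_le_pi_norm u.1 (Fin.castLE (by omega) j)

lemma jetEval_truncateJet {k l : ℕ} (h : l ≤ k) (u : JetBanach c x₀ ε k) (q : Plane) :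
    jetEval c x₀ ε l 0 q (truncateJet c x₀ ε h u) = jetEval c x₀ ε k 0 q u :=
  evalJet_castLE (by omega) u.1 0 q

end JetSpace

/-! ### Jets of maps of the surface in a chart -/

section MapJet

/-- The spaces of derivatives of maps of the plane into `ℝ⁴`. -/
abbrev Deriv (j : ℕ) : Type := Plane [×j]→L[ℝ] Space

/-- A derivative of order `j + 1`, as a derivative of a derivative of order `j`. -/
def curryDeriv (j : ℕ) : Deriv (j + 1) →L[ℝ] Plane →L[ℝ] Deriv j :=
  (continuousMultilinearCurryLeftEquiv ℝ (fun _ : Fin (j + 1) => Plane)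
    Space).toContinuousLinearEquiv

/-- The Banach space of `k`-jets of maps of a closed disk into `ℝ⁴`. -/
abbrev MapJet (x₀ : Plane) (ε : ℝ) (k : ℕ) : Type := JetBanach curryDeriv x₀ ε k

variable {x₀ : Plane} {ε : ℝ} {k : ℕ}

/-- The map underlying a jet. -/
def jetMap (u : MapJet x₀ ε k) (q : Plane) : Space := jetEval curryDeriv x₀ ε k 0 q u 0

/-- A jet of order k is treated as a parameter on the same footing as the point; all smooth
dependence on μ is derived from this joint regularity. -/
lemma contDiffAt_jetMap {u : MapJet x₀ ε k} {q : Plane} (hq : q ∈ Metric.ball x₀ ε) :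
    ContDiffAt ℝ k (fun x : MapJet x₀ ε k × Plane => jetMap x.1 x.2) (u, q) :=
  ContDiffAt.comp (g := fun A : Deriv 0 => A 0) (f := fun x : MapJet x₀ ε k × Plane =>
      jetEval curryDeriv x₀ ε k 0 x.2 x.1) (u, q)
    (ContinuousMultilinearMap.apply ℝ (fun _ : Fin 0 => Plane) Space 0).contDiff.contDiffAt
    (contDiffAt_jetEval hq)

lemma jetMap_truncateJet {l : ℕ} (h : l ≤ k) (u : MapJet x₀ ε k) :
    jetMap (truncateJet curryDeriv x₀ ε h u) = jetMap u := by
  funext q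
  simp only [jetMap, jetEval_truncateJet]
  rfl

variable {M : Type*} [TopologicalSpace M] [ChartedSpace Plane M] [IsManifold (𝓡 2) ∞ M] {r : ℕ∞}
  {p : M}

lemma contDiffAt_chartMap_nat (hk : (k : ℕ∞) ≤ r) (μ : CrMap r M) {q : Plane}
    (hq : q ∈ (extChartAt (𝓡 2) p).target) : ContDiffAt ℝ k (chartMap p μ) q :=
  (contDiffAt_chartMap p μ hq).of_le (by exact_mod_cast hk)

/-- The jets, in a chart, of the derivatives of order at most `k` of `μ`. -/
def derivTuple (hε : Metric.closedBall x₀ ε ⊆ (extChartAt (𝓡 2) p).target) (hk : (k : ℕ∞) ≤ r)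
    (μ : CrMap r M) : JetProd Deriv x₀ ε k := fun j =>
  ⟨fun q => iteratedFDeriv ℝ j (chartMap p μ) q,
    continuous_iff_continuousAt.2 fun q =>
      ((contDiffAt_chartMap_nat hk μ (hε q.2)).continuousAt_iteratedFDeriv
        (by exact_mod_cast Nat.lt_succ_iff.1 j.2)).comp continuousAt_subtype_val⟩

lemma evalJet_derivTuple (hε : Metric.closedBall x₀ ε ⊆ (extChartAt (𝓡 2) p).target)
    (hk : (k : ℕ∞) ≤ r) (μ : CrMap r M) (j : Fin (k + 1)) {q : Plane}
    (hq : q ∈ Metric.closedBall x₀ ε) :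
    evalJet Deriv x₀ ε k j q (derivTuple hε hk μ) = iteratedFDeriv ℝ j (chartMap p μ) q :=
  evalJet_apply j hq _

lemma derivTuple_mem (hε : Metric.closedBall x₀ ε ⊆ (extChartAt (𝓡 2) p).target)
    (hk : (k : ℕ∞) ≤ r) (μ : CrMap r M) :
    derivTuple hε hk μ ∈ JetSpace curryDeriv x₀ ε k := by
  intro j q hq
  have hqc := Metric.ball_subset_closedBall hq
  have h1 : DifferentiableAt ℝ (iteratedFDeriv ℝ (j : ℕ) (chartMap p μ)) q :=
    (contDiffAt_chartMap_nat hk μ (hε hqc)).differentiableAt_iteratedFDeriv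
      (by exact_mod_cast j.2)
  have h2 := h1.hasFDerivAt
  rw [evalJet_derivTuple hε hk μ _ hqc]
  refine HasFDerivAt.congr_of_eventuallyEq (f := iteratedFDeriv ℝ (j : ℕ) (chartMap p μ)) ?_ ?_
  · rw [fderiv_iteratedFDeriv] at h2
    exact h2
  · filter_upwards [Metric.isOpen_ball.mem_nhds hq] with y hy
    exact evalJet_derivTuple hε hk μ j.castSucc (Metric.ball_subset_closedBall hy)

/-- The C^r topology controls derivatives uniformly on compact subsets of chart domains, in
particular on the closed disk. -/
lemma continuous_derivTuple (hε : Metric.closedBall x₀ ε ⊆ (extChartAt (𝓡 2) p).target)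
    (hk : (k : ℕ∞) ≤ r) : Continuous (derivTuple (M := M) hε hk) := by
  refine continuous_pi fun j => continuous_iff_continuousAt.2 fun μ => ?_
  have hj : ((j : ℕ) : ℕ∞) ≤ r := le_trans (by exact_mod_cast Nat.lt_succ_iff.1 j.2) hk
  have h1 : Continuous (fun μ : CrMap r M =>
      UniformOnFun.ofFun {K : Set Plane | IsCompact K ∧ K ⊆ (extChartAt (𝓡 2) p).target}
        (iteratedFDeriv ℝ (j : ℕ) (μ ∘ (extChartAt (𝓡 2) p).symm))) :=
    continuous_iff_le_induced.2 ((iInf_le _ p).trans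
      (iInf_le _ (⟨(j : ℕ), hj⟩ : {j : ℕ // (j : ℕ∞) ≤ r})))
  have h2 := UniformOnFun.tendsto_iff_tendstoUniformlyOn.1 (h1.tendsto μ) _
    ⟨isCompact_closedBall x₀ ε, hε⟩
  refine ContinuousMap.tendsto_iff_tendstoUniformly.2 ?_
  exact tendstoUniformlyOn_iff_tendstoUniformly_comp_coe.1 h2

/-- The jets of the expression of `μ` in a chart, as a continuous linear function of `μ`. -/
def mapJet (hε : Metric.closedBall x₀ ε ⊆ (extChartAt (𝓡 2) p).target) (hk : (k : ℕ∞) ≤ r) :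
    CrMap r M →L[ℝ] MapJet x₀ ε k where
  toFun μ := ⟨derivTuple hε hk μ, derivTuple_mem hε hk μ⟩
  map_add' μ ν := by
    refine Subtype.ext (funext fun j => ContinuousMap.ext fun q => ?_)
    have hj : ((j : ℕ) : ℕ∞) ≤ r := le_trans (by exact_mod_cast Nat.lt_succ_iff.1 j.2) hk
    exact iteratedFDeriv_add_apply (contDiffAt_chartMap_nat hj μ (hε q.2))
      (contDiffAt_chartMap_nat hj ν (hε q.2))
  map_smul' a μ := by
    refine Subtype.ext (funext fun j => ContinuousMap.ext fun q => ?_)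
    have hj : ((j : ℕ) : ℕ∞) ≤ r := le_trans (by exact_mod_cast Nat.lt_succ_iff.1 j.2) hk
    exact iteratedFDeriv_const_smul_apply (contDiffAt_chartMap_nat hj μ (hε q.2))
  cont := (continuous_derivTuple hε hk).subtype_mk _

lemma jetMap_mapJet (hε : Metric.closedBall x₀ ε ⊆ (extChartAt (𝓡 2) p).target)
    (hk : (k : ℕ∞) ≤ r) (μ : CrMap r M) {q : Plane} (hq : q ∈ Metric.closedBall x₀ ε) :
    jetMap (mapJet hε hk μ) q = chartMap p μ q := by
  have := evalJet_derivTuple hε hk μ 0 hq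
  change evalJet Deriv x₀ ε k 0 q (derivTuple hε hk μ) 0 = _
  rw [this]
  rfl

end MapJet

/-! ### The metric and the differentials of the coefficients as smooth data -/

section Symbol

/-- The data `E`, `F`, `G` and two differentials. -/
abbrev Symbol : Type := ℝ × ℝ × ℝ × (Plane →L[ℝ] ℝ) × (Plane →L[ℝ] ℝ)

/-- The quartic form of a symbol, which depends linearly on `w`. -/
def symTensor (σ : Symbol) (w v : Plane) : ℝ :=
  axialTensor σ.1 σ.2.1 σ.2.2.1 σ.2.2.2.1 σ.2.2.2.2 w v

/-- The determinant of the metric of a symbol. -/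
def symArea (σ : Symbol) : ℝ := σ.1 * σ.2.2.1 - σ.2.1 ^ 2

/-- The vector orthogonal to `v`, and of the same length, for the metric of a symbol. -/
def symPerp (σ : Symbol) (v : Plane) : Plane := perp σ.1 σ.2.1 σ.2.2.1 v

/-- The coefficient `a` of the normal form of a symbol whose axis has the direction `v`. -/
def symA (σ : Symbol) (v : Plane) : ℝ := axisA σ.1 σ.2.1 σ.2.2.1 σ.2.2.2.1 σ.2.2.2.2 v

/-- The coefficient `b` of the normal form of a symbol whose axis has the direction `v`. -/
def symB (σ : Symbol) (v : Plane) : ℝ := axisB σ.1 σ.2.1 σ.2.2.1 σ.2.2.2.1 σ.2.2.2.2 v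

lemma contDiff_symTensor {n : WithTop ℕ∞} :
    ContDiff ℝ n (fun x : Symbol × Plane × Plane => symTensor x.1 x.2.1 x.2.2) := by
  simp only [symTensor, axialTensor, quart]
  fun_prop

lemma contDiff_symArea {n : WithTop ℕ∞} : ContDiff ℝ n symArea := by
  unfold symArea
  fun_prop

lemma contDiffAt_symPerp {n : WithTop ℕ∞} {σ : Symbol} (hσ : 0 < symArea σ) (v : Plane) :
    ContDiffAt ℝ n (fun x : Symbol × Plane => symPerp x.1 x.2) (σ, v) := by
  have hσ' : (σ.1 * σ.2.2.1 - σ.2.1 ^ 2) ≠ 0 := hσ.ne'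
  have hs : √(σ.1 * σ.2.2.1 - σ.2.1 ^ 2) ≠ 0 := (Real.sqrt_pos.2 hσ).ne'
  have h1 : ContDiffAt ℝ n (fun x : Symbol × Plane =>
      (√(x.1.1 * x.1.2.2.1 - x.1.2.1 ^ 2))⁻¹) (σ, v) := by
    refine ContDiffAt.inv (ContDiffAt.sqrt ?_ hσ') hs
    fun_prop
  have h2 : ContDiffAt ℝ n (fun x : Symbol × Plane =>
      (!₂[-(x.1.2.1 * x.2 0 + x.1.2.2.1 * x.2 1), x.1.1 * x.2 0 + x.1.2.1 * x.2 1] : Plane))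
      (σ, v) := by
    rw [contDiffAt_euclidean]
    intro i
    fin_cases i
    · simp; fun_prop
    · simp; fun_prop
  exact h1.smul h2

lemma contDiffAt_symAB {n : WithTop ℕ∞} {σ : Symbol} (hσ : 0 < symArea σ) {v : Plane}
    (hv : symTensor σ (symPerp σ v) v ≠ 0) :
    ContDiffAt ℝ n (fun x : Symbol × Plane => (symA x.1 x.2, symB x.1 x.2)) (σ, v) := by
  have hp := contDiffAt_symPerp (n := n) hσ v
  have hT : ∀ {w z : Symbol × Plane → Plane}, ContDiffAt ℝ n w (σ, v) → ContDiffAt ℝ n z (σ, v) →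
      ContDiffAt ℝ n (fun x : Symbol × Plane => symTensor x.1 (w x) (z x)) (σ, v) := by
    intro w z hw hz
    exact ContDiff.comp_contDiffAt (g := fun x : Symbol × Plane × Plane =>
      symTensor x.1 x.2.1 x.2.2) (f := fun x : Symbol × Plane => (x.1, w x, z x)) (σ, v)
      contDiff_symTensor (contDiffAt_fst.prodMk (hw.prodMk hz))
  have h2 : ContDiffAt ℝ n (fun x : Symbol × Plane => (2 : ℝ) • x.2 + symPerp x.1 x.2) (σ, v) :=
    (contDiffAt_snd.const_smul 2).add hp
  have hden : ContDiffAt ℝ n (fun x : Symbol × Plane =>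
      6 * symTensor x.1 (symPerp x.1 x.2) x.2) (σ, v) :=
    contDiffAt_const.mul (hT hp contDiffAt_snd)
  have hden0 : 6 * symTensor σ (symPerp σ v) v ≠ 0 := mul_ne_zero (by norm_num) hv
  refine ContDiffAt.prodMk ?_ ?_
  · exact (hT contDiffAt_snd h2).div hden hden0
  · exact ((hT hp h2).add (contDiffAt_const.mul (hT hp contDiffAt_snd))).div hden hden0

/-- The symbol of a parametrized surface at a point. -/
def symbol (X : Plane → Space) (q : Plane) : Symbol :=
  (coefE X q, coefF X q, coefG X q, fderiv ℝ (coefZ0 X) q, fderiv ℝ (coefZ1 X) q)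

/-- The coefficients `a₀`, `a₁`, up to a factor. -/
def zeroMap (X : Plane → Space) (q : Plane) : ℝ × ℝ := (coefZ0 X q, coefZ1 X q)

variable {B : Type*} [NormedAddCommGroup B] [NormedSpace ℝ B] {X : B → Plane → Space}
  {u : B} {q : Plane} {n : ℕ}

lemma contDiffAt_fderiv_snd {F : Type*} [NormedAddCommGroup F] [NormedSpace ℝ F]
    {X : B → Plane → F} (h : ContDiffAt ℝ (n + 1 : ℕ) (fun x : B × Plane => X x.1 x.2) (u, q)) :
    ContDiffAt ℝ n (fun x : B × Plane => fderiv ℝ (X x.1) x.2) (u, q) := by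
  refine ContDiffAt.fderiv (𝕜 := ℝ) (f := fun x : B × Plane => X x.1) (g := Prod.snd)
    (n := (n + 1 : ℕ)) ?_ contDiffAt_snd (by push_cast; exact le_rfl)
  exact ContDiffAt.comp (((u, q), q) : (B × Plane) × Plane)
    (g := fun x : B × Plane => X x.1 x.2) (f := fun y : (B × Plane) × Plane => (y.1.1, y.2)) h
    (by fun_prop)

lemma contDiffAt_zeroMap (h : ContDiffAt ℝ (n + 2 : ℕ) (fun x : B × Plane => X x.1 x.2) (u, q)) :
    ContDiffAt ℝ n (fun x : B × Plane => coefZ0 (X x.1) x.2) (u, q) ∧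
    ContDiffAt ℝ n (fun x : B × Plane => coefZ1 (X x.1) x.2) (u, q) := by
  have h1 : ContDiffAt ℝ (n + 1 : ℕ) (fun x : B × Plane => fderiv ℝ (X x.1) x.2) (u, q) :=
    contDiffAt_fderiv_snd h
  have h2 : ContDiffAt ℝ n (fun x : B × Plane => fderiv ℝ (fderiv ℝ (X x.1)) x.2) (u, q) :=
    contDiffAt_fderiv_snd (X := fun u => fderiv ℝ (X u)) h1
  have h12 : ContDiffAt ℝ n (fun x : B × Plane => (fderiv ℝ (X x.1) x.2,
      fderiv ℝ (fderiv ℝ (X x.1)) x.2)) (u, q) :=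
    (h1.of_le (by exact_mod_cast Nat.le_succ n)).prodMk h2
  constructor
  · have := ContDiff.comp_contDiffAt (g := fun J : (Plane →L[ℝ] Space) ×
      (Plane →L[ℝ] Plane →L[ℝ] Space) => jetA0 J.1 J.2) (u, q) contDiff_jetA0 h12
    have he : (fun x : B × Plane => coefZ0 (X x.1) x.2) =
      fun x => jetA0 (fderiv ℝ (X x.1) x.2) (fderiv ℝ (fderiv ℝ (X x.1)) x.2) := rfl
    rw [he]
    exact this
  · have := ContDiff.comp_contDiffAt (g := fun J : (Plane →L[ℝ] Space) ×
      (Plane →L[ℝ] Plane →L[ℝ] Space) => jetA1 J.1 J.2) (u, q) contDiff_jetA1 h12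
    have he : (fun x : B × Plane => coefZ1 (X x.1) x.2) =
      fun x => jetA1 (fderiv ℝ (X x.1) x.2) (fderiv ℝ (fderiv ℝ (X x.1)) x.2) := rfl
    rw [he]
    exact this

/-- The coefficients involve two derivatives of the surface and their differentials a third one:
this is the source of r - 3. -/
lemma contDiffAt_symbol (h : ContDiffAt ℝ (n + 3 : ℕ) (fun x : B × Plane => X x.1 x.2) (u, q)) :
    ContDiffAt ℝ n (fun x : B × Plane => symbol (X x.1) x.2) (u, q) := by
  have h1 : ContDiffAt ℝ n (fun x : B × Plane => fderiv ℝ (X x.1) x.2) (u, q) :=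
    (contDiffAt_fderiv_snd (n := n + 2) h).of_le (by exact_mod_cast Nat.le_add_right n 2)
  have h3 := contDiffAt_zeroMap (n := n + 1) h
  have hap : ∀ v : Plane, ContDiffAt ℝ n (fun x : B × Plane => fderiv ℝ (X x.1) x.2 v) (u, q) :=
    fun v => h1.clm_apply contDiffAt_const
  refine ContDiffAt.prodMk ((hap dX).inner ℝ (hap dX)) (ContDiffAt.prodMk
    ((hap dX).inner ℝ (hap dY)) (ContDiffAt.prodMk ((hap dY).inner ℝ (hap dY))
      (ContDiffAt.prodMk ?_ ?_)))
  · exact contDiffAt_fderiv_snd (X := fun u => coefZ0 (X u)) h3.1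
  · exact contDiffAt_fderiv_snd (X := fun u => coefZ1 (X u)) h3.2

lemma fderiv_comp_inr {E F : Type*} [NormedAddCommGroup E] [NormedSpace ℝ E]
    [NormedAddCommGroup F] [NormedSpace ℝ F] {f : B × E → F} {q : E}
    (hf : DifferentiableAt ℝ f (u, q)) :
    fderiv ℝ f (u, q) ∘L .inr ℝ B E = fderiv ℝ (fun y => f (u, y)) q :=
  (HasFDerivAt.comp q hf.hasFDerivAt (hasFDerivAt_prodMk_right u q)).fderiv.symm

/-- The partial derivative to be inverted for axiumbilic points consists of the two differentials of
the symbol, so the condition of the implicit function theorem is `symDet ≠ 0`. -/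
lemma fderiv_zeroMap_comp_inr
    (h : ContDiffAt ℝ 3 (fun x : B × Plane => X x.1 x.2) (u, q)) :
    fderiv ℝ (fun x : B × Plane => zeroMap (X x.1) x.2) (u, q) ∘L .inr ℝ B Plane =
      (symbol (X u) q).2.2.2.1.prod (symbol (X u) q).2.2.2.2 := by
  have h3 := contDiffAt_zeroMap (n := 1) h
  have hz : DifferentiableAt ℝ (fun x : B × Plane => zeroMap (X x.1) x.2) (u, q) :=
    (h3.1.differentiableAt (by simp)).prodMk (h3.2.differentiableAt (by simp))
  have hX : ContDiffAt ℝ 3 (X u) q :=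
    ContDiffAt.comp q (g := fun x : B × Plane => X x.1 x.2) (f := fun y : Plane => (u, y)) h
      (by fun_prop)
  rw [fderiv_comp_inr hz]
  exact ((contDiffAt_coefZ0 hX).differentiableAt (by simp)).fderiv_prodMk
    ((contDiffAt_coefZ1 hX).differentiableAt (by simp))

end Symbol

/-! ### Families of axiumbilic points and of axes -/

section AxisFamily

/-- The determinant of the differentials of a symbol. -/
def symDet (σ : Symbol) : ℝ :=
  σ.2.2.2.1 dX * σ.2.2.2.2 dY - σ.2.2.2.1 dY * σ.2.2.2.2 dX

lemma continuous_symDet : Continuous symDet := by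
  unfold symDet
  fun_prop

lemma isInvertible_of_symDet_ne_zero {σ : Symbol} (h : symDet σ ≠ 0) :
    (σ.2.2.2.1.prod σ.2.2.2.2).IsInvertible := by
  have hinj : Function.Injective (σ.2.2.2.1.prod σ.2.2.2.2 : Plane →ₗ[ℝ] ℝ × ℝ) := by
    rw [← LinearMap.ker_eq_bot, LinearMap.ker_eq_bot']
    intro v hv
    have h0 : σ.2.2.2.1 v = 0 := congrArg Prod.fst hv
    have h1 : σ.2.2.2.2 v = 0 := congrArg Prod.snd hv
    rw [plane_eq v] at h0 h1 ⊢
    simp only [map_add, map_smul, smul_eq_mul] at h0 h1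
    have e0 : v 0 = 0 := by
      refine (mul_eq_zero.1 (?_ : v 0 * symDet σ = 0)).resolve_right h
      unfold symDet
      linear_combination σ.2.2.2.2 dY * h0 - σ.2.2.2.1 dY * h1
    have e1 : v 1 = 0 := by
      refine (mul_eq_zero.1 (?_ : v 1 * symDet σ = 0)).resolve_right h
      unfold symDet
      linear_combination σ.2.2.2.1 dX * h1 - σ.2.2.2.2 dX * h0
    rw [e0, e1, zero_smul, zero_smul, add_zero]
  have hdim : Module.finrank ℝ Plane = Module.finrank ℝ (ℝ × ℝ) := by simp
  refine ⟨(LinearMap.linearEquivOfInjective _ hinj hdim).toContinuousLinearEquiv, ?_⟩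
  ext v <;> rfl

/-- The value of the quintic form of a symbol at the direction `v + t w`. -/
def quintic (v w : Plane) (x : Symbol × ℝ) : ℝ :=
  symTensor x.1 (v + x.2 • w) (v + x.2 • w)

lemma contDiff_quintic (v w : Plane) {n : WithTop ℕ∞} : ContDiff ℝ n (quintic v w) :=
  ContDiff.comp (g := fun x : Symbol × Plane × Plane => symTensor x.1 x.2.1 x.2.2)
    (f := fun x : Symbol × ℝ => (x.1, v + x.2 • w, v + x.2 • w)) contDiff_symTensor (by fun_prop)

/-- The derivative of the quintic form along the line of directions `v + t w`. -/
def quinticDeriv (v w : Plane) (x : Symbol × ℝ) : ℝ := fderiv ℝ (quintic v w) x (0, 1)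

lemma continuous_quinticDeriv (v w : Plane) : Continuous (quinticDeriv v w) :=
  ((contDiff_quintic v w (n := 1)).continuous_fderiv (by simp)).clm_apply continuous_const

lemma hasDerivAt_quintic (v w : Plane) (σ : Symbol) (t : ℝ) :
    HasDerivAt (fun t => quintic v w (σ, t)) (quinticDeriv v w (σ, t)) t :=
  HasFDerivAt.comp_hasDerivAt t (((contDiff_quintic v w (n := 1)).differentiable (by simp)
    (σ, t)).hasFDerivAt) ((hasDerivAt_const t σ).prodMk (hasDerivAt_id t))

lemma isInvertible_of_apply_one_ne_zero {L : ℝ →L[ℝ] ℝ} (h : L 1 ≠ 0) : L.IsInvertible :=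
  ⟨ContinuousLinearEquiv.unitsEquivAut ℝ (Units.mk0 (L 1) h), by ext; simp⟩

variable {B : Type*} [NormedAddCommGroup B] [NormedSpace ℝ B]
  {X : B → Plane → Space} {u : B} {n : ℕ} {q : B → Plane} {s : B → ℝ} {v w : Plane}

lemma isInvertible_quintic {σ : B → Symbol} (hσ : ContDiffAt ℝ 1 σ u) {t : ℝ}
    (h : quinticDeriv v w (σ u, t) ≠ 0) :
    (fderiv ℝ (fun x : B × ℝ => quintic v w (σ x.1, x.2)) (u, t) ∘L .inr ℝ B ℝ).IsInvertible := by
  have hf : DifferentiableAt ℝ (fun x : B × ℝ => quintic v w (σ x.1, x.2)) (u, t) := by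
    refine DifferentiableAt.comp (u, t) (g := quintic v w)
      ((contDiff_quintic v w (n := 1)).differentiable (by simp) _) ?_
    exact ((hσ.differentiableAt (by simp)).comp (u, t) differentiableAt_fst).prodMk
      differentiableAt_snd
  rw [fderiv_comp_inr hf]
  refine isInvertible_of_apply_one_ne_zero ?_
  rw [(hasDerivAt_quintic v w (σ u) t).hasFDerivAt.fderiv]
  simpa using h

lemma contDiffAt_quintic {σ : B → Symbol} {m : WithTop ℕ∞} (hσ : ContDiffAt ℝ m σ u) (t : ℝ) :
    ContDiffAt ℝ m (fun x : B × ℝ => quintic v w (σ x.1, x.2)) (u, t) :=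
  ContDiff.comp_contDiffAt (g := quintic v w) (f := fun x : B × ℝ => (σ x.1, x.2)) (u, t)
    (contDiff_quintic v w)
    ((ContDiffAt.comp (u, t) (g := σ) (f := Prod.fst) hσ contDiffAt_fst).prodMk contDiffAt_snd)

variable [CompleteSpace B]

/-- A continuous family of zeros of `a₀`, `a₁` is smooth, and so are the symbols there. -/
lemma contDiffAt_symbol_zero (hn : n ≠ 0)
    (hX : ContDiffAt ℝ (n + 3 : ℕ) (fun x : B × Plane => X x.1 x.2) (u, q u))
    (hq : ContinuousAt q u) (hz : ∀ᶠ y in 𝓝 u, zeroMap (X y) (q y) = 0)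
    (hdet : symDet (symbol (X u) (q u)) ≠ 0) :
    ContDiffAt ℝ n (fun y => symbol (X y) (q y)) u := by
  have hz' := contDiffAt_zeroMap (n := n + 1) hX
  have hle : ((n : ℕ) : WithTop ℕ∞) ≤ ((n + 1 : ℕ) : WithTop ℕ∞) := by
    exact_mod_cast Nat.le_succ n
  have hzn : ContDiffAt ℝ n (fun x : B × Plane => zeroMap (X x.1) x.2) (u, q u) :=
    (hz'.1.of_le hle).prodMk (hz'.2.of_le hle)
  have hqn : ContDiffAt ℝ n q u := by
    refine contDiffAt_of_implicit (by exact_mod_cast hn) hzn hq ?_ hz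
    rw [fderiv_zeroMap_comp_inr (hX.of_le (by exact_mod_cast Nat.le_add_left 3 n))]
    exact isInvertible_of_symDet_ne_zero hdet
  exact ContDiffAt.comp u (g := fun x : B × Plane => symbol (X x.1) x.2)
    (f := fun y => (y, q y)) (contDiffAt_symbol hX) (contDiffAt_id.prodMk hqn)

/-- Continuous families of axiumbilic points and of axes there have smooth coefficients. -/
lemma contDiffAt_symAB_zero (hn : n ≠ 0)
    (hX : ContDiffAt ℝ (n + 3 : ℕ) (fun x : B × Plane => X x.1 x.2) (u, q u))
    (hq : ContinuousAt q u) (hz : ∀ᶠ y in 𝓝 u, zeroMap (X y) (q y) = 0)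
    (hdet : symDet (symbol (X u) (q u)) ≠ 0) (hs : ContinuousAt s u)
    (hg : ∀ᶠ y in 𝓝 u, quintic v w (symbol (X y) (q y), s y) = 0)
    (hgs : quinticDeriv v w (symbol (X u) (q u), s u) ≠ 0)
    (harea : 0 < symArea (symbol (X u) (q u)))
    (hden : symTensor (symbol (X u) (q u)) (symPerp (symbol (X u) (q u)) (v + s u • w))
      (v + s u • w) ≠ 0) :
    ContDiffAt ℝ n (fun y => (symA (symbol (X y) (q y)) (v + s y • w),
      symB (symbol (X y) (q y)) (v + s y • w))) u := by
  have hσ := contDiffAt_symbol_zero hn hX hq hz hdet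
  have hsn : ContDiffAt ℝ n s u := by
    refine contDiffAt_of_implicit (by exact_mod_cast hn)
      (contDiffAt_quintic (v := v) (w := w) hσ (s u)) hs ?_ hg
    exact isInvertible_quintic (hσ.of_le (by exact_mod_cast Nat.one_le_iff_ne_zero.2 hn)) hgs
  exact ContDiffAt.comp u (g := fun x : Symbol × Plane => (symA x.1 x.2, symB x.1 x.2))
    (f := fun y => (symbol (X y) (q y), v + s y • w)) (contDiffAt_symAB harea hden)
    (hσ.prodMk (contDiffAt_const.add (hsn.smul contDiffAt_const)))

/-- A nondegenerate zero of `a₀`, `a₁` and a simple axis there persist. -/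
lemma exists_axis_family {u₀ : B} {x₀ : Plane} {ε : ℝ} (hε : 0 < ε)
    (hX : ∀ y, ∀ z ∈ Metric.ball x₀ ε, ContDiffAt ℝ 5 (fun x : B × Plane => X x.1 x.2) (y, z))
    (hz : zeroMap (X u₀) x₀ = 0) (hdet : symDet (symbol (X u₀) x₀) ≠ 0)
    (harea : 0 < symArea (symbol (X u₀) x₀)) (hv : v ≠ 0)
    (hg : quintic v w (symbol (X u₀) x₀, 0) = 0)
    (hgs : quinticDeriv v w (symbol (X u₀) x₀, 0) ≠ 0)
    (hden : symTensor (symbol (X u₀) x₀) (symPerp (symbol (X u₀) x₀) v) v ≠ 0)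
    {C : Set (ℝ × ℝ)} (hC : IsOpen C)
    (hAB : (symA (symbol (X u₀) x₀) v, symB (symbol (X u₀) x₀) v) ∈ C) :
    ∃ (q : B → Plane) (s : B → ℝ) (V : Set Plane) (V' : Set ℝ) (U : Set B),
      V ⊆ Metric.ball x₀ ε ∧ IsOpen V ∧ x₀ ∈ V ∧ (0 : ℝ) ∈ V' ∧ IsOpen U ∧ u₀ ∈ U ∧
      ∀ y ∈ U, ContinuousAt q y ∧ ContinuousAt s y ∧ q y ∈ V ∧ s y ∈ V' ∧
        (∀ z ∈ V, zeroMap (X y) z = 0 ↔ z = q y) ∧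
        (∀ t ∈ V', quintic v w (symbol (X y) (q y), t) = 0 ↔ t = s y) ∧
        symDet (symbol (X y) (q y)) ≠ 0 ∧ 0 < symArea (symbol (X y) (q y)) ∧
        v + s y • w ≠ 0 ∧ quinticDeriv v w (symbol (X y) (q y), s y) ≠ 0 ∧
        symTensor (symbol (X y) (q y)) (symPerp (symbol (X y) (q y)) (v + s y • w))
          (v + s y • w) ≠ 0 ∧
        (symA (symbol (X y) (q y)) (v + s y • w),
          symB (symbol (X y) (q y)) (v + s y • w)) ∈ C := by
  have hx₀ : x₀ ∈ Metric.ball x₀ ε := Metric.mem_ball_self hε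
  have hX₀ := hX u₀ x₀ hx₀
  have hz' := contDiffAt_zeroMap (n := 3) hX₀
  have hz1 : ContDiffAt ℝ 1 (fun x : B × Plane => zeroMap (X x.1) x.2) (u₀, x₀) :=
    (hz'.1.of_le (by norm_num)).prodMk (hz'.2.of_le (by norm_num))
  -- The first implicit equation is for the point; the second, below, is for the slope of the axis
  -- at this point and has a simple root. Both uniqueness statements are kept, to identify the
  -- solutions later.
  obtain ⟨q, hq0, V, hVs, hVo, hxV, U₁, hU₁, hu₁, hqc, hqU⟩ := exists_implicit hz1 (by
      rw [fderiv_zeroMap_comp_inr (hX₀.of_le (by norm_num))]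
      exact isInvertible_of_symDet_ne_zero hdet) hz (Metric.isOpen_ball.mem_nhds hx₀)
  have hqc' : ∀ y ∈ U₁, ContinuousAt q y := fun y hy => hqc.continuousAt (hU₁.mem_nhds hy)
  have hσ : ContDiffAt ℝ 2 (fun y => symbol (X y) (q y)) u₀ := by
    refine contDiffAt_symbol_zero (n := 2) (by norm_num) (by rw [hq0]; exact hX₀) (hqc' _ hu₁) ?_
      (by rwa [hq0])
    filter_upwards [hU₁.mem_nhds hu₁] with y hy
    exact ((hqU y hy).2 _ (hqU y hy).1).2 rfl
  have hσ1 : ContDiffAt ℝ 1 (fun y => symbol (X y) (q y)) u₀ := hσ.of_le (by norm_num)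
  obtain ⟨s, hs0, V', -, hV'o, h0V', U₂, hU₂, hu₂, hsc, hsU⟩ :=
    exists_implicit (contDiffAt_quintic (v := v) (w := w) hσ1 0)
      (isInvertible_quintic hσ1 (by rwa [hq0])) (by simpa only [hq0] using hg) univ_mem
  have hsc' : ∀ y ∈ U₂, ContinuousAt s y := fun y hy => hsc.continuousAt (hU₂.mem_nhds hy)
  have cσ : ContinuousAt (fun y => symbol (X y) (q y)) u₀ := hσ.continuousAt
  have cs : ContinuousAt s u₀ := hsc' _ hu₂
  have cw : ContinuousAt (fun y => v + s y • w) u₀ := by fun_prop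
  have hw0 : v + s u₀ • w = v := by rw [hs0, zero_smul, add_zero]
  have e1 : ∀ᶠ y in 𝓝 u₀, symDet (symbol (X y) (q y)) ≠ 0 :=
    (continuous_symDet.continuousAt.comp cσ).eventually_ne (by simpa [hq0] using hdet)
  have e2 : ∀ᶠ y in 𝓝 u₀, 0 < symArea (symbol (X y) (q y)) :=
    ((contDiff_symArea (n := 0)).continuous.continuousAt.comp cσ).eventually_const_lt
      (by simpa [hq0] using harea)
  have e3 : ∀ᶠ y in 𝓝 u₀, v + s y • w ≠ 0 := cw.eventually_ne (by rwa [hw0])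
  have e4 : ∀ᶠ y in 𝓝 u₀, quinticDeriv v w (symbol (X y) (q y), s y) ≠ 0 :=
    ContinuousAt.eventually_ne (ContinuousAt.comp (g := quinticDeriv v w)
      (f := fun y => (symbol (X y) (q y), s y))
      (continuous_quinticDeriv v w).continuousAt (cσ.prodMk cs)) (by simpa [hq0, hs0] using hgs)
  have cp : ContinuousAt (fun y => symPerp (symbol (X y) (q y)) (v + s y • w)) u₀ :=
    ContinuousAt.comp (g := fun x : Symbol × Plane => symPerp x.1 x.2)
      (f := fun y => (symbol (X y) (q y), v + s y • w))
      (contDiffAt_symPerp (n := 0) (by rwa [hq0]) _).continuousAt (cσ.prodMk cw)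
  have hden' : symTensor (symbol (X u₀) (q u₀)) (symPerp (symbol (X u₀) (q u₀)) (v + s u₀ • w))
      (v + s u₀ • w) ≠ 0 := by rwa [hw0, hq0]
  have e5 : ∀ᶠ y in 𝓝 u₀, symTensor (symbol (X y) (q y))
      (symPerp (symbol (X y) (q y)) (v + s y • w)) (v + s y • w) ≠ 0 :=
    ContinuousAt.eventually_ne (ContinuousAt.comp (g := fun x : Symbol × Plane × Plane =>
      symTensor x.1 x.2.1 x.2.2) (f := fun y => (symbol (X y) (q y),
        symPerp (symbol (X y) (q y)) (v + s y • w), v + s y • w))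
      (contDiff_symTensor (n := 0)).continuous.continuousAt (cσ.prodMk (cp.prodMk cw))) hden'
  have cAB : ContinuousAt (fun y => (symA (symbol (X y) (q y)) (v + s y • w),
      symB (symbol (X y) (q y)) (v + s y • w))) u₀ :=
    ContinuousAt.comp (g := fun x : Symbol × Plane => (symA x.1 x.2, symB x.1 x.2))
      (f := fun y => (symbol (X y) (q y), v + s y • w))
      (contDiffAt_symAB (n := 0) (by rwa [hq0]) hden').continuousAt (cσ.prodMk cw)
  have e6 := cAB.eventually_mem (hC.mem_nhds (by simp only [hq0, hw0]; exact hAB))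
  obtain ⟨U, hUs, hU, hu⟩ := eventually_nhds_iff.1
    ((hU₁.eventually_mem hu₁).and ((hU₂.eventually_mem hu₂).and
      (e1.and (e2.and (e3.and (e4.and (e5.and e6)))))))
  refine ⟨q, s, V, V', U, hVs, hVo, hxV, h0V', hU, hu, fun y hy => ?_⟩
  obtain ⟨y1, y2, y3⟩ := hUs y hy
  exact ⟨hqc' y y1, hsc' y y2, (hqU y y1).1, (hsU y y2).1, (hqU y y1).2, (hsU y y2).2, y3⟩

end AxisFamily

/-! ### The inner product of normal components as a degenerate bilinear form -/

section NormalInner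

variable (P : Plane →L[ℝ] Space)

lemma normalInner_add_left (x y z : Space) :
    normalInner P (x + y) z = normalInner P x z + normalInner P y z := by
  unfold normalInner
  simp only [inner_add_left]
  ring

lemma normalInner_smul_left (c : ℝ) (x z : Space) :
    normalInner P (c • x) z = c * normalInner P x z := by
  unfold normalInner
  simp only [real_inner_smul_left]
  ring

lemma normalInner_comm (x y : Space) : normalInner P x y = normalInner P y x := by
  unfold normalInner
  rw [real_inner_comm y x]
  ring

lemma normalInner_add_right (x y z : Space) :
    normalInner P x (y + z) = normalInner P x y + normalInner P x z := by
  rw [normalInner_comm, normalInner_add_left, normalInner_comm P y, normalInner_comm P z]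

lemma normalInner_smul_right (c : ℝ) (x z : Space) :
    normalInner P x (c • z) = c * normalInner P x z := by
  rw [normalInner_comm, normalInner_smul_left, normalInner_comm P z]

lemma normalInner_sub_left (x y z : Space) :
    normalInner P (x - y) z = normalInner P x z - normalInner P y z := by
  rw [sub_eq_add_neg, ← neg_one_smul ℝ, normalInner_add_left, normalInner_smul_left]
  ring

lemma normalInner_sub_right (x y z : Space) :
    normalInner P x (y - z) = normalInner P x y - normalInner P x z := by
  rw [normalInner_comm, normalInner_sub_left, normalInner_comm P y, normalInner_comm P z]

variable {P}

/-- `P` is its own differential, so the identity for surfaces applies to the surface `P` and gives a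
nonnegative multiple of a squared length. -/
lemma normalInner_self_nonneg (hP : 0 < jetArea P) (x : Space) : 0 ≤ normalInner P x x := by
  have h := area_mul_inner_normal P 0 x x
  rw [← jetArea_fderiv, P.fderiv] at h
  rw [← h]
  exact mul_nonneg hP.le real_inner_self_nonneg

end NormalInner

/-! ### The quartic form of a 2-jet in a conformal frame -/

section SymForm

/-- The symmetric bilinear form with the coefficients of the second derivative `B`. -/
def symForm (B : Plane →L[ℝ] Plane →L[ℝ] Space) (v w : Plane) : Space :=
  (v 0 * w 0) • B dX dX + (v 0 * w 1 + v 1 * w 0) • B dX dY + (v 1 * w 1) • B dY dY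

variable (B : Plane →L[ℝ] Plane →L[ℝ] Space)

lemma symForm_add_left (u v w : Plane) : symForm B (u + v) w = symForm B u w + symForm B v w := by
  simp only [symForm, PiLp.add_apply]
  module

lemma symForm_smul_left (c : ℝ) (v w : Plane) : symForm B (c • v) w = c • symForm B v w := by
  simp only [symForm, PiLp.smul_apply, smul_eq_mul]
  module

lemma symForm_comm (v w : Plane) : symForm B v w = symForm B w v := by
  simp only [symForm]
  module

lemma symForm_add_right (u v w : Plane) : symForm B u (v + w) = symForm B u v + symForm B u w := by
  rw [symForm_comm, symForm_add_left, symForm_comm B v, symForm_comm B w]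

lemma symForm_smul_right (c : ℝ) (v w : Plane) : symForm B v (c • w) = c • symForm B v w := by
  rw [symForm_comm, symForm_smul_left, symForm_comm B w]

/-- The coefficients of the first fundamental form. -/
def jetE (P : Plane →L[ℝ] Space) : ℝ := inner ℝ (P dX) (P dX)

/-- The coefficients of the first fundamental form. -/
def jetF (P : Plane →L[ℝ] Space) : ℝ := inner ℝ (P dX) (P dY)

/-- The coefficients of the first fundamental form. -/
def jetG (P : Plane →L[ℝ] Space) : ℝ := inner ℝ (P dY) (P dY)

/-- The rotation by a right angle, scaled by the area element. -/
def jetRot (P : Plane →L[ℝ] Space) (v : Plane) : Plane := rot (jetE P) (jetF P) (jetG P) v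

variable {B} (P : Plane →L[ℝ] Space)

/-- The analogue of `axialForm_eq` for arbitrary 2-jets: the full second derivative replaces its
normal part, because `normalInner` ignores tangential components. -/
lemma quart_jet_eq (v : Plane) :
    quart (jetE P) (jetF P) (jetG P) (jetA0 P B) (jetA1 P B) (v 0) (v 1) =
      -4 * jetE P ^ 3 * normalInner P
        (jetArea P • symForm B v v - symForm B (jetRot P v) (jetRot P v))
        (symForm B v (jetRot P v)) := by
  have hA : jetArea P = jetE P * jetG P - jetF P ^ 2 := rfl
  have h0 : jetRot P v 0 = -(jetF P * v 0 + jetG P * v 1) := rfl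
  have h1 : jetRot P v 1 = jetE P * v 0 + jetF P * v 1 := rfl
  simp only [symForm, h0, h1, normalInner_add_left, normalInner_add_right, normalInner_sub_left,
    normalInner_smul_left, normalInner_smul_right, smul_add]
  rw [normalInner_comm P (B dX dY) (B dX dX), normalInner_comm P (B dY dY) (B dX dX),
    normalInner_comm P (B dY dY) (B dX dY)]
  simp only [jetA0, jetA1, quart, hA, jetE, jetF, jetG]
  ring

lemma perp_eq (v : Plane) :
    perp (jetE P) (jetF P) (jetG P) v = (√(jetArea P))⁻¹ • jetRot P v := rfl

variable {P}

lemma jetRot_frame (hP : 0 < jetArea P) (v : Plane) (x y : ℝ) :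
    jetRot P (x • v + y • perp (jetE P) (jetF P) (jetG P) v) =
      √(jetArea P) • (x • perp (jetE P) (jetF P) (jetG P) v - y • v) := by
  have hs : √(jetArea P) ≠ 0 := (Real.sqrt_pos.2 hP).ne'
  have hs2 : √(jetArea P) * √(jetArea P) = jetE P * jetG P - jetF P ^ 2 :=
    Real.mul_self_sqrt hP.le
  rw [perp_eq]
  ext i
  fin_cases i
  · simp [jetRot, rot]
    field_simp
    linear_combination (y * v 0) * hs2
  · simp [jetRot, rot]
    field_simp
    linear_combination (y * v 1) * hs2

/-- The quartic form in a conformal frame. -/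
lemma quart_jet_frame (hP : 0 < jetArea P) (v : Plane) (x y : ℝ) :
    let w := perp (jetE P) (jetF P) (jetG P) v
    let D := symForm B v v - symForm B w w
    let N := symForm B v w
    quart (jetE P) (jetF P) (jetG P) (jetA0 P B) (jetA1 P B) ((x • v + y • w) 0)
      ((x • v + y • w) 1) = -4 * jetE P ^ 3 * √(jetArea P) ^ 3 *
        (h1 x y * normalInner P D N
          + h2 x y * (4 * normalInner P N N - normalInner P D D)) := by
  intro w D N
  have hs2 : √(jetArea P) ^ 2 = jetArea P := Real.sq_sqrt hP.le
  have hsub : x • perp (jetE P) (jetF P) (jetG P) v - y • v = x • w + (-y) • v := by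
    rw [neg_smul, sub_eq_add_neg]
  rw [quart_jet_eq, jetRot_frame hP, hsub]
  clear_value w
  generalize √(jetArea P) = S at hs2 ⊢
  rw [← hs2]
  simp only [D, N, symForm_add_left, symForm_add_right, symForm_smul_left, symForm_smul_right,
    normalInner_add_left, normalInner_add_right, normalInner_sub_left, normalInner_sub_right,
    normalInner_smul_left, normalInner_smul_right, smul_add, symForm_comm B w v]
  rw [normalInner_comm P (symForm B v w) (symForm B v v),
    normalInner_comm P (symForm B w w) (symForm B v v),
    normalInner_comm P (symForm B w w) (symForm B v w)]
  unfold h1 h2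
  ring

end SymForm

/-! ### The curvature ellipse is not a point -/

section Nondegenerate

/-- The two normal vectors whose inner product is the quartic form, up to a factor. -/
def jetFirst (v : Plane) (J : (Plane →L[ℝ] Space) × (Plane →L[ℝ] Plane →L[ℝ] Space)) : Space :=
  jetArea J.1 • symForm J.2 v v - symForm J.2 (jetRot J.1 v) (jetRot J.1 v)

/-- The two normal vectors whose inner product is the quartic form, up to a factor. -/
def jetSecond (v : Plane) (J : (Plane →L[ℝ] Space) × (Plane →L[ℝ] Plane →L[ℝ] Space)) : Space :=
  symForm J.2 v (jetRot J.1 v)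

lemma contDiff_jetFirst (v : Plane) {n : WithTop ℕ∞} : ContDiff ℝ n (jetFirst v) := by
  have h0 : ∀ P, jetRot P v 0 = -(jetF P * v 0 + jetG P * v 1) := fun _ => rfl
  have h1 : ∀ P, jetRot P v 1 = jetE P * v 0 + jetF P * v 1 := fun _ => rfl
  unfold jetFirst
  simp only [symForm, h0, h1, jetE, jetF, jetG, jetArea]
  fun_prop

lemma contDiff_jetSecond (v : Plane) {n : WithTop ℕ∞} : ContDiff ℝ n (jetSecond v) := by
  have h0 : ∀ P, jetRot P v 0 = -(jetF P * v 0 + jetG P * v 1) := fun _ => rfl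
  have h1 : ∀ P, jetRot P v 1 = jetE P * v 0 + jetF P * v 1 := fun _ => rfl
  unfold jetSecond
  simp only [symForm, h0, h1, jetE, jetF, jetG]
  fun_prop

lemma contDiff_normalInner_self {n : WithTop ℕ∞}
    {f : (Plane →L[ℝ] Space) × (Plane →L[ℝ] Plane →L[ℝ] Space) → Space} (hf : ContDiff ℝ n f) :
    ContDiff ℝ n (fun J => normalInner J.1 (f J) (f J)) := by
  unfold normalInner jetArea
  fun_prop

/-- The jet of second order of a parametrized surface. -/
def jet2 (X : Plane → Space) (q : Plane) :
    (Plane →L[ℝ] Space) × (Plane →L[ℝ] Plane →L[ℝ] Space) :=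
  (fderiv ℝ X q, fderiv ℝ (fderiv ℝ X) q)

lemma contDiffAt_jet2 {X : Plane → Space} {q : Plane} (hX : ContDiffAt ℝ 3 X q) :
    ContDiffAt ℝ 1 (jet2 X) q := by
  have h1 : ContDiffAt ℝ 2 (fderiv ℝ X) q := hX.fderiv_right (by norm_num)
  exact (h1.of_le (by norm_num)).prodMk (h1.fderiv_right (by norm_num))

/-- A zero of a nonnegative function is a local minimum. This replaces the product rule for
`normalInner`, where a zero square does not mean a zero vector but only a zero normal component. -/
lemma hasFDerivAt_zero_of_nonneg {X : Plane → Space} {q : Plane} (hX : ContDiffAt ℝ 3 X q)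
    (harea : 0 < jetArea (fderiv ℝ X q))
    {g : (Plane →L[ℝ] Space) × (Plane →L[ℝ] Plane →L[ℝ] Space) → ℝ} (hg : ContDiff ℝ 1 g)
    (hpos : ∀ J, 0 < jetArea J.1 → 0 ≤ g J) (h0 : g (jet2 X q) = 0) :
    HasFDerivAt (fun y => g (jet2 X y)) (0 : Plane →L[ℝ] ℝ) q := by
  have hJ := contDiffAt_jet2 hX
  have hd : DifferentiableAt ℝ (fun y => g (jet2 X y)) q :=
    (ContDiff.comp_contDiffAt q hg hJ).differentiableAt (by simp)
  have hc : ContinuousAt (fun y => jetArea (jet2 X y).1) q :=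
    (contDiff_jetArea (n := 0)).continuous.continuousAt.comp
      (continuousAt_fst.comp hJ.continuousAt)
  have hmin : IsLocalMin (fun y => g (jet2 X y)) q := by
    filter_upwards [hc.eventually_const_lt harea] with y hy
    rw [h0]
    exact hpos _ hy
  have := hd.hasFDerivAt
  rwa [hmin.fderiv_eq_zero] at this

/-- The quadratic forms of normal vectors have critical points at their zeros. -/
lemma hasFDerivAt_normalInner_self {X : Plane → Space} {q : Plane} (hX : ContDiffAt ℝ 3 X q)
    (harea : 0 < jetArea (fderiv ℝ X q))
    {f : (Plane →L[ℝ] Space) × (Plane →L[ℝ] Plane →L[ℝ] Space) → Space} (hf : ContDiff ℝ 1 f)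
    (h0 : normalInner (fderiv ℝ X q) (f (jet2 X q)) (f (jet2 X q)) = 0) :
    HasFDerivAt (fun y => normalInner (jet2 X y).1 (f (jet2 X y)) (f (jet2 X y)))
      (0 : Plane →L[ℝ] ℝ) q :=
  hasFDerivAt_zero_of_nonneg hX harea (contDiff_normalInner_self hf)
    (fun _ hJ => normalInner_self_nonneg hJ _) h0

lemma jetE_ne_zero {P : Plane →L[ℝ] Space} (hP : 0 < jetArea P) : jetE P ≠ 0 := by
  intro h
  have hA : jetArea P = jetE P * jetG P - jetF P ^ 2 := rfl
  rw [hA, h] at hP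
  nlinarith [sq_nonneg (jetF P)]

/-- The difference of the second derivatives in the two directions of a conformal frame. -/
def frameDiff (X : Plane → Space) (q v : Plane) : Space :=
  symForm (fderiv ℝ (fderiv ℝ X) q) v v -
    symForm (fderiv ℝ (fderiv ℝ X) q) (symPerp (symbol X q) v) (symPerp (symbol X q) v)

/-- The mixed second derivative in a conformal frame. -/
def frameMixed (X : Plane → Space) (q v : Plane) : Space :=
  symForm (fderiv ℝ (fderiv ℝ X) q) v (symPerp (symbol X q) v)

/-- In a unit frame the radius vectors of the curvature ellipse are cos 2θ·D/2 + sin 2θ·N, with the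
normal parts of `frameDiff` as D and of `frameMixed` as N. The ellipse is a circle exactly if D/2
and N are orthogonal of equal length. -/
lemma normalInner_frame_eq_zero {X : Plane → Space} {q : Plane}
    (harea : 0 < jetArea (fderiv ℝ X q)) (hz : zeroMap X q = 0) (v : Plane) :
    normalInner (fderiv ℝ X q) (frameDiff X q v) (frameMixed X q v) = 0 ∧
    4 * normalInner (fderiv ℝ X q) (frameMixed X q v) (frameMixed X q v) =
      normalInner (fderiv ℝ X q) (frameDiff X q v) (frameDiff X q v) := by
  have z0 : jetA0 (fderiv ℝ X q) (fderiv ℝ (fderiv ℝ X) q) = 0 := congrArg Prod.fst hz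
  have z1 : jetA1 (fderiv ℝ X q) (fderiv ℝ (fderiv ℝ X) q) = 0 := congrArg Prod.snd hz
  have hne : -4 * jetE (fderiv ℝ X q) ^ 3 * √(jetArea (fderiv ℝ X q)) ^ 3 ≠ 0 :=
    mul_ne_zero (mul_ne_zero (by norm_num) (pow_ne_zero _ (jetE_ne_zero harea)))
      (pow_ne_zero _ (Real.sqrt_pos.2 harea).ne')
  have key : ∀ x y : ℝ, h1 x y * normalInner (fderiv ℝ X q) (frameDiff X q v) (frameMixed X q v)
      + h2 x y * (4 * normalInner (fderiv ℝ X q) (frameMixed X q v) (frameMixed X q v)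
        - normalInner (fderiv ℝ X q) (frameDiff X q v) (frameDiff X q v)) = 0 := by
    intro x y
    have := quart_jet_frame (B := fderiv ℝ (fderiv ℝ X) q) harea v x y
    dsimp only at this
    have hq0 : ∀ a b c d e : ℝ, quart a b c 0 0 d e = 0 := by intros; unfold quart; ring
    rw [z0, z1, hq0] at this
    exact (mul_eq_zero.1 this.symm).resolve_left hne
  have k1 := key 1 0
  have k2 := key 2 1
  norm_num [h1, h2] at k1 k2
  refine ⟨k1, ?_⟩
  rw [k1] at k2
  linarith

/-- The curvature ellipse does not reduce to a point where the differential is nondegenerate. -/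
lemma normalInner_frameDiff_ne_zero {X : Plane → Space} {q : Plane} (hX : ContDiffAt ℝ 3 X q)
    (hz : zeroMap X q = 0) (harea : 0 < jetArea (fderiv ℝ X q)) {v w : Plane}
    (hne : symTensor (symbol X q) w v ≠ 0) :
    normalInner (fderiv ℝ X q) (frameDiff X q v) (frameDiff X q v) ≠ 0 := by
  intro hD
  obtain ⟨hDM, hM⟩ := normalInner_frame_eq_zero harea hz v
  rw [hD] at hM
  have hM : normalInner (fderiv ℝ X q) (frameMixed X q v) (frameMixed X q v) = 0 := by linarith
  have hs2 : √(jetArea (fderiv ℝ X q)) ^ 2 = jetArea (fderiv ℝ X q) := Real.sq_sqrt harea.le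
  have hrot : jetRot (fderiv ℝ X q) v =
      √(jetArea (fderiv ℝ X q)) • symPerp (symbol X q) v := by
    have := jetRot_frame harea v 1 0
    simp only [one_smul, zero_smul, add_zero, sub_zero] at this
    exact this
  have hfirst : jetFirst v (jet2 X q) = jetArea (fderiv ℝ X q) • frameDiff X q v := by
    unfold jetFirst jet2 frameDiff
    simp only [hrot, symForm_smul_left, symForm_smul_right, smul_smul, smul_sub, ← sq, hs2]
  have hsecond : jetSecond v (jet2 X q) = √(jetArea (fderiv ℝ X q)) • frameMixed X q v := by
    unfold jetSecond jet2 frameMixed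
    simp only [hrot, symForm_smul_right]
  have c1 := contDiff_jetFirst v (n := 1)
  have c2 := contDiff_jetSecond v (n := 1)
  -- If the ellipse were a point, both normal vectors would have zero normal part at `q`. Their
  -- squares and the square of their sum then have zero differential, hence by polarization so does
  -- their product, which is the quartic form at `v` up to a factor. This contradicts `hne`.
  have d1 := hasFDerivAt_normalInner_self hX harea c1 (by
    rw [hfirst, normalInner_smul_left, normalInner_smul_right, hD]; ring)
  have d2 := hasFDerivAt_normalInner_self hX harea c2 (by
    rw [hsecond, normalInner_smul_left, normalInner_smul_right, hM]; ring)
  have d3 := hasFDerivAt_normalInner_self hX harea (c1.add c2) (by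
    simp only [hfirst, hsecond, normalInner_add_left, normalInner_add_right,
      normalInner_smul_left, normalInner_smul_right, hD, hM, hDM,
      normalInner_comm _ (frameMixed X q v) (frameDiff X q v)]
    ring)
  have d4 : HasFDerivAt (fun y => normalInner (jet2 X y).1 (jetFirst v (jet2 X y))
      (jetSecond v (jet2 X y))) (0 : Plane →L[ℝ] ℝ) q := by
    have := ((d3.sub d1).sub d2).const_mul (1 / 2)
    simp only [sub_zero, smul_zero] at this
    refine this.congr_of_eventuallyEq (Eventually.of_forall fun y => ?_)
    simp only [Pi.sub_apply, normalInner_add_left, normalInner_add_right]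
    rw [normalInner_comm _ (jetSecond v (jet2 X y)) (jetFirst v (jet2 X y))]
    ring
  have hJ := contDiffAt_jet2 hX
  have hap : ∀ a : Plane, ContinuousAt (fun y => fderiv ℝ X y a) q := fun a =>
    ContinuousAt.clm_apply (continuousAt_fst.comp hJ.continuousAt) continuousAt_const
  have cE : ContinuousAt (coefE X) q := (hap dX).inner (hap dX)
  have cF : ContinuousAt (coefF X) q := (hap dX).inner (hap dY)
  have cG : ContinuousAt (coefG X) q := (hap dY).inner (hap dY)
  have cQ : ∀ a b : ℝ, ContinuousAt (fun y => quart (coefE X y) (coefF X y) (coefG X y) a b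
      (v 0) (v 1)) q := by
    intro a b
    unfold quart
    fun_prop
  have hnormal : normalInner (fderiv ℝ X q) (jetFirst v (jet2 X q)) (jetSecond v (jet2 X q)) = 0 := by
    rw [hfirst, hsecond, normalInner_smul_left, normalInner_smul_right, hDM]; ring
  have f1 := hasFDerivAt_mul_of_eq_zero d4 hnormal
    (g := fun y => -4 * coefE X y ^ 3) (by fun_prop)
  have a0 := hasFDerivAt_mul_of_eq_zero
    ((contDiffAt_coefZ0 hX).differentiableAt (by simp)).hasFDerivAt (congrArg Prod.fst hz) (cQ 1 0)
  have a1 := hasFDerivAt_mul_of_eq_zero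
    ((contDiffAt_coefZ1 hX).differentiableAt (by simp)).hasFDerivAt (congrArg Prod.snd hz) (cQ 0 1)
  have f2 := f1.congr_of_eventuallyEq (f₁ := fun y =>
      quart (coefE X y) (coefF X y) (coefG X y) 1 0 (v 0) (v 1) * coefZ0 X y +
      quart (coefE X y) (coefF X y) (coefG X y) 0 1 (v 0) (v 1) * coefZ1 X y)
    (Eventually.of_forall fun y => by
      have := quart_jet_eq (B := fderiv ℝ (fderiv ℝ X) y) (fderiv ℝ X y) v
      rw [quart_eq_linear] at this
      exact this)
  have hu := congrArg (fun L : Plane →L[ℝ] ℝ => L w) ((a0.add a1).unique f2)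
  refine hne ?_
  unfold symTensor axialTensor symbol
  rw [quart_eq_linear]
  simpa using hu

end Nondegenerate

/-! ### Cubic perturbations of a surface -/

section Perturbation

variable {X Y : Plane → Space} {q : Plane} {ℓ : Plane →L[ℝ] ℝ} {n : Space} {t : ℝ}

/-- The cubic map `ℓ³ / 6 n` centred at `q`. -/
def cubicMap (ℓ : Plane →L[ℝ] ℝ) (n : Space) (q y : Plane) : Space := (ℓ (y - q) ^ 3 / 6) • n

lemma hasFDerivAt_apply_sub (ℓ : Plane →L[ℝ] ℝ) (q y : Plane) :
    HasFDerivAt (fun z => ℓ (z - q)) ℓ y := by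
  have h := ℓ.hasFDerivAt.comp y ((hasFDerivAt_id y).sub_const q)
  rwa [ContinuousLinearMap.comp_id] at h

lemma hasFDerivAt_cubicMap (ℓ : Plane →L[ℝ] ℝ) (n : Space) (q y : Plane) :
    HasFDerivAt (cubicMap ℓ n q) ((ℓ (y - q) ^ 2 / 2) • ℓ.smulRight n) y := by
  have h := (((hasFDerivAt_apply_sub ℓ q y).pow 3).mul_const (1 / 6 : ℝ)).smul_const n
  refine (h.congr_fderiv ?_).congr_of_eventuallyEq (Eventually.of_forall fun z => ?_)
  · ext w : 1
    simp only [ContinuousLinearMap.smulRight_apply, smul_apply, smul_smul, smul_eq_mul]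
    congr 1
    push_cast
    ring
  · simp [cubicMap, div_eq_mul_inv]

/-- The third derivative of the cubic map. -/
def cubicForm (ℓ : Plane →L[ℝ] ℝ) (n : Space) : Plane →L[ℝ] Plane →L[ℝ] Space :=
  ℓ.smulRight (ℓ.smulRight n)

lemma eventually_fderiv_add_cubicMap (hX : ContDiffAt ℝ 3 X q)
    (hY : Y =ᶠ[𝓝 q] fun y => X y + t • cubicMap ℓ n q y) :
    fderiv ℝ Y =ᶠ[𝓝 q] fun y => fderiv ℝ X y + (t * (ℓ (y - q) ^ 2 / 2)) • ℓ.smulRight n := by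
  filter_upwards [hX.eventually (by simp), hY.eventuallyEq_nhds] with y hy hYy
  rw [hYy.fderiv_eq]
  have := (hy.differentiableAt (by simp)).hasFDerivAt.add
    ((hasFDerivAt_cubicMap ℓ n q y).const_smul t)
  rw [smul_smul] at this
  exact this.fderiv

lemma hasFDerivAt_half_sq (ℓ : Plane →L[ℝ] ℝ) (t : ℝ) (q y : Plane) :
    HasFDerivAt (fun y => t * (ℓ (y - q) ^ 2 / 2)) ((t * ℓ (y - q)) • ℓ) y := by
  have e := (((hasFDerivAt_apply_sub ℓ q y).pow 2).mul_const (1 / 2 : ℝ)).const_mul t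
  refine (e.congr_fderiv ?_).congr_of_eventuallyEq (Eventually.of_forall fun z => ?_)
  · ext w : 1
    simp only [smul_apply, smul_eq_mul]
    push_cast
    ring
  · simp [div_eq_mul_inv]

lemma eventually_fderiv_fderiv_add_cubicMap (hX : ContDiffAt ℝ 3 X q)
    (hY : Y =ᶠ[𝓝 q] fun y => X y + t • cubicMap ℓ n q y) :
    fderiv ℝ (fderiv ℝ Y) =ᶠ[𝓝 q] fun y => fderiv ℝ (fderiv ℝ X) y +
      (t * ℓ (y - q)) • cubicForm ℓ n := by
  filter_upwards [hX.eventually (by simp),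
    (eventually_fderiv_add_cubicMap hX hY).eventuallyEq_nhds] with y hy hYy
  rw [hYy.fderiv_eq]
  have e1 : DifferentiableAt ℝ (fderiv ℝ X) y :=
    (hy.fderiv_right (m := 2) (by norm_num)).differentiableAt (by simp)
  have e3 : HasFDerivAt (fun y => (t * (ℓ (y - q) ^ 2 / 2)) • ℓ.smulRight n)
      ((t * ℓ (y - q)) • cubicForm ℓ n) y := by
    refine ((hasFDerivAt_half_sq ℓ t q y).smul_const (ℓ.smulRight n)).congr_fderiv ?_
    ext w : 1
    simp only [ContinuousLinearMap.smulRight_apply, smul_apply, cubicForm, smul_smul, smul_eq_mul]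
  exact (e1.hasFDerivAt.add e3).fderiv

/-- The cubic ℓ³ vanishes to third order at `q`, so the perturbation is felt only in the third
derivative there. -/
lemma jet2_add_cubicMap (hX : ContDiffAt ℝ 3 X q)
    (hY : Y =ᶠ[𝓝 q] fun y => X y + t • cubicMap ℓ n q y) :
    fderiv ℝ Y q = fderiv ℝ X q ∧ fderiv ℝ (fderiv ℝ Y) q = fderiv ℝ (fderiv ℝ X) q := by
  rw [(eventually_fderiv_add_cubicMap hX hY).self_of_nhds,
    (eventually_fderiv_fderiv_add_cubicMap hX hY).self_of_nhds]
  constructor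
  · ext w : 1
    simp [add_apply, smul_apply]
  · ext w z : 2
    simp [add_apply, smul_apply, cubicForm]

lemma hasDerivAt_comp_line {V₁ V₂ : Type*} [NormedAddCommGroup V₁] [NormedSpace ℝ V₁]
    [NormedAddCommGroup V₂] [NormedSpace ℝ V₂] {g : V₁ × V₂ → ℝ} (hg : ContDiff ℝ 1 g)
    (a : V₁) (b C : V₂) :
    HasDerivAt (fun s : ℝ => g (a, b + s • C)) (fderiv ℝ g (a, b) (0, C)) 0 := by
  have hline : HasDerivAt (fun s : ℝ => (a, b + s • C)) ((0 : V₁), C) 0 := by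
    refine (hasDerivAt_const (0 : ℝ) a).prodMk ?_
    simpa using ((hasDerivAt_id (0 : ℝ)).smul_const C).const_add b
  refine HasFDerivAt.comp_hasDerivAt (0 : ℝ) ?_ hline
  rw [zero_smul, add_zero]
  exact (hg.differentiable (by simp) _).hasFDerivAt

/-- The first variation of a function of a map into a product. -/
lemma fderiv_comp_add {V₁ V₂ : Type*} [NormedAddCommGroup V₁] [NormedSpace ℝ V₁]
    [NormedAddCommGroup V₂] [NormedSpace ℝ V₂] {g : V₁ × V₂ → ℝ} (hg : ContDiff ℝ 1 g)
    {J J' : Plane → V₁ × V₂} (hJ : DifferentiableAt ℝ J q) {a b : Plane → ℝ} {A : V₁} {C : V₂}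
    (h₁ : ∀ᶠ y in 𝓝 q, (J' y).1 = (J y).1 + a y • A)
    (h₂ : ∀ᶠ y in 𝓝 q, (J' y).2 = (J y).2 + b y • C)
    (ha : HasFDerivAt a (0 : Plane →L[ℝ] ℝ) q) (hb : HasFDerivAt b (t • ℓ) q)
    (ha0 : a q = 0) (hb0 : b q = 0) :
    fderiv ℝ (fun y => g (J' y)) q = fderiv ℝ (fun y => g (J y)) q +
      (t * deriv (fun s : ℝ => g ((J q).1, (J q).2 + s • C)) 0) • ℓ := by
  have heq : J' =ᶠ[𝓝 q] fun y => J y + (a y • A, b y • C) := by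
    filter_upwards [h₁, h₂] with y e₁ e₂
    exact Prod.ext e₁ e₂
  have hJ' : HasFDerivAt J' (fderiv ℝ J q +
      ((0 : Plane →L[ℝ] ℝ).smulRight A).prod ((t • ℓ).smulRight C)) q :=
    (hJ.hasFDerivAt.add ((ha.smul_const A).prodMk (hb.smul_const C))).congr_of_eventuallyEq heq
  have hq : J' q = J q := by
    refine Prod.ext (h₁.self_of_nhds.trans ?_) (h₂.self_of_nhds.trans ?_)
    · rw [ha0, zero_smul, add_zero]
    · rw [hb0, zero_smul, add_zero]
  have hgJ : HasFDerivAt g (fderiv ℝ g (J q)) (J q) := (hg.differentiable (by simp) _).hasFDerivAt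
  have hgJ' : HasFDerivAt g (fderiv ℝ g (J q)) (J' q) := by rw [hq]; exact hgJ
  have h1 : HasFDerivAt (fun y => g (J' y)) _ q := hgJ'.comp q hJ'
  have h2 : HasFDerivAt (fun y => g (J y)) _ q := hgJ.comp q hJ.hasFDerivAt
  rw [h1.fderiv, h2.fderiv, (hasDerivAt_comp_line hg (J q).1 (J q).2 C).deriv]
  ext w : 1
  have e3 : ((0 : V₁), (t * ℓ w) • C) = (t * ℓ w) • ((0 : V₁), C) := by simp
  simp only [ContinuousLinearMap.comp_apply, add_apply, map_add, ContinuousLinearMap.prod_apply,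
    zero_apply, ContinuousLinearMap.smulRight_apply, smul_apply, smul_eq_mul, zero_smul]
  rw [e3, map_smul, smul_eq_mul]
  ring

/-- The derivatives of the coefficients of the quartic form along the cubic form. -/
def cubicVar0 (ℓ : Plane →L[ℝ] ℝ) (n : Space) (X : Plane → Space) (q : Plane) : ℝ :=
  deriv (fun s : ℝ => jetA0 (fderiv ℝ X q) (fderiv ℝ (fderiv ℝ X) q + s • cubicForm ℓ n)) 0

/-- The derivatives of the coefficients of the quartic form along the cubic form. -/
def cubicVar1 (ℓ : Plane →L[ℝ] ℝ) (n : Space) (X : Plane → Space) (q : Plane) : ℝ :=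
  deriv (fun s : ℝ => jetA1 (fderiv ℝ X q) (fderiv ℝ (fderiv ℝ X) q + s • cubicForm ℓ n)) 0

lemma fderiv_comp_jet2 (hX : ContDiffAt ℝ 3 X q)
    (hY : Y =ᶠ[𝓝 q] fun y => X y + t • cubicMap ℓ n q y)
    {g : (Plane →L[ℝ] Space) × (Plane →L[ℝ] Plane →L[ℝ] Space) → ℝ} (hg : ContDiff ℝ 1 g) :
    fderiv ℝ (fun y => g (jet2 Y y)) q = fderiv ℝ (fun y => g (jet2 X y)) q +
      (t * deriv (fun s : ℝ => g ((jet2 X q).1, (jet2 X q).2 + s • cubicForm ℓ n)) 0) • ℓ := by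
  refine fderiv_comp_add hg ((contDiffAt_jet2 hX).differentiableAt (by simp))
    (eventually_fderiv_add_cubicMap hX hY) (eventually_fderiv_fderiv_add_cubicMap hX hY) ?_
    ((hasFDerivAt_apply_sub ℓ q q).const_mul t) (by simp) (by simp)
  simpa using hasFDerivAt_half_sq ℓ t q q

/-- Near `q` the second derivative changes by t·ℓ(y - q) times the fixed form ℓ²n, and the first
derivative only to second order. So the coefficients vary to first order along ℓ, and the tensor
changes by a product of ℓ(w) and a quartic in v. -/
lemma symTensor_add_cubicMap (hX : ContDiffAt ℝ 3 X q)
    (hY : Y =ᶠ[𝓝 q] fun y => X y + t • cubicMap ℓ n q y) (w v : Plane) :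
    symTensor (symbol Y q) w v = symTensor (symbol X q) w v + t * ℓ w *
      quart (jetE (fderiv ℝ X q)) (jetF (fderiv ℝ X q)) (jetG (fderiv ℝ X q))
        (cubicVar0 ℓ n X q) (cubicVar1 ℓ n X q) (v 0) (v 1) := by
  have hP : fderiv ℝ Y q = fderiv ℝ X q := (jet2_add_cubicMap hX hY).1
  have h0 : fderiv ℝ (coefZ0 Y) q = fderiv ℝ (coefZ0 X) q +
      (t * cubicVar0 ℓ n X q) • ℓ := fderiv_comp_jet2 hX hY contDiff_jetA0
  have h1 : fderiv ℝ (coefZ1 Y) q = fderiv ℝ (coefZ1 X) q +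
      (t * cubicVar1 ℓ n X q) • ℓ := fderiv_comp_jet2 hX hY contDiff_jetA1
  have hE : coefE Y q = coefE X q := by simp only [coefE, firstForm, hP]
  have hF : coefF Y q = coefF X q := by simp only [coefF, firstForm, hP]
  have hG : coefG Y q = coefG X q := by simp only [coefG, firstForm, hP]
  unfold symTensor axialTensor symbol
  simp only [hE, hF, hG, h0, h1, add_apply, smul_apply, smul_eq_mul]
  rw [quart_add, ← quart_smul]
  congr 2 <;> ring

lemma symPerp_add_cubicMap (hX : ContDiffAt ℝ 3 X q)
    (hY : Y =ᶠ[𝓝 q] fun y => X y + t • cubicMap ℓ n q y) (v : Plane) :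
    symPerp (symbol Y q) v = symPerp (symbol X q) v := by
  have hP : fderiv ℝ Y q = fderiv ℝ X q := (jet2_add_cubicMap hX hY).1
  simp only [symPerp, symbol, coefE, coefF, coefG, firstForm, hP]

lemma zeroMap_add_cubicMap (hX : ContDiffAt ℝ 3 X q)
    (hY : Y =ᶠ[𝓝 q] fun y => X y + t • cubicMap ℓ n q y) :
    zeroMap Y q = zeroMap X q := by
  obtain ⟨hP, hB⟩ := jet2_add_cubicMap hX hY
  simp only [zeroMap, coefZ0, coefZ1, hP, hB]

lemma symForm_add_cubicForm (B : Plane →L[ℝ] Plane →L[ℝ] Space) (t : ℝ) (v w : Plane) :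
    symForm (B + t • cubicForm ℓ n) v w = symForm B v w + (t * (ℓ v * ℓ w)) • n := by
  have hv : ℓ v = v 0 * ℓ dX + v 1 * ℓ dY := by
    conv_lhs => rw [plane_eq v]
    simp
  have hw : ℓ w = w 0 * ℓ dX + w 1 * ℓ dY := by
    conv_lhs => rw [plane_eq w]
    simp
  simp only [symForm, cubicForm, add_apply, smul_apply, ContinuousLinearMap.smulRight_apply, hv, hw]
  module

/-- The variation of the quartic form, in a conformal frame, by a cubic map in the direction
of `frameDiff`. -/
lemma quart_cubicVar (harea : 0 < jetArea (fderiv ℝ X q)) (hz : zeroMap X q = 0)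
    {v : Plane} (hℓ : ℓ v * ℓ (symPerp (symbol X q) v) = 0) (x y : ℝ) :
    let w := symPerp (symbol X q) v
    quart (jetE (fderiv ℝ X q)) (jetF (fderiv ℝ X q)) (jetG (fderiv ℝ X q))
        (cubicVar0 ℓ (frameDiff X q v) X q) (cubicVar1 ℓ (frameDiff X q v) X q)
        ((x • v + y • w) 0) ((x • v + y • w) 1) =
      (ℓ v ^ 2 - ℓ w ^ 2) * (8 * jetE (fderiv ℝ X q) ^ 3 * √(jetArea (fderiv ℝ X q)) ^ 3 *
        normalInner (fderiv ℝ X q) (frameDiff X q v) (frameDiff X q v)) * h2 x y := by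
  intro w
  obtain ⟨hDM, hM⟩ := normalInner_frame_eq_zero harea hz v
  set P := fderiv ℝ X q with hP
  set B := fderiv ℝ (fderiv ℝ X) q with hB
  set D := frameDiff X q v with hD
  set N := frameMixed X q v with hN
  have d0 : HasDerivAt (fun t : ℝ => jetA0 P (B + t • cubicForm ℓ D)) (cubicVar0 ℓ D X q) 0 :=
    (hasDerivAt_comp_line (contDiff_jetA0 (n := 1)) P B
      (cubicForm ℓ D)).differentiableAt.hasDerivAt
  have d1 : HasDerivAt (fun t : ℝ => jetA1 P (B + t • cubicForm ℓ D)) (cubicVar1 ℓ D X q) 0 :=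
    (hasDerivAt_comp_line (contDiff_jetA1 (n := 1)) P B
      (cubicForm ℓ D)).differentiableAt.hasDerivAt
  have dL := (d0.const_mul (quart (jetE P) (jetF P) (jetG P) 1 0 ((x • v + y • w) 0)
    ((x • v + y • w) 1))).add (d1.const_mul (quart (jetE P) (jetF P) (jetG P) 0 1
      ((x • v + y • w) 0) ((x • v + y • w) 1)))
  rw [← quart_eq_linear] at dL
  set c := ℓ v ^ 2 - ℓ w ^ 2 with hc
  have dp : HasDerivAt (fun t : ℝ => 1 + t * c) c 0 := by
    simpa using ((hasDerivAt_id (0 : ℝ)).mul_const c).const_add 1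
  have dR : HasDerivAt (fun t : ℝ => -4 * jetE P ^ 3 * √(jetArea P) ^ 3 *
      (h2 x y * (4 * normalInner P N N - (1 + t * c) ^ 2 * normalInner P D D)))
      (-4 * jetE P ^ 3 * √(jetArea P) ^ 3 * (h2 x y * (0 - (2 * (1 + 0 * c) ^ (2 - 1) * c) *
        normalInner P D D))) 0 := by
    refine HasDerivAt.const_mul _ (HasDerivAt.const_mul _ (HasDerivAt.sub (hasDerivAt_const _ _) ?_))
    have := (dp.pow 2).mul_const (normalInner P D D)
    simpa using this
  have heq := dL.unique (dR.congr_of_eventuallyEq (Eventually.of_forall fun t => ?_))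
  · rw [heq]
    ring
  · have hfr := quart_jet_frame (B := B + t • cubicForm ℓ D) harea v x y
    dsimp only at hfr
    have hperp : perp (jetE P) (jetF P) (jetG P) v = w := rfl
    -- Since the vector added is a multiple of `D`, the difference is merely multiplied by 1 + tc,
    -- and `N` is unchanged because ℓ v · ℓ w = 0. Orthogonality of `D` and `N` persists, so only
    -- the coefficient of `h2` varies.
    have eD : symForm (B + t • cubicForm ℓ D) v v - symForm (B + t • cubicForm ℓ D) w w
        = (1 + t * c) • D := by
      rw [symForm_add_cubicForm, symForm_add_cubicForm]
      have : D = symForm B v v - symForm B w w := rfl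
      have e2 : symForm B v v = D + symForm B w w := by rw [this]; abel
      rw [e2]
      module
    have eN : symForm (B + t • cubicForm ℓ D) v w = N := by
      rw [symForm_add_cubicForm, hℓ, mul_zero, zero_smul, add_zero]
      rfl
    rw [hperp, eD, eN, quart_eq_linear] at hfr
    refine Eq.trans hfr ?_
    rw [normalInner_smul_left, normalInner_smul_left, normalInner_smul_right, hDM]
    ring

end Perturbation

/-! ### Normal frames and the nondegeneracy conditions on their coefficients -/

section Frame

/-- The tensor of the symbol `σ` is in normal form, with coefficients `a`, `b` and factor `κ`, in
the conformal frame that starts with `v`. -/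
def IsNormalFrame (σ : Symbol) (v : Plane) (κ a b : ℝ) : Prop :=
  ∀ s t x y : ℝ, symTensor σ (s • v + t • symPerp σ v) (x • v + y • symPerp σ v) =
    κ * (t * h1 x y + (a * s + b * t) * h2 x y)

variable {σ : Symbol} {v : Plane} {κ a b : ℝ}

lemma IsNormalFrame.symA_symB (h : IsNormalFrame σ v κ a b) (hκ : κ ≠ 0) :
    symA σ v = a ∧ symB σ v = b := axis_eq_of_frame hκ h

lemma IsNormalFrame.symTensor_perp (h : IsNormalFrame σ v κ a b) :
    symTensor σ (symPerp σ v) v = κ := by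
  have := h 0 1 1 0
  simpa [h1, h2] using this

lemma IsNormalFrame.quintic_eq (h : IsNormalFrame σ v κ a b) (t : ℝ) :
    quintic v (symPerp σ v) (σ, t) = κ * (t * h1 1 t + (a + b * t) * h2 1 t) := by
  have := h 1 t 1 t
  simpa [quintic] using this

lemma IsNormalFrame.quintic_zero (h : IsNormalFrame σ v κ a b) :
    quintic v (symPerp σ v) (σ, 0) = 0 := by
  rw [h.quintic_eq]
  simp [h2]

/-- The axis is thus a simple root of the quintic exactly when a ≠ -1, given κ ≠ 0. -/
lemma IsNormalFrame.quinticDeriv_zero (h : IsNormalFrame σ v κ a b) :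
    quinticDeriv v (symPerp σ v) (σ, 0) = κ * (1 + a) := by
  refine (hasDerivAt_quintic v (symPerp σ v) σ 0).unique ?_
  simp only [h.quintic_eq, h1, h2]
  have e : (fun t : ℝ => κ * (t * (1 ^ 4 - 6 * 1 ^ 2 * t ^ 2 + t ^ 4)
      + (a + b * t) * (1 * t * (1 ^ 2 - t ^ 2)))) =
      fun t => κ * (1 + a) * t + t ^ 2 * (κ * (b + t * (-6 - a) - b * t ^ 2 + t ^ 3)) := by
    funext t
    ring
  rw [e]
  have d1 := (hasDerivAt_id (0 : ℝ)).const_mul (κ * (1 + a))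
  have d2 : HasDerivAt (fun t : ℝ => κ * (b + t * (-6 - a) - b * t ^ 2 + t ^ 3))
      (deriv (fun t : ℝ => κ * (b + t * (-6 - a) - b * t ^ 2 + t ^ 3)) 0) 0 :=
    DifferentiableAt.hasDerivAt (by fun_prop)
  refine (d1.add (((hasDerivAt_id (0 : ℝ)).pow 2).mul d2)).congr_deriv ?_
  simp

lemma exists_frame_coordinates (hE : 0 < σ.1) (hσ : 0 < symArea σ) (hv : v ≠ 0) (u : Plane) :
    ∃ s t : ℝ, u = s • v + t • symPerp σ v :=
  ⟨_, _, eq_frame_combination (metric_self_pos hE hσ hv) rfl (metric_perp_perp hσ v)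
    (metric_perp_right _ _ _ v) u⟩

/-- A vector killed by both differentials gives a zero quartic; its coefficients t and as + bt
relative to `h1`, `h2` vanish, and a ≠ 0 makes the vector zero. -/
lemma IsNormalFrame.symDet_ne_zero (h : IsNormalFrame σ v κ a b) (hE : 0 < σ.1)
    (hσ : 0 < symArea σ) (hv : v ≠ 0) (hκ : κ ≠ 0) (ha : a ≠ 0) : symDet σ ≠ 0 := by
  intro hdet
  have hinj : ∀ u : Plane, σ.2.2.2.1 u = 0 → σ.2.2.2.2 u = 0 → u = 0 := by
    intro u h0 h1'
    obtain ⟨s, t, hu⟩ := exists_frame_coordinates hE hσ hv u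
    have hz : ∀ z, symTensor σ u z = 0 := by
      intro z
      unfold symTensor axialTensor
      rw [h0, h1']
      unfold quart
      ring
    have e1 := h s t 1 0
    have e2 := h s t 2 1
    rw [← hu, hz] at e1 e2
    have f1 := (mul_eq_zero.1 e1.symm).resolve_left hκ
    have f2 := (mul_eq_zero.1 e2.symm).resolve_left hκ
    norm_num [h1, h2] at f1 f2
    rw [f1] at f2
    have hs : s = 0 := by
      refine (mul_eq_zero.1 (?_ : a * s = 0)).resolve_left ha
      linarith
    rw [hu, hs, f1, zero_smul, zero_smul, add_zero]
  unfold symDet at hdet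
  have hcoord : ∀ c d : ℝ, c • dX + d • dY = (0 : Plane) → c = 0 ∧ d = 0 := by
    intro c d hcd
    have g0 := congrArg (fun z : Plane => z 0) hcd
    have g1 := congrArg (fun z : Plane => z 1) hcd
    simpa [dX, dY] using And.intro g0 g1
  -- A vanishing determinant puts (A₀(∂y), -A₀(∂x)) and the same vector for A₁ into the common
  -- kernel. As this kernel is zero, A₀ = A₁ = 0, which would put ∂x into it.
  have hA := hcoord _ _ (hinj (σ.2.2.2.1 dY • dX + (-σ.2.2.2.1 dX) • dY)
    (by simp; ring) (by simp; linarith))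
  have hB := hcoord _ _ (hinj (σ.2.2.2.2 dY • dX + (-σ.2.2.2.2 dX) • dY)
    (by simp; linarith) (by simp; ring))
  have hdX : dX = 0 := hinj dX (by linarith [hA.2]) (by linarith [hB.2])
  have := congrArg (fun z : Plane => z 0) hdX
  simp [dX] at this

lemma not_isTripleValue_neg (h : ¬ IsTripleValue a b) : ¬ IsTripleValue a (-b) := by
  contrapose! h
  simp only [IsTripleValue, Prod.mk.injEq] at h ⊢
  rcases h with ⟨h1, h2⟩ | ⟨h1, h2⟩ | ⟨h1, h2⟩
  · exact Or.inl ⟨h1, by linarith⟩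
  · exact Or.inr (Or.inr ⟨h1, by linarith⟩)
  · exact Or.inr (Or.inl ⟨h1, by linarith⟩)

lemma eq_zero_of_Δ_neg_one_eq_zero (h : Δ (-1) b = 0) : b = 0 := by
  rw [Δ_neg_one] at h
  have h2 : (b ^ 2 + 11) ^ 2 + 4 ≠ 0 := by positivity
  have h4 := (mul_eq_zero.1 h).resolve_right h2
  simpa using h4

/-- These conditions survive perturbation of μ and are the ones under which the sign of `Δ` decides
the type. -/
lemma isOpen_simple : IsOpen {x : ℝ × ℝ | x.1 < 0 ∧ x.1 ≠ -1 ∧ ¬ IsTripleValue x.1 x.2} := by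
  have h1 : IsOpen {x : ℝ × ℝ | x.1 < 0} := isOpen_lt continuous_fst continuous_const
  have h2 : IsOpen {x : ℝ × ℝ | x.1 ≠ -1} := isOpen_ne_fun continuous_fst continuous_const
  have h3 : IsOpen {x : ℝ × ℝ | ¬ IsTripleValue x.1 x.2} := by
    have : {x : ℝ × ℝ | ¬ IsTripleValue x.1 x.2} =
        ({(-1, 0), (-27 / 2, 5 / 2 * √5), (-27 / 2, -(5 / 2 * √5))} : Set (ℝ × ℝ))ᶜ := by
      ext x
      simp [IsTripleValue, Prod.ext_iff]
    rw [this]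
    exact (Set.toFinite _).isClosed.isOpen_compl
  exact h1.inter (h2.inter h3)

end Frame

/-! ### The types of axiumbilic points and the sign of `Δ` -/

section Types

variable {M : Type*} [TopologicalSpace M] [ChartedSpace Plane M] [IsManifold (𝓡 2) ∞ M]
  {r : ℕ∞} {μ : CrMap r M} {p m : M}

lemma HasNormalForm.exists_pos_Δ_mul_eq (hr : 3 ≤ r) (hμ : IsImmersion μ) {a b a' b' : ℝ}
    (h : HasNormalForm r μ m a b) (h' : HasNormalForm r μ m a' b') :
    ∃ κ : ℝ, 0 < κ ∧ Δ a' b' * (1 + a') ^ 2 = κ * (Δ a b * (1 + a) ^ 2) :=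
  (h.hasAxis hr hμ (mem_chart_source Plane m)).exists_pos_Δ_mul_eq
    (h'.hasAxis hr hμ (mem_chart_source Plane m))

/-- Every normal form has the same sign of Δ·(1 + a)². A form witnessing E₃ has a ≠ -1
automatically, one witnessing E₄ by definition, and both alternatives of E₃₄¹ make the product zero.
Since a ≠ -1 here, the sign passes back to `Δ a b`. -/
lemma HasNormalForm.sign_iff (hr : 3 ≤ r) (hμ : IsImmersion μ) {a b : ℝ}
    (h : HasNormalForm r μ m a b) (ha : a < 0) (ha1 : a ≠ -1) (htriple : ¬ IsTripleValue a b) :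
    (Δ a b < 0 ↔ IsE3 r μ m) ∧ (0 < Δ a b ↔ IsE4 r μ m) ∧ (Δ a b = 0 ↔ IsE34 r μ m) := by
  have hsq : ∀ {c : ℝ}, c ≠ -1 → 0 < (1 + c) ^ 2 := fun {c} hc => by
    have : 1 + c ≠ 0 := fun h0 => hc (by linarith)
    positivity
  have ha2 := hsq ha1
  refine ⟨⟨fun hΔ => ⟨a, b, h, hΔ⟩, ?_⟩, ⟨fun hΔ => ⟨a, b, h, hΔ, ha, ha1⟩, ?_⟩,
    ⟨fun hΔ => ⟨a, b, h, ha.ne, Or.inl ⟨hΔ, fun h0 => htriple (Or.inl h0),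
      fun h0 => htriple (Or.inr (Or.inl h0)), fun h0 => htriple (Or.inr (Or.inr h0))⟩⟩, ?_⟩⟩
  · rintro ⟨a', b', h', hΔ'⟩
    obtain ⟨κ, hκ, heq⟩ := h'.exists_pos_Δ_mul_eq hr hμ h
    have ha' : a' ≠ -1 := by
      rintro rfl
      rw [Δ_neg_one] at hΔ'
      have : 0 ≤ 4 * b' ^ 2 * ((b' ^ 2 + 11) ^ 2 + 4) := by positivity
      linarith
    have hneg : κ * (Δ a' b' * (1 + a') ^ 2) < 0 :=
      mul_neg_of_pos_of_neg hκ (mul_neg_of_neg_of_pos hΔ' (hsq ha'))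
    rw [← heq] at hneg
    exact neg_of_mul_neg_left hneg ha2.le
  · rintro ⟨a', b', h', hΔ', -, ha'⟩
    obtain ⟨κ, hκ, heq⟩ := h'.exists_pos_Δ_mul_eq hr hμ h
    have hpos : 0 < κ * (Δ a' b' * (1 + a') ^ 2) := mul_pos hκ (mul_pos hΔ' (hsq ha'))
    rw [← heq] at hpos
    exact pos_of_mul_pos_left hpos ha2.le
  · rintro ⟨a', b', h', -, hcase⟩
    obtain ⟨κ, -, heq⟩ := h'.exists_pos_Δ_mul_eq hr hμ h
    have h0 : Δ a' b' * (1 + a') ^ 2 = 0 := by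
      rcases hcase with ⟨hΔ', -⟩ | ⟨rfl, -⟩
      · rw [hΔ', zero_mul]
      · norm_num
    rw [h0, mul_zero] at heq
    exact (mul_eq_zero.1 heq).resolve_right ha2.ne'

/-- An axiumbilic point of type `E₃₄¹` has a normal form whose axis is simple. -/
lemma IsE34.exists_frame (hr : 3 ≤ r) (hμ : IsImmersion μ) (h : IsE34 r μ p) :
    ∃ (v : Plane) (κ a b : ℝ), v ≠ 0 ∧ κ ≠ 0 ∧
      IsNormalFrame (symbol (chartMap p μ) (extChartAt (𝓡 2) p p)) v κ a b ∧
      a ≠ 0 ∧ a ≠ -1 ∧ Δ a b = 0 ∧ ¬ IsTripleValue a b := by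
  have hpx : (extChartAt (𝓡 2) p p) ∈ (extChartAt (𝓡 2) p).target := mem_extChartAt_target p
  have hinj := injective_fderiv_chartMap (le_trans (by norm_num) hr) p μ hμ hpx
  have hW := coef_det_pos hinj
  obtain ⟨a, b, hab, ha, hcase⟩ := h
  have hax : HasAxis (coefE (chartMap p μ) (extChartAt (𝓡 2) p p))
      (coefF (chartMap p μ) (extChartAt (𝓡 2) p p)) (coefG (chartMap p μ) (extChartAt (𝓡 2) p p))
      (fderiv ℝ (coefZ0 (chartMap p μ)) (extChartAt (𝓡 2) p p))
      (fderiv ℝ (coefZ1 (chartMap p μ)) (extChartAt (𝓡 2) p p)) a b :=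
    hab.hasAxis hr hμ (mem_chart_source Plane p)
  have key : ∃ a b, HasAxis (coefE (chartMap p μ) (extChartAt (𝓡 2) p p))
      (coefF (chartMap p μ) (extChartAt (𝓡 2) p p)) (coefG (chartMap p μ) (extChartAt (𝓡 2) p p))
      (fderiv ℝ (coefZ0 (chartMap p μ)) (extChartAt (𝓡 2) p p))
      (fderiv ℝ (coefZ1 (chartMap p μ)) (extChartAt (𝓡 2) p p)) a b ∧
      a ≠ 0 ∧ a ≠ -1 ∧ Δ a b = 0 ∧ ¬ IsTripleValue a b := by
    rcases hcase with ⟨hΔ, t1, t2, t3⟩ | ⟨rfl, hb⟩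
    · refine ⟨a, b, hax, ha, ?_, hΔ, ?_⟩
      · rintro rfl
        rw [eq_zero_of_Δ_neg_one_eq_zero hΔ] at t1
        exact t1 rfl
      · rintro (h | h | h)
        exacts [t1 h, t2 h, t3 h]
    -- For a = -1 the given axis is a multiple root. At another, simple axis the comparison of
    -- discriminants transfers the zero to `Δ`, and the value of a' excludes the triple values.
    · obtain ⟨t, δ, a', hδ, e1, e3, e2, ha0, ha1, ha2⟩ := exists_simple_axis hb
      have hax' := hax.rotate (a' := a')
        (b' := (-16 * 1 * h2 1 t + (-(-1) * t + b * 1) * h1 1 t) / δ) (Or.inl one_ne_zero) hδ e1 e2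
        e3 (mul_div_cancel₀ _ hδ)
      obtain ⟨κ, -, heq⟩ := hax.exists_pos_Δ_mul_eq hax'
      have h0 : (1 + a') ^ 2 ≠ 0 := pow_ne_zero _ fun h0 => ha1 (by linarith)
      refine ⟨a', _, hax', ha0, ha1, ?_, ?_⟩
      · have h1 : ((1 : ℝ) + -1) ^ 2 = 0 := by norm_num
        rw [h1, mul_zero, mul_zero] at heq
        exact (mul_eq_zero.1 heq).resolve_right h0
      · rintro (h | h | h)
        exacts [ha1 (congrArg Prod.fst h), ha2 (congrArg Prod.fst h), ha2 (congrArg Prod.fst h)]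
  obtain ⟨a, b, hax, h1, h2, h3, h4⟩ := key
  obtain ⟨v, κ, b', hv, hκ, hb', hT⟩ := hax.exists_frame hW
  refine ⟨v, κ, a, b', hv, hκ, hT, h1, h2, ?_, ?_⟩
  · rcases hb' with rfl | rfl
    exacts [h3, by rwa [Δ_neg_right]]
  · rcases hb' with rfl | rfl
    exacts [h4, not_isTripleValue_neg h4]

variable [T2Space M]

/-- A map of class `C^r` which is, near `p`, a given smooth map of the coordinates. -/
lemma exists_crMap_eventuallyEq (r : ℕ∞) (p : M) {f : Plane → Space} (hf : ContDiff ℝ ∞ f) :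
    ∃ h : CrMap r M, chartMap p h =ᶠ[𝓝 (extChartAt (𝓡 2) p p)] f := by
  let β : SmoothBumpFunction (𝓡 2) p := Classical.arbitrary _
  have hg : ContMDiffOn (𝓡 2) 𝓘(ℝ, Space) ∞ (fun m => f (extChartAt (𝓡 2) p m))
      (chartAt Plane p).source :=
    hf.contMDiff.comp_contMDiffOn (contMDiffOn_extChartAt)
  have hβ := β.contMDiff_smul hg
  refine ⟨⟨fun m => β m • f (extChartAt (𝓡 2) p m),
    hβ.of_le (by exact_mod_cast le_top)⟩, ?_⟩
  have h1 : ∀ᶠ y in 𝓝 (extChartAt (𝓡 2) p p), β ((extChartAt (𝓡 2) p).symm y) = 1 := by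
    have := (continuousAt_extChartAt_symm (I := 𝓡 2) p).eventually
      (p := fun m => β m = 1) (by
        rw [extChartAt_to_inv]
        exact β.eventuallyEq_one)
    exact this
  filter_upwards [h1, (isOpen_target p).mem_nhds (mem_extChartAt_target p)] with y hy hyt
  change β ((extChartAt (𝓡 2) p).symm y) • f (extChartAt (𝓡 2) p ((extChartAt (𝓡 2) p).symm y)) = _
  rw [hy, one_smul, (extChartAt (𝓡 2) p).right_inv hyt]

end Types

/-! ### Dependence on the germ of the surface only -/

section Germs

variable {X Y : Plane → Space} {q : Plane}

lemma zeroMap_eventuallyEq (h : X =ᶠ[𝓝 q] Y) : zeroMap X =ᶠ[𝓝 q] zeroMap Y := by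
  filter_upwards [h.fderiv (𝕜 := ℝ), (h.fderiv (𝕜 := ℝ)).fderiv (𝕜 := ℝ)] with y h1 h2
  simp only [zeroMap, coefZ0, coefZ1, h1, h2]

lemma symbol_congr (h : X =ᶠ[𝓝 q] Y) : symbol X q = symbol Y q := by
  have hP : fderiv ℝ X q = fderiv ℝ Y q := h.fderiv_eq
  have hz := zeroMap_eventuallyEq h
  have h0 : coefZ0 X =ᶠ[𝓝 q] coefZ0 Y := hz.fun_comp Prod.fst
  have h1 : coefZ1 X =ᶠ[𝓝 q] coefZ1 Y := hz.fun_comp Prod.snd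
  simp only [symbol, coefE, coefF, coefG, firstForm, hP, h0.fderiv_eq, h1.fderiv_eq]

end Germs

/-! ### First order variation of the normal form -/

section Variation

variable {X Y : Plane → Space} {q v : Plane} {ℓ : Plane →L[ℝ] ℝ} {κ a b t : ℝ}

/-- The perturbation adds only a multiple of `h2`, with a factor linear in the first argument of the
tensor. The axis and κ are therefore kept, and a, b move by amounts proportional to ℓ v and ℓ w. -/
lemma IsNormalFrame.add_cubicMap (h : IsNormalFrame (symbol X q) v κ a b) (hκ : κ ≠ 0)
    (hX : ContDiffAt ℝ 3 X q) (hz : zeroMap X q = 0) (harea : 0 < jetArea (fderiv ℝ X q))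
    (hℓ : ℓ v * ℓ (symPerp (symbol X q) v) = 0)
    (hY : Y =ᶠ[𝓝 q] fun y => X y + t • cubicMap ℓ (frameDiff X q v) q y) :
    let w := symPerp (symbol X q) v
    let K := (ℓ v ^ 2 - ℓ w ^ 2) * (8 * jetE (fderiv ℝ X q) ^ 3 * √(jetArea (fderiv ℝ X q)) ^ 3 *
      normalInner (fderiv ℝ X q) (frameDiff X q v) (frameDiff X q v))
    IsNormalFrame (symbol Y q) v κ (a + ℓ v * K / κ * t) (b + ℓ w * K / κ * t) := by
  intro w K s' t' x y
  rw [symPerp_add_cubicMap hX hY, symTensor_add_cubicMap hX hY, h, quart_cubicVar harea hz hℓ]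
  change _ + t * ℓ (s' • v + t' • w) * (K * h2 x y) = _
  rw [map_add, map_smul, map_smul, smul_eq_mul, smul_eq_mul]
  field_simp
  ring

/-- The dual basis of a conformal frame. -/
lemma exists_dual_form {σ : Symbol} (hE : 0 < σ.1) (hσ : 0 < symArea σ) (hv : v ≠ 0) :
    (∃ ℓ : Plane →L[ℝ] ℝ, ℓ v = 1 ∧ ℓ (symPerp σ v) = 0) ∧
    ∃ ℓ : Plane →L[ℝ] ℝ, ℓ v = 0 ∧ ℓ (symPerp σ v) = 1 := by
  let form (u : Plane) : Plane →L[ℝ] ℝ :=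
    (metric σ.1 σ.2.1 σ.2.2.1 v v)⁻¹ • ((σ.1 * u 0 + σ.2.1 * u 1) • EuclideanSpace.proj 0 +
      (σ.2.1 * u 0 + σ.2.2.1 * u 1) • EuclideanSpace.proj 1)
  have hform : ∀ u z, form u z =
      (metric σ.1 σ.2.1 σ.2.2.1 v v)⁻¹ * metric σ.1 σ.2.1 σ.2.2.1 u z := by
    intro u z
    simp only [form, smul_apply, add_apply, PiLp.proj_apply, smul_eq_mul, metric]
    ring
  have hpos := (metric_self_pos hE hσ hv).ne'
  have hvw : metric σ.1 σ.2.1 σ.2.2.1 v (symPerp σ v) = 0 := metric_perp_right _ _ _ v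
  have hww : metric σ.1 σ.2.1 σ.2.2.1 (symPerp σ v) (symPerp σ v) =
    metric σ.1 σ.2.1 σ.2.2.1 v v := metric_perp_perp hσ v
  have hwv : metric σ.1 σ.2.1 σ.2.2.1 (symPerp σ v) v = 0 := by
    rw [← hvw]
    unfold metric
    ring
  refine ⟨⟨form v, ?_, ?_⟩, form (symPerp σ v), ?_, ?_⟩
  · rw [hform, inv_mul_cancel₀ hpos]
  · rw [hform, hvw, mul_zero]
  · rw [hform, hwv, mul_zero]
  · rw [hform, hww, inv_mul_cancel₀ hpos]

lemma contDiff_cubicMap (ℓ : Plane →L[ℝ] ℝ) (n : Space) (q : Plane) {m : WithTop ℕ∞} :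
    ContDiff ℝ m (cubicMap ℓ n q) := by
  unfold cubicMap
  fun_prop

/-- At a simple axis where `Δ` vanishes, some cubic variation changes `Δ` to first order. -/
lemma exists_cubicMap_Δ (h : IsNormalFrame (symbol X q) v κ a b) (hκ : κ ≠ 0) (hv : v ≠ 0)
    (hX : ContDiffAt ℝ 3 X q) (hz : zeroMap X q = 0)
    (hinj : Function.Injective (fderiv ℝ X q)) (ha : a ≠ 0) (hΔ : Δ a b = 0)
    (htriple : ¬ IsTripleValue a b) :
    ∃ (ℓ : Plane →L[ℝ] ℝ) (n : Space) (a' b' : ℝ → ℝ) (c : ℝ), c ≠ 0 ∧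
      HasDerivAt (fun t => Δ (a' t) (b' t)) c 0 ∧
      ∀ t Y, Y =ᶠ[𝓝 q] (fun y => X y + t • cubicMap ℓ n q y) →
        IsNormalFrame (symbol Y q) v κ (a' t) (b' t) := by
  have harea : 0 < jetArea (fderiv ℝ X q) := coef_det_pos hinj
  have hD := normalInner_frameDiff_ne_zero hX hz harea
    (w := symPerp (symbol X q) v) (v := v) (by rwa [h.symTensor_perp])
  have hE := jetE_ne_zero harea
  have hs : √(jetArea (fderiv ℝ X q)) ≠ 0 := (Real.sqrt_pos.2 harea).ne'
  set K := 8 * jetE (fderiv ℝ X q) ^ 3 * √(jetArea (fderiv ℝ X q)) ^ 3 *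
      normalInner (fderiv ℝ X q) (frameDiff X q v) (frameDiff X q v) with hKdef
  have hK : K ≠ 0 := by positivity
  have hlin : ∀ d : ℝ, HasDerivAt (fun t : ℝ => d * t) d 0 := fun d => by
    simpa using (hasDerivAt_id (0 : ℝ)).const_mul d
  obtain ⟨⟨ℓ, hl1, hl2⟩, ℓ', hl1', hl2'⟩ :=
    exists_dual_form (σ := symbol X q) (coefE_pos hinj) harea hv
  -- If the derivative in a is nonzero, ℓ is dual to `v` and moves a alone; otherwise ℓ is dual to
  -- `symPerp` and moves b alone. The minus sign in the second case comes from ℓ v ^ 2 - ℓ w ^ 2 =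
  -- -1.
  rcases gradient_Δ_ne_zero ha hΔ htriple with hg | hg
  · refine ⟨ℓ, frameDiff X q v, fun t => a + K / κ * t, fun _ => b, Δa a b * (K / κ),
      mul_ne_zero hg (div_ne_zero hK hκ), ?_, fun t Y hY => ?_⟩
    · exact HasDerivAt.comp (0 : ℝ) (h₂ := fun t => Δ (a + t) b) (h := fun t => K / κ * t)
        (by rw [mul_zero]; exact hasDerivAt_Δ_left a b) (hlin _)
    · have := h.add_cubicMap hκ hX hz harea (by rw [hl2, mul_zero]) hY
      simpa [hl1, hl2, ← hKdef] using this
  · refine ⟨ℓ', frameDiff X q v, fun _ => a, fun t => b + -K / κ * t, 2 * b * Δs a b * (-K / κ),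
      mul_ne_zero hg (div_ne_zero (neg_ne_zero.2 hK) hκ), ?_, fun t Y hY => ?_⟩
    · exact HasDerivAt.comp (0 : ℝ) (h₂ := fun t => Δ a (b + t)) (h := fun t => -K / κ * t)
        (by rw [mul_zero]; exact hasDerivAt_Δ_right a b) (hlin _)
    · have := h.add_cubicMap hκ hX hz harea (by rw [hl1', zero_mul]) hY
      simpa [hl1', hl2', ← hKdef] using this

end Variation

/-! ### Differentiability class of the bifurcation function -/

section Class

variable {M : Type*} [TopologicalSpace M] [ChartedSpace Plane M] [IsManifold (𝓡 2) ∞ M]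
  {r : ℕ∞} {p : M} {x₀ v w : Plane} {ε : ℝ}

/-- The discriminant of the normal form at the points `q u`, with axes `v + s u • w`. -/
def axisΔ {B : Type*} (v w : Plane) (X : B → Plane → Space) (q : B → Plane) (s : B → ℝ) (u : B) :
    ℝ :=
  Δ (symA (symbol (X u) (q u)) (v + s u • w)) (symB (symbol (X u) (q u)) (v + s u • w))

lemma contDiff_Δ {n : WithTop ℕ∞} : ContDiff ℝ n (fun x : ℝ × ℝ => Δ x.1 x.2) := by
  unfold Δ
  fun_prop

/-- The open set is fixed by 5-jets before the order n is chosen. Continuity of q and s and the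
nondegeneracy at every point of `U` give smoothness of each order on that same set. -/
lemma isOfClass_axisΔ (hr : 5 ≤ r) (hε : Metric.closedBall x₀ ε ⊆ (extChartAt (𝓡 2) p).target)
    {q : MapJet x₀ ε 5 → Plane} {s : MapJet x₀ ε 5 → ℝ} {U : Set (MapJet x₀ ε 5)} (hU : IsOpen U)
    (hq : ∀ y ∈ U, ContinuousAt q y) (hs : ∀ y ∈ U, ContinuousAt s y)
    (hball : ∀ y ∈ U, q y ∈ Metric.ball x₀ ε) (hz : ∀ y ∈ U, zeroMap (jetMap y) (q y) = 0)
    (hg : ∀ y ∈ U, quintic v w (symbol (jetMap y) (q y), s y) = 0)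
    (hdet : ∀ y ∈ U, symDet (symbol (jetMap y) (q y)) ≠ 0)
    (harea : ∀ y ∈ U, 0 < symArea (symbol (jetMap y) (q y)))
    (hgs : ∀ y ∈ U, quinticDeriv v w (symbol (jetMap y) (q y), s y) ≠ 0)
    (hden : ∀ y ∈ U, symTensor (symbol (jetMap y) (q y))
      (symPerp (symbol (jetMap y) (q y)) (v + s y • w)) (v + s y • w) ≠ 0) :
    IsOfClass (r - 3) (fun μ : CrMap r M => axisΔ v w jetMap q s (mapJet (k := 5) hε hr μ))
      (mapJet (k := 5) hε hr ⁻¹' U) := by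
  intro n hn
  -- Jets of order m + 3 give class C^m. The bound m ≥ 2 makes the order at least 5, so that
  -- truncation to the 5-jets carrying q and s is defined.
  obtain ⟨m, hm2, hnm, hmr⟩ : ∃ m : ℕ, 2 ≤ m ∧ n ≤ m ∧ ((m + 3 : ℕ) : ℕ∞) ≤ r := by
    refine ⟨max n 2, le_max_right _ _, le_max_left _ _, ?_⟩
    induction r using ENat.recTopCoe with
    | top => exact le_top
    | coe r =>
      norm_cast at hn hr ⊢
      omega
  have h5 : 5 ≤ m + 3 := by omega
  set π := truncateJet curryDeriv x₀ ε h5 with hπ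
  have hUo : IsOpen (π ⁻¹' U) := hU.preimage π.continuous
  refine exists_derivatives_of_comp (mapJet hε hmr)
    (g := axisΔ v w (fun u : MapJet x₀ ε (m + 3) => jetMap u) (q ∘ π) (s ∘ π)) hUo
    (fun μ hμ => hμ) ?_ (fun μ _ => ?_)
  · intro u hu
    refine ContDiffAt.contDiffWithinAt ?_
    have hj : ∀ u : MapJet x₀ ε (m + 3), jetMap u = jetMap (π u) := fun u =>
      (jetMap_truncateJet h5 u).symm
    have := contDiffAt_symAB_zero (n := m) (v := v) (w := w) (q := q ∘ π) (s := s ∘ π)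
      (X := fun u : MapJet x₀ ε (m + 3) => jetMap u) (u := u) (by omega)
      (contDiffAt_jetMap (hball _ hu))
      ((hq _ hu).comp π.continuous.continuousAt)
      (by
        filter_upwards [hUo.mem_nhds hu] with y hy
        rw [hj]
        exact hz _ hy)
      (by rw [hj]; exact hdet _ hu)
      ((hs _ hu).comp π.continuous.continuousAt)
      (by
        filter_upwards [hUo.mem_nhds hu] with y hy
        rw [hj]
        exact hg _ hy)
      (by rw [hj]; exact hgs _ hu) (by rw [hj]; exact harea _ hu) (by rw [hj]; exact hden _ hu)
    exact (contDiff_Δ.comp_contDiffAt u this).of_le (by exact_mod_cast hnm)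
  · simp only [axisΔ, Function.comp_apply]
    rw [← jetMap_truncateJet h5]
    rfl

end Class

/-! ### The bifurcation function -/

section Main

variable {M : Type*} [TopologicalSpace M] [ChartedSpace Plane M] [IsManifold (𝓡 2) ∞ M]
  {r : ℕ∞} {p : M} {x₀ : Plane} {ε : ℝ}

lemma jetMap_mapJet_eventuallyEq {k : ℕ}
    (hε : Metric.closedBall x₀ ε ⊆ (extChartAt (𝓡 2) p).target) (hk : (k : ℕ∞) ≤ r)
    (μ : CrMap r M) {z : Plane} (hz : z ∈ Metric.ball x₀ ε) :
    jetMap (mapJet hε hk μ) =ᶠ[𝓝 z] chartMap p μ := by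
  filter_upwards [Metric.isOpen_ball.mem_nhds hz] with y hy
  exact jetMap_mapJet hε hk μ (Metric.ball_subset_closedBall hy)

lemma isAxiumbilic_iff_zeroMap (hr : 3 ≤ r) (μ : CrMap r M) (hμ : IsImmersion μ) {m : M}
    (hm : m ∈ (extChartAt (𝓡 2) p).source) :
    IsAxiumbilic μ m ↔ zeroMap (chartMap p μ) (extChartAt (𝓡 2) p m) = 0 := by
  rw [isAxiumbilic_iff hr p μ hμ hm, zeroMap, Prod.mk_eq_zero]

/-- The normal form at an axiumbilic point with an axis in the direction `v`. -/
lemma hasNormalForm_of_symTensor (hr : 3 ≤ r) {μ : CrMap r M} (hμ : IsImmersion μ) {z v : Plane}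
    (hz : z ∈ (extChartAt (𝓡 2) p).target) (h0 : zeroMap (chartMap p μ) z = 0) (hv : v ≠ 0)
    (hroot : symTensor (symbol (chartMap p μ) z) v v = 0)
    (hne : symTensor (symbol (chartMap p μ) z) (symPerp (symbol (chartMap p μ) z) v) v ≠ 0) :
    HasNormalForm r μ ((extChartAt (𝓡 2) p).symm z) (symA (symbol (chartMap p μ) z) v)
      (symB (symbol (chartMap p μ) z) v) := by
  have hinj := injective_fderiv_chartMap (le_trans (by norm_num) hr) p μ hμ hz
  have hm := (extChartAt (𝓡 2) p).map_target hz
  have hmz : extChartAt (𝓡 2) p ((extChartAt (𝓡 2) p).symm z) = z :=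
    (extChartAt (𝓡 2) p).right_inv hz
  have hax : IsAxiumbilic μ ((extChartAt (𝓡 2) p).symm z) := by
    rwa [isAxiumbilic_iff_zeroMap hr μ hμ hm, hmz]
  refine hasNormalForm_of_hasAxis (p := p) hr hμ (by simpa using hm) hax ?_
  have hmz' : chartAt Plane p ((extChartAt (𝓡 2) p).symm z) = z := hmz
  rw [hmz']
  exact hasAxis_of_root (coefE_pos hinj) (coef_det_pos hinj) hv hroot hne

variable [T2Space M]

/-- The bifurcation function of an axiumbilic point of type `E₃₄¹`. -/
theorem IsE34.exists_bifurcation_function (hr : 5 ≤ r) {α : CrMap r M} (hα : IsImmersion α)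
    (hp : IsE34 r α p) :
    ∃ V : Set M, IsOpen V ∧ p ∈ V ∧
    ∃ W : Set (CrMap r M), IsOpen W ∧ α ∈ W ∧
    ∃ 𝓕 : CrMap r M → ℝ, IsOfClass (r - 3) 𝓕 W ∧ HasNonzeroDifferential 𝓕 α ∧
      ∀ μ ∈ W, IsImmersion μ →
        ∃ pμ ∈ V, (∀ q ∈ V, IsAxiumbilic μ q ↔ q = pμ) ∧
          (∃ a b : ℝ, HasNormalForm r μ pμ a b ∧ 𝓕 μ = Δ a b) ∧
          (𝓕 μ < 0 ↔ IsE3 r μ pμ) ∧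
          (0 < 𝓕 μ ↔ IsE4 r μ pμ) ∧
          (𝓕 μ = 0 ↔ IsE34 r μ pμ) := by
  have hr3 : 3 ≤ r := le_trans (by norm_num) hr
  have hx₀ : extChartAt (𝓡 2) p p ∈ (extChartAt (𝓡 2) p).target := mem_extChartAt_target p
  have hps : p ∈ (extChartAt (𝓡 2) p).source := mem_extChartAt_source p
  obtain ⟨v, κ, a, b, hv, hκ, hframe, ha0, ha1, hΔ, htriple⟩ := hp.exists_frame hr3 hα
  have haxα : IsAxiumbilic α p := by
    obtain ⟨_, _, h, -⟩ := hp
    exact h.1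
  have hzα := (isAxiumbilic_iff_zeroMap hr3 α hα hps).1 haxα
  obtain ⟨ε, hε0, hε⟩ := Metric.nhds_basis_closedBall.mem_iff.1 ((isOpen_target p).mem_nhds hx₀)
  set x₀ := extChartAt (𝓡 2) p p with hx₀def
  have hinj := injective_fderiv_chartMap (le_trans (by norm_num) hr) p α hα hx₀
  have hE : 0 < (symbol (chartMap p α) x₀).1 := coefE_pos hinj
  have harea : 0 < symArea (symbol (chartMap p α) x₀) := coef_det_pos hinj
  set w := symPerp (symbol (chartMap p α) x₀) v with hw
  have hmem : x₀ ∈ Metric.ball x₀ ε := Metric.mem_ball_self hε0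
  set ρ : CrMap r M →L[ℝ] MapJet x₀ ε 5 := mapJet (k := 5) hε hr with hρ
  have hgerm : ∀ μ : CrMap r M, ∀ z ∈ Metric.ball x₀ ε, jetMap (ρ μ) =ᶠ[𝓝 z] chartMap p μ :=
    fun μ z hz => jetMap_mapJet_eventuallyEq hε hr μ hz
  have hσ : ∀ μ : CrMap r M, ∀ z ∈ Metric.ball x₀ ε,
      symbol (jetMap (ρ μ)) z = symbol (chartMap p μ) z := fun μ z hz => symbol_congr (hgerm μ z hz)
  have hzero : ∀ μ : CrMap r M, ∀ z ∈ Metric.ball x₀ ε,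
      zeroMap (jetMap (ρ μ)) z = zeroMap (chartMap p μ) z :=
    fun μ z hz => (zeroMap_eventuallyEq (hgerm μ z hz)).self_of_nhds
  have hAB := hframe.symA_symB hκ
  obtain ⟨q, s, V₀, V', U, hVs, hVo, hxV, h0V', hU, hu, hfam⟩ :=
    exists_axis_family (X := fun u : MapJet x₀ ε 5 => jetMap u) (u₀ := ρ α) (v := v) (w := w) hε0
      (fun y z hz => contDiffAt_jetMap hz) ((hzero α x₀ hmem).trans hzα)
      (by rw [hσ α x₀ hmem]; exact hframe.symDet_ne_zero hE harea hv hκ ha0)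
      (by rwa [hσ α x₀ hmem]) hv
      (by rw [hσ α x₀ hmem]; exact hframe.quintic_zero)
      (by
        rw [hσ α x₀ hmem, hframe.quinticDeriv_zero]
        exact mul_ne_zero hκ fun h => ha1 (by linarith))
      (by rwa [hσ α x₀ hmem, hframe.symTensor_perp]) isOpen_simple
      (by
        rw [hσ α x₀ hmem, hAB.1, hAB.2]
        -- Negativity of a is part of the definition of E₄ and here follows from Δ = 0; as an open
        -- condition it then holds for all nearby μ.
        exact ⟨neg_of_Δ_eq_zero ha0 hΔ, ha1, htriple⟩)
  refine ⟨(extChartAt (𝓡 2) p).source ∩ extChartAt (𝓡 2) p ⁻¹' V₀,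
    isOpen_extChartAt_preimage' p hVo, ⟨hps, hxV⟩, ρ ⁻¹' U, hU.preimage ρ.continuous, hu,
    fun μ => axisΔ v w jetMap q s (ρ μ), ?_, ?_, ?_⟩
  · refine isOfClass_axisΔ hr hε hU (fun y hy => (hfam y hy).1) (fun y hy => (hfam y hy).2.1)
      (fun y hy => ?_) (fun y hy => ?_) (fun y hy => ?_) (fun y hy => ?_) (fun y hy => ?_)
      (fun y hy => ?_) (fun y hy => ?_) <;>
    obtain ⟨-, -, f1, f2, f3, f4, f5, f6, -, f7, f8, -⟩ := hfam y hy
    exacts [hVs f1, (f3 _ f1).2 rfl, (f4 _ f2).2 rfl, f5, f6, f7, f8]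
  · have hX3 : ContDiffAt ℝ 3 (chartMap p α) x₀ := contDiffAt_chartMap_nat (k := 3) hr3 α hx₀
    obtain ⟨ℓ, n, a', b', c, hc, hder, hvar⟩ :=
      exists_cubicMap_Δ hframe hκ hv hX3 hzα hinj ha0 hΔ htriple
    obtain ⟨h, hh⟩ := exists_crMap_eventuallyEq (M := M) r p (contDiff_cubicMap ℓ n x₀)
    refine ⟨h, c, hc, hder.congr_of_eventuallyEq ?_⟩
    have hcont : ContinuousAt (fun t : ℝ => ρ α + t • ρ h) 0 := by fun_prop
    have hUt : ∀ᶠ t : ℝ in 𝓝 0, ρ α + t • ρ h ∈ U :=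
      hcont.eventually_mem (hU.mem_nhds (by simpa using hu))
    filter_upwards [hUt] with t ht
    rw [← map_smul, ← map_add] at ht
    have hY : chartMap p (α + t • h : CrMap r M) =ᶠ[𝓝 x₀]
        fun y => chartMap p α y + t • cubicMap ℓ n x₀ y := by
      filter_upwards [hh] with y hy
      rw [← hy]
      rfl
    have hfr := hvar t _ hY
    have hpw : symPerp (symbol (chartMap p (α + t • h : CrMap r M)) x₀) v = w :=
      symPerp_add_cubicMap hX3 hY v
    obtain ⟨-, -, -, -, hq, hs, -⟩ := hfam _ ht
    -- Along the cubic variation x₀ stays axiumbilic and `v` stays an axis. By uniqueness these are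
    -- the point and the axis selected by q and s, so that 𝓕(α + th) = Δ(a' t, b' t) for small t.
    have hqt : x₀ = q (ρ (α + t • h)) := (hq x₀ hxV).1 (by
      rw [hzero _ _ hmem, zeroMap_add_cubicMap hX3 hY, hzα])
    rw [← hqt] at hs
    have hst : 0 = s (ρ (α + t • h)) := (hs 0 h0V').1 (by
      rw [hσ _ _ hmem, ← hpw]
      exact hfr.quintic_zero)
    obtain ⟨hA, hB⟩ := hfr.symA_symB hκ
    simp only [axisΔ]
    rw [← hqt, ← hst, zero_smul, add_zero, hσ _ _ hmem, hA, hB]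
  · intro μ hμU hμ
    obtain ⟨-, -, f1, f2, f3, f4, f5, f6, f7, -, f8, f9⟩ := hfam _ hμU
    have hb := hVs f1
    have hqt := hε (Metric.ball_subset_closedBall hb)
    have hroot := (f4 _ f2).2 rfl
    have hz0 := (f3 _ f1).2 rfl
    rw [hzero _ _ hb] at hz0
    rw [hσ _ _ hb] at hroot f8 f9
    have hnf := hasNormalForm_of_symTensor hr3 hμ hqt hz0 f7 hroot f8
    have hF : axisΔ v w jetMap q s (ρ μ) =
        Δ (symA (symbol (chartMap p μ) (q (ρ μ))) (v + s (ρ μ) • w))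
          (symB (symbol (chartMap p μ) (q (ρ μ))) (v + s (ρ μ) • w)) := by
      rw [axisΔ, hσ _ _ hb]
    have hright : extChartAt (𝓡 2) p ((extChartAt (𝓡 2) p).symm (q (ρ μ))) = q (ρ μ) :=
      (extChartAt (𝓡 2) p).right_inv hqt
    refine ⟨(extChartAt (𝓡 2) p).symm (q (ρ μ)), ⟨(extChartAt (𝓡 2) p).map_target hqt, ?_⟩,
      ?_, ⟨_, _, hnf, hF⟩, ?_⟩
    · rwa [mem_preimage, hright]
    · rintro m ⟨hm, hmV⟩
      rw [isAxiumbilic_iff_zeroMap hr3 μ hμ hm, ← hzero _ _ (hVs hmV), f3 _ hmV]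
      exact ⟨fun h => by rw [← h, (extChartAt (𝓡 2) p).left_inv hm], fun h => by rw [h, hright]⟩
    · simp only [hF]
      exact hnf.sign_iff hr3 hμ f9.1 f9.2.1 f9.2.2

end Main

end Axial

end

theorem proposition11 {M : Type*} [TopologicalSpace M] [T2Space M] [ChartedSpace Plane M]
    [IsManifold (𝓡 2) ∞ M] (r : ℕ∞) (hr : 5 ≤ r)
    (α : CrMap r M) (hα : IsImmersion α) (p : M) (hp : IsE34 r α p) :
    ∃ V : Set M, IsOpen V ∧ p ∈ V ∧
    ∃ W : Set (CrMap r M), IsOpen W ∧ α ∈ W ∧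
    ∃ 𝓕 : CrMap r M → ℝ, IsOfClass (r - 3) 𝓕 W ∧ HasNonzeroDifferential 𝓕 α ∧
      ∀ μ ∈ W, IsImmersion μ →
        ∃ pμ ∈ V, (∀ q ∈ V, IsAxiumbilic μ q ↔ q = pμ) ∧
          (∃ a b : ℝ, HasNormalForm r μ pμ a b ∧ 𝓕 μ = Δ a b) ∧
          (𝓕 μ < 0 ↔ IsE3 r μ pμ) ∧
          (0 < 𝓕 μ ↔ IsE4 r μ pμ) ∧
          (𝓕 μ = 0 ↔ IsE34 r μ pμ) := by
  exact hp.exists_bifurcation_function hr hα
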